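/- Let $n,d\ge 0$ be integers and let $\mathcal H$ be a real Hilbert space of vector fields on $\mathbb R^d$ such that the inclusions $\mathfrak X_c(\mathbb R^d)\hookrightarrow\mathcal H\hookrightarrow C^2_b(\mathbb R^d,\mathbb R^d)$ are bounded and $\mathfrak X_c(\mathbb R^d)$ (the smooth compactly supported vector fields) is dense in $\mathcal H$. Here $C^2_b$ carries the norm $\sum_{j\le 2}\|D^jX\|_\infty$. Let $K$ be the reproducing kernel of $\mathcal H$, i.e. $\langle u,K(\cdot,x)a\rangle_{\mathcal H}=\langle u(x),a\rangle$ for all $u\in\mathcal H$ and $x,a\in\mathbb R^d$. Let $\mathcal L^n(\mathbb R^d)\subset(\mathbb R^d)^n$ be the set of $n$-tuples $q=(q^1,\dots,q^n)$ of distinct points, with the Riemannian metric $g_{\mathcal H}(q)=\big(K(q^i,q^j)\big)_{i,j}^{-1}\in\mathbb R^{nd\times nd}$. Define $$\operatorname{dist}^{\mathcal H}(q,\tilde q)=\inf\Big\{\Big(\int_0^1\|v(t)\|_{\mathcal H}^2\,dt\Big)^{1/2} : \varphi^v(1,q^i)=\tilde q^i \text{ for all } i\Big\},$$ where $v$ ranges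 over the smooth curves $[0,1]\to\mathfrak X_c(\mathbb R^d)$ and $\varphi^v$ is the flow of the time-dependent field $v$ with $\varphi^v(0,x)=x$. For a $C^1$ path $\gamma:[0,1]\to\mathcal L^n(\mathbb R^d)$ put $\tilde E(\gamma)=\int_0^1\dot\gamma(t)^{T}g_{\mathcal H}(\gamma(t))\dot\gamma(t)\,dt$, and let $\widetilde{\operatorname{dist}}{}^{\mathcal H}(q,\tilde q)$ be the infimum of $\sqrt{\tilde E(\gamma)}$ over all $C^1$ paths $\gamma$ in $\mathcal L^n(\mathbb R^d)$ from $q$ to $\tilde q$ (the geodesic distance of $g_{\mathcal H}$). As usual $\inf\emptyset=+\infty$. (1) If $d\ge 2$ or $n\le 1$, then $(\mathcal L^n(\mathbb R^d),\operatorname{dist}^{\mathcal H})$ is a complete metric space. For arbitrary $n,d$, $\operatorname{dist}^{\mathcal H}$ is a complete extended metric (one that may take the value $+\infty$) on $\mathcal L^n(\mathbb R^d)$, and $\operatorname{dist}^{\mathcal H}(q,\tilde q)<\infty$ if and only if $q$ and $\tilde q$ lie in the same path component of $\mathcal L^n(\mathbb R^d)$. (2) The same statements hold for the geodesic distance $\widetilde{\operatorname{dist}}{}^{\mathcal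 H}$ of $g_{\mathcal H}$. (3) For all $q,\tilde q\in\mathcal L^n(\mathbb R^d)$, if $d\ge 2$ or $q,\tilde q$ lie in the same path component of $\mathcal L^n(\mathbb R^d)$, there is a $C^1$ path $\gamma:[0,1]\to\mathcal L^n(\mathbb R^d)$ from $q$ to $\tilde q$ that minimizes $\tilde E$ among all such paths. -/

import Mathlib

open Set Topology MeasureTheory
open scoped ENNReal NNReal ContDiff

noncomputable section

/-- Euclidean space `ℝ^d`. -/
abbrev Eucl (d : ℕ) : Type := EuclideanSpace ℝ (Fin d)

/-- The norm `‖X‖_{k,∞} = ∑_{0 ≤ j ≤ k} sup_x ‖D^j X(x)‖`, with values in `[0, ∞]`. -/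
def ckNorm {d : ℕ} (k : ℕ) (X : Eucl d → Eucl d) : ℝ≥0∞ :=
  ∑ j ∈ Finset.range (k + 1), ⨆ x, ‖iteratedFDeriv ℝ j X x‖ₑ

/-- `X` belongs to `𝔛_c(ℝ^d)`: it is a smooth vector field with compact support. -/
def IsCompactlySupportedField {d : ℕ} (X : Eucl d → Eucl d) : Prop :=
  ContDiff ℝ ∞ X ∧ HasCompactSupport X

/-- The Hilbert space `H` of vector fields on `ℝ^d` (the class `RKHS` says that the elements of `H`
are vector fields and that point evaluations are continuous, which is contained in `embeds`)
satisfies `𝔛_c(ℝ^d) ↪ H ↪ C^k_b(ℝ^d, ℝ^d)` with bounded inclusions, and `𝔛_c(ℝ^d)` is dense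
in `H`. -/
structure IsAdmissible (d k : ℕ) (H : Type*) [NormedAddCommGroup H] [InnerProductSpace ℝ H]
    [RKHS ℝ H (Eucl d) (Eucl d)] : Prop where
  /-- The elements of `H` are of class `C^k`. -/
  contDiff : ∀ u : H, ContDiff ℝ k (u : Eucl d → Eucl d)
  /-- The inclusion of `H` into `C^k_b` is bounded. -/
  embeds : ∃ C : ℝ≥0, ∀ u : H, ckNorm k (u : Eucl d → Eucl d) ≤ C * ‖u‖ₑ
  /-- `H` contains all smooth compactly supported vector fields. -/
  contains : ∀ X : Eucl d → Eucl d, IsCompactlySupportedField X →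
    ∃ u : H, (u : Eucl d → Eucl d) = X
  /-- The inclusion of `𝔛_c` into `H` is bounded: for each compact set `S`, the norm of `H` is
  dominated by some `C^m`-norm on the fields supported in `S`. -/
  bounded : ∀ S : Set (Eucl d), IsCompact S → ∃ (m : ℕ) (C : ℝ≥0), ∀ u : H,
    ContDiff ℝ ∞ (u : Eucl d → Eucl d) → tsupport (u : Eucl d → Eucl d) ⊆ S →
      ‖u‖ₑ ≤ C * ckNorm m (u : Eucl d → Eucl d)
  /-- `𝔛_c` is dense in `H`. -/
  dense : Dense {u : H | IsCompactlySupportedField (u : Eucl d → Eucl d)}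

/-- The open set of `n`-tuples of distinct points in `(ℝ^d)^n`. -/
def landmarkSet (n d : ℕ) : Set (Fin n → Eucl d) := {q | Function.Injective q}

/-- The landmark space `ℒ^n(ℝ^d)`. -/
structure Landmarks (n d : ℕ) where
  /-- The points `q^1, …, q^n`. -/
  pt : Fin n → Eucl d
  /-- The points are distinct. -/
  mem : pt ∈ landmarkSet n d

section Distances

variable {n d : ℕ} (H : Type*) [NormedAddCommGroup H] [InnerProductSpace ℝ H]
  [RKHS ℝ H (Eucl d) (Eucl d)]

variable {H} in
/-- `v` restricts to a smooth curve `[0,1] → 𝔛_c(ℝ^d)`: the supports lie in a common compact set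
and `(t, x) ↦ v(t, x)` is smooth on `[0,1] × ℝ^d`. -/
def IsSmoothControl (v : ℝ → H) : Prop :=
  (∃ S : Set (Eucl d), IsCompact S ∧ ∀ t ∈ Icc (0 : ℝ) 1, tsupport (v t : Eucl d → Eucl d) ⊆ S) ∧
    ContDiffOn ℝ ∞ (fun p : ℝ × Eucl d => v p.1 p.2) (Icc (0 : ℝ) 1 ×ˢ univ)

variable {H} in
/-- `φ` is the flow on `[0,1]` of the time-dependent vector field `v`. -/
def IsFlow (v : ℝ → H) (φ : ℝ → Eucl d → Eucl d) : Prop :=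
  (∀ x, φ 0 x = x) ∧ ∀ x, ∀ t ∈ Icc (0 : ℝ) 1,
    HasDerivWithinAt (fun s => φ s x) (v t (φ t x)) (Icc (0 : ℝ) 1) t

variable {H} in
/-- The energy `E(v) = ∫₀¹ ‖v(t)‖²_H dt`. -/
def controlEnergy (v : ℝ → H) : ℝ≥0∞ := ∫⁻ t in Icc (0 : ℝ) 1, ‖v t‖ₑ ^ 2

/-- The distance `dist^H(q, q̃) = inf { √E(v) : φ^v(1, q^i) = q̃^i for all i }`. -/
def flowDist (q q' : Landmarks n d) : ℝ≥0∞ :=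
  ⨅ (v : ℝ → H) (_ : IsSmoothControl v)
    (_ : ∃ φ : ℝ → Eucl d → Eucl d, IsFlow v φ ∧ ∀ i, φ 1 (q.pt i) = q'.pt i),
    controlEnergy v ^ (1 / 2 : ℝ)

variable [CompleteSpace H]

/-- The `nd × nd` matrix with the blocks `K(q^i, q^j)`, where `K` is the reproducing kernel
of `H`. -/
def cometric (q : Fin n → Eucl d) : Matrix (Fin n × Fin d) (Fin n × Fin d) ℝ :=
  Matrix.of fun a b => (RKHS.kernel H (q a.1) (q b.1) (EuclideanSpace.single b.2 1)) a.2

/-- The Riemannian metric `g_H(q)(h, h) = hᵀ (K(q^i, q^j))_{i,j}⁻¹ h` on landmark space. -/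
def landmarkMetric (q h : Fin n → Eucl d) : ℝ :=
  (fun a : Fin n × Fin d => h a.1 a.2) ⬝ᵥ
    ((cometric H q)⁻¹.mulVec fun a : Fin n × Fin d => h a.1 a.2)

/-- The energy `∫₀¹ g_H(γ(t))(γ'(t), γ'(t)) dt` of a path of landmarks. -/
def pathEnergy (γ : ℝ → Fin n → Eucl d) : ℝ≥0∞ :=
  ∫⁻ t in Icc (0 : ℝ) 1,
    ENNReal.ofReal (landmarkMetric H (γ t) (derivWithin γ (Icc (0 : ℝ) 1) t))

/-- `γ` restricts to a `C^1` path `[0,1] → ℒ^n(ℝ^d)` from `q` to `q'`. -/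
def IsLandmarkPath (q q' : Landmarks n d) (γ : ℝ → Fin n → Eucl d) : Prop :=
  ContDiffOn ℝ 1 γ (Icc (0 : ℝ) 1) ∧ (∀ t ∈ Icc (0 : ℝ) 1, γ t ∈ landmarkSet n d) ∧
    γ 0 = q.pt ∧ γ 1 = q'.pt

/-- The geodesic distance of the Riemannian metric `g_H` on landmark space. -/
def geodesicDist (q q' : Landmarks n d) : ℝ≥0∞ :=
  ⨅ (γ : ℝ → Fin n → Eucl d) (_ : IsLandmarkPath q q' γ), pathEnergy H γ ^ (1 / 2 : ℝ)

end Distances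

/-- `δ` is a complete extended metric (a metric that may take the value `∞`) on `X`. -/
def IsCompleteEMetric {X : Type*} (δ : X → X → ℝ≥0∞) : Prop :=
  ∃ _ : EMetricSpace X, (∀ x y : X, edist x y = δ x y) ∧ CompleteSpace X

/-- `δ` is a complete metric on `X`; in particular it takes finite values. -/
def IsCompleteMetric {X : Type*} (δ : X → X → ℝ≥0∞) : Prop :=
  ∃ _ : MetricSpace X, (∀ x y : X, edist x y = δ x y) ∧ CompleteSpace X

end

/-! Both distances coincide, and the geodesic distance is handled by the direct method of the
calculus of variations.

Let `ev_q : H → ℝ^{nd}` evaluate fields at the configuration `q`. The block matrix `K(q^i, q^j)` is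
`ev_q ev_q*`, so `g_H(q)(h, h)` is the least `‖u‖²` among the `u ∈ H` with `u(q^i) = h^i`, attained
at the horizontal lift `ev_q* g_H(q) h`. Bump fields make `ev_q` onto, hence the matrix invertible;
the embedding into `C^2_b` makes `g_H` of class `C^1` and, through the bound on `ev_q`, uniformly
coercive.

The decisive estimate excludes collisions. Along a path with horizontal lift `u(t)`, the difference
`q^i - q^j` has velocity `u(q^i) - u(q^j)`, of norm at most `C ‖u‖ |q^i - q^j|`, so finite energy
bounds `|q^i - q^j|` below by a positive multiple of its initial value. Together with coercivity,
paths of bounded energy from a given point stay in a compact set of configurations.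
`IsCompleteDomain` records just these properties (proved in `IsAdmissible.isCompleteDomain`).

In such a domain, weak compactness in `L²` and lower semicontinuity give minimizers among absolutely
continuous paths, and the first variation with the du Bois-Reymond lemma makes their velocity
continuous. So enlarging the class of paths beyond `C^1` does not lower the infimum. A Cauchy
sequence converges in the Euclidean norm and is eventually confined to a compact set, so its limit
lies in the domain. Near a point the distance is dominated by the norm, whence finiteness along
continuous paths.

For the comparison of distances, a flow moves the landmarks along a path whose energy is at most
that of the control, by minimality of the lift. Conversely, the horizontal lift of a `C^1` minimizer
is approximated by smooth compactly supported controls, and small bump fields around the moving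
landmarks correct the error, so that the end points are hit exactly (`IsAdmissible.exists_control`).
-/

noncomputable section

/-! ### Weak sequential compactness of balls in a separable Hilbert space -/

/-- Sequential Banach-Alaoglu in the dual of a separable space, transported by the Riesz
isomorphism. -/
theorem exists_subseq_tendsto_inner {V : Type*} [NormedAddCommGroup V] [InnerProductSpace ℝ V]
    [CompleteSpace V] [TopologicalSpace.SeparableSpace V] {f : ℕ → V} {r : ℝ}
    (hf : ∀ k, ‖f k‖ ≤ r) :
    ∃ (g : V) (φ : ℕ → ℕ), StrictMono φ ∧
      ∀ z, Filter.Tendsto (fun k => inner ℝ (f (φ k)) z) Filter.atTop (𝓝 (inner ℝ g z)) := by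
  have hc := WeakDual.isSeqCompact_closedBall ℝ V (0 : StrongDual ℝ V) r
  obtain ⟨ℓ, -, φ, hφ, hlim⟩ := hc
    (x := fun k => StrongDual.toWeakDual (InnerProductSpace.toDual ℝ V (f k)))
    (fun k => mem_closedBall_zero_iff.2
      (((InnerProductSpace.toDual ℝ V).norm_map (f k)).trans_le (hf k)))
  refine ⟨(InnerProductSpace.toDual ℝ V).symm (WeakDual.toStrongDual ℓ), φ, hφ, fun z => ?_⟩
  have h := (WeakDual.eval_continuous z).continuousAt.tendsto.comp hlim
  rw [InnerProductSpace.toDual_symm_apply]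
  exact h

/-! ### Primitives of square integrable curves on the unit interval -/

/-- Lebesgue measure on the unit interval. -/
abbrev unitMeasure : Measure ℝ := volume.restrict (Ioc (0 : ℝ) 1)

variable {F : Type*} [NormedAddCommGroup F] [InnerProductSpace ℝ F]

/-- The primitive of `w` that vanishes at `0`. -/
def primitive {F : Type*} [NormedAddCommGroup F] [NormedSpace ℝ F] (w : ℝ → F) (t : ℝ) : F :=
  ∫ s in (0 : ℝ)..t, w s

theorem MeasureTheory.MemLp.integrable_unit {F : Type*} [NormedAddCommGroup F] {w : ℝ → F}
    (hw : MemLp w 2 unitMeasure) : Integrable w unitMeasure :=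
  hw.integrable (by norm_num)

theorem intervalIntegrable_of_unit {F : Type*} [NormedAddCommGroup F] {w : ℝ → F}
    (hw : Integrable w unitMeasure) {a b : ℝ} (ha : a ∈ Icc (0 : ℝ) 1) (hb : b ∈ Icc (0 : ℝ) 1) :
    IntervalIntegrable w volume a b := by
  have h : IntervalIntegrable w volume 0 1 :=
    (intervalIntegrable_iff_integrableOn_Ioc_of_le zero_le_one).2 hw
  refine h.mono_set ?_
  rw [uIcc_of_le zero_le_one]
  exact uIcc_subset_Icc ha hb

theorem continuousOn_primitive_unit {F : Type*} [NormedAddCommGroup F] [NormedSpace ℝ F]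
    {w : ℝ → F} (hw : Integrable w unitMeasure) : ContinuousOn (primitive w) (Icc (0 : ℝ) 1) := by
  have h := intervalIntegral.continuousOn_primitive_interval (μ := volume) (f := w) (a := 0)
    (b := 1) (by rw [uIcc_of_le zero_le_one]; exact (integrableOn_Icc_iff_integrableOn_Ioc (by simp)).2 hw)
  rwa [uIcc_of_le zero_le_one] at h

theorem primitive_sub_primitive {F : Type*} [NormedAddCommGroup F] [NormedSpace ℝ F]
    {w : ℝ → F} (hw : Integrable w unitMeasure) {a b : ℝ} (ha : a ∈ Icc (0 : ℝ) 1)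
    (hb : b ∈ Icc (0 : ℝ) 1) : primitive w b - primitive w a = ∫ s in a..b, w s := by
  have h0 : (0 : ℝ) ∈ Icc (0 : ℝ) 1 := by simp
  exact intervalIntegral.integral_interval_sub_left (intervalIntegrable_of_unit hw h0 hb)
    (intervalIntegrable_of_unit hw h0 ha)

theorem aestronglyMeasurable_unit {X : Type*} [TopologicalSpace X]
    [TopologicalSpace.PseudoMetrizableSpace X]
    {f : ℝ → X} (hf : ContinuousOn f (Icc (0 : ℝ) 1)) : AEStronglyMeasurable f unitMeasure :=
  (hf.mono Ioc_subset_Icc_self).aestronglyMeasurable measurableSet_Ioc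

theorem ae_unit_mem : ∀ᵐ t ∂unitMeasure, t ∈ Icc (0 : ℝ) 1 :=
  (ae_restrict_mem measurableSet_Ioc).mono fun _ h => Ioc_subset_Icc_self h

theorem MeasureTheory.MemLp.clm_apply_unit {φ : ℝ → F →L[ℝ] F} {M : ℝ}
    (hφ : AEStronglyMeasurable φ unitMeasure) (hM : ∀ᵐ t ∂unitMeasure, ‖φ t‖ ≤ M)
    {a : ℝ → F} (ha : MemLp a 2 unitMeasure) : MemLp (fun t => φ t (a t)) 2 unitMeasure := by
  refine ha.of_le_mul (c := M) ?_ ?_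
  · exact (ContinuousLinearMap.id ℝ (F →L[ℝ] F)).aestronglyMeasurable_comp₂ hφ ha.1
  · filter_upwards [hM] with t ht
    exact ((φ t).le_opNorm _).trans (by gcongr)

theorem MeasureTheory.MemLp.integrable_inner_unit {a b : ℝ → F}
    (ha : MemLp a 2 unitMeasure) (hb : MemLp b 2 unitMeasure) :
    Integrable (fun t => inner ℝ (a t) (b t)) unitMeasure := by
  have h := L2.integrable_inner (𝕜 := ℝ) (ha.toLp a) (hb.toLp b)
  refine h.congr ?_
  filter_upwards [ha.coeFn_toLp, hb.coeFn_toLp] with t h1 h2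
  rw [h1, h2]

theorem MeasureTheory.MemLp.inner_toLp_unit {a b : ℝ → F}
    (ha : MemLp a 2 unitMeasure) (hb : MemLp b 2 unitMeasure) :
    inner ℝ (ha.toLp a) (hb.toLp b) = ∫ t, inner ℝ (a t) (b t) ∂unitMeasure := by
  rw [L2.inner_def]
  refine integral_congr_ae ?_
  filter_upwards [ha.coeFn_toLp, hb.coeFn_toLp] with t h1 h2
  rw [h1, h2]

theorem MeasureTheory.MemLp.integrable_sq_unit {a : ℝ → F} (ha : MemLp a 2 unitMeasure) :
    Integrable (fun t => ‖a t‖ ^ 2) unitMeasure := by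
  simpa using ha.integrable_inner_unit ha

/-- Cauchy-Schwarz against the constant `1` on `[a, b]`. The domination is asked for only on `(a,
b]`, while the right side keeps the integral over the whole unit interval, which is what energy
bounds control. -/
theorem norm_integral_sq_le {F : Type*} [NormedAddCommGroup F] [NormedSpace ℝ F] {w : ℝ → F}
    {k : ℝ → ℝ} (hk : MemLp k 2 unitMeasure) {a b : ℝ} (ha : a ∈ Icc (0 : ℝ) 1) (hb : b ∈ Icc (0 : ℝ) 1)
    (hab : a ≤ b) (hwk : ∀ᵐ t ∂volume.restrict (Ioc a b), ‖w t‖ ≤ k t) :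
    ‖∫ s in a..b, w s‖ ^ 2 ≤ (b - a) * ∫ t, k t ^ 2 ∂unitMeasure := by
  have hsub : Ioc a b ⊆ Ioc (0 : ℝ) 1 := Ioc_subset_Ioc ha.1 hb.2
  set ν := volume.restrict (Ioc a b) with hν
  have hle : ν ≤ unitMeasure := Measure.restrict_mono hsub le_rfl
  have hk' : MemLp k 2 ν := hk.mono_measure hle
  have h1 : ‖∫ s in a..b, w s‖ ≤ ∫ s, k s ∂ν := by
    rw [intervalIntegral.integral_of_le hab]
    refine (norm_integral_le_integral_norm _).trans ?_
    exact integral_mono_of_nonneg (.of_forall fun _ => norm_nonneg _)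
      (hk'.integrable (by norm_num)) hwk
  have hone : MemLp (fun _ : ℝ => (1 : ℝ)) 2 ν := memLp_const 1
  have h2 : (∫ s, k s ∂ν) ^ 2 ≤ (b - a) * ∫ s, k s ^ 2 ∂ν := by
    have h := real_inner_mul_inner_self_le (hone.toLp _) (hk'.toLp k)
    have e1 : ∀ f g : ℝ → ℝ, ∀ hf : MemLp f 2 ν, ∀ hg : MemLp g 2 ν,
        inner ℝ (hf.toLp f) (hg.toLp g) = ∫ t, f t * g t ∂ν := by
      intro f g hf hg
      rw [L2.inner_def]
      refine integral_congr_ae ?_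
      filter_upwards [hf.coeFn_toLp, hg.coeFn_toLp] with t h1 h2
      rw [h1, h2]; simp [mul_comm]
    rw [e1, e1, e1] at h
    simp only [one_mul, integral_const, smul_eq_mul, mul_one] at h
    rw [hν, measureReal_restrict_apply_univ, Real.volume_real_Ioc_of_le hab] at h
    simpa [pow_two] using h
  have h3 : ∫ s, k s ^ 2 ∂ν ≤ ∫ t, k t ^ 2 ∂unitMeasure :=
    integral_mono_measure hle (.of_forall fun _ => sq_nonneg _) hk.integrable_sq
  calc ‖∫ s in a..b, w s‖ ^ 2 ≤ (∫ s, k s ∂ν) ^ 2 := by gcongr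
    _ ≤ _ := h2
    _ ≤ _ := by gcongr

end

/-! ### Weak convergence of velocities, and the direct method -/

noncomputable section

variable {F : Type*} [NormedAddCommGroup F] [InnerProductSpace ℝ F]

theorem MeasureTheory.MemLp.norm_toLp_sq_unit {a : ℝ → F} (ha : MemLp a 2 unitMeasure) :
    ‖ha.toLp a‖ ^ 2 = ∫ t, ‖a t‖ ^ 2 ∂unitMeasure := by
  rw [← real_inner_self_eq_norm_sq, ha.inner_toLp_unit ha]
  simp

/-- The strongly convergent factor may be replaced by its limit: the error is at most `r ‖a k - a₀‖`
since the weakly convergent factor is bounded. -/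
theorem tendsto_inner_of_tendsto_of_weak {V : Type*} [NormedAddCommGroup V]
    [InnerProductSpace ℝ V] {a b : ℕ → V} {a₀ b₀ : V} {r : ℝ}
    (ha : Filter.Tendsto a Filter.atTop (𝓝 a₀)) (hr : ∀ k, ‖b k‖ ≤ r)
    (hb : ∀ z, Filter.Tendsto (fun k => inner ℝ (b k) z) Filter.atTop (𝓝 (inner ℝ b₀ z))) :
    Filter.Tendsto (fun k => inner ℝ (b k) (a k)) Filter.atTop (𝓝 (inner ℝ b₀ a₀)) := by
  have h1 : Filter.Tendsto (fun k => inner ℝ (b k) (a k - a₀)) Filter.atTop (𝓝 (0 : ℝ)) := by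
    refine squeeze_zero_norm (a := fun k => r * ‖a k - a₀‖) (fun k => ?_) ?_
    · exact (norm_inner_le_norm _ _).trans (by gcongr; exact hr k)
    · simpa using (tendsto_iff_norm_sub_tendsto_zero.1 ha).const_mul r
  simpa [inner_sub_right] using h1.add (hb a₀)

variable [FiniteDimensional ℝ F]

theorem tendsto_of_forall_inner {f : ℕ → F} {f₀ : F}
    (h : ∀ a, Filter.Tendsto (fun k => inner ℝ a (f k)) Filter.atTop (𝓝 (inner ℝ a f₀))) :
    Filter.Tendsto f Filter.atTop (𝓝 f₀) := by
  set b := stdOrthonormalBasis ℝ F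
  rw [← b.sum_repr' f₀]
  have : f = fun k => ∑ i, inner ℝ (b i) (f k) • b i := funext fun k => (b.sum_repr' (f k)).symm
  rw [this]
  exact tendsto_finsetSum _ fun i _ => (h (b i)).smul_const _

/-- Weak convergence of the derivatives implies pointwise convergence of the primitives. -/
theorem tendsto_primitive_of_weak {w : ℕ → ℝ → F} (hw : ∀ k, MemLp (w k) 2 unitMeasure)
    {g : Lp F 2 unitMeasure}
    (h : ∀ z, Filter.Tendsto (fun k => inner ℝ ((hw k).toLp (w k)) z) Filter.atTop
      (𝓝 (inner ℝ g z))) {t : ℝ} (ht : t ∈ Icc (0 : ℝ) 1) :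
    Filter.Tendsto (fun k => primitive (w k) t) Filter.atTop (𝓝 (primitive g t)) := by
  have key : ∀ (a : F) (v : ℝ → F) (u : Lp F 2 unitMeasure), u =ᵐ[unitMeasure] v →
      inner ℝ a (primitive v t) = inner ℝ u (indicatorConstLp 2 (measurableSet_Ioc (a := 0) (b := t))
        (measure_ne_top unitMeasure _) a) := by
    intro a v u huv
    rw [real_inner_comm _ u, L2.inner_indicatorConstLp_eq_inner_setIntegral, primitive,
      intervalIntegral.integral_of_le ht.1]
    congr 1
    have hm : unitMeasure.restrict (Ioc 0 t) = volume.restrict (Ioc 0 t) := by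
      rw [Measure.restrict_restrict measurableSet_Ioc,
        inter_eq_left.2 (Ioc_subset_Ioc_right ht.2)]
    rw [hm]
    refine integral_congr_ae ?_
    have := ae_restrict_of_ae (s := Ioc 0 t) huv
    rw [hm] at this
    exact Filter.EventuallyEq.symm this
  refine tendsto_of_forall_inner fun a => ?_
  simp only [fun k => key a (w k) _ (hw k).coeFn_toLp, key a g g (by rfl)]
  exact h _

/-! ### Energy paths in a Riemannian domain -/

/-- `w` is the derivative of an absolutely continuous path of finite energy in `U` from `x`
to `y`. -/
structure IsEnergyPath (U : Set F) (x y : F) (w : ℝ → F) : Prop where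
  memLp : MemLp w 2 unitMeasure
  mem : ∀ t ∈ Icc (0 : ℝ) 1, x + primitive w t ∈ U
  endpoint : x + primitive w 1 = y

/-- The energy of the path with initial point `x` and derivative `w`. -/
def domainEnergy (G : F → F →L[ℝ] F) (x : F) (w : ℝ → F) : ℝ :=
  ∫ t, inner ℝ (G (x + primitive w t) (w t)) (w t) ∂unitMeasure

/-- An open set with a coercive Riemannian metric of class `C^1` such that paths of bounded energy
from a given point stay in a compact set. -/
structure IsCompleteDomain (U : Set F) (G : F → F →L[ℝ] F) : Prop where
  isOpen : IsOpen U
  symm : ∀ x ∈ U, ∀ a b, inner ℝ (G x a) b = inner ℝ a (G x b)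
  contDiffOn : ContDiffOn ℝ 1 G U
  coercive : ∃ c > 0, ∀ x ∈ U, ∀ h, c * ‖h‖ ^ 2 ≤ inner ℝ (G x h) h
  confined : ∀ x ∈ U, ∀ R, ∃ Q ⊆ U, IsCompact Q ∧ ∀ y w, IsEnergyPath U x y w →
    domainEnergy G x w ≤ R → ∀ t ∈ Icc (0 : ℝ) 1, x + primitive w t ∈ Q

omit [FiniteDimensional ℝ F] in
theorem IsEnergyPath.continuousOn {U : Set F} {x y : F} {w : ℝ → F} (h : IsEnergyPath U x y w) :
    ContinuousOn (fun t => x + primitive w t) (Icc (0 : ℝ) 1) :=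
  continuousOn_const.add (continuousOn_primitive_unit h.memLp.integrable_unit)

omit [FiniteDimensional ℝ F] in
theorem IsEnergyPath.start_mem {U : Set F} {x y : F} {w : ℝ → F} (h : IsEnergyPath U x y w) :
    x ∈ U := by simpa [primitive] using h.mem 0 (by simp)

omit [FiniteDimensional ℝ F] in
theorem memLp_metric_apply {U : Set F} {G : F → F →L[ℝ] F} (hG : ContinuousOn G U)
    {γ w : ℝ → F} (hγ : ContinuousOn γ (Icc (0 : ℝ) 1)) (hU : ∀ t ∈ Icc (0 : ℝ) 1, γ t ∈ U)
    (hw : MemLp w 2 unitMeasure) : MemLp (fun t => G (γ t) (w t)) 2 unitMeasure := by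
  have hc : ContinuousOn (fun t => G (γ t)) (Icc (0 : ℝ) 1) := hG.comp hγ hU
  obtain ⟨M, hM⟩ := isCompact_Icc.exists_bound_of_continuousOn hc
  exact hw.clm_apply_unit (aestronglyMeasurable_unit hc) (ae_unit_mem.mono hM)

omit [FiniteDimensional ℝ F] in
theorem IsCompleteDomain.integrable_energy {U : Set F} {G : F → F →L[ℝ] F}
    (hD : IsCompleteDomain U G) {x y : F} {w : ℝ → F} (h : IsEnergyPath U x y w) :
    Integrable (fun t => inner ℝ (G (x + primitive w t) (w t)) (w t)) unitMeasure :=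
  (memLp_metric_apply hD.contDiffOn.continuousOn h.continuousOn h.mem
    h.memLp).integrable_inner_unit h.memLp

omit [FiniteDimensional ℝ F] in
theorem IsCompleteDomain.le_energy {U : Set F} {G : F → F →L[ℝ] F}
    (hD : IsCompleteDomain U G) : ∃ c > 0, ∀ x y w, IsEnergyPath U x y w →
      c * ∫ t, ‖w t‖ ^ 2 ∂unitMeasure ≤ domainEnergy G x w := by
  obtain ⟨c, hc, h⟩ := hD.coercive
  refine ⟨c, hc, fun x y w hw => ?_⟩
  rw [← integral_const_mul]
  refine integral_mono_ae (hw.memLp.integrable_sq_unit.const_mul c) (hD.integrable_energy hw) ?_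
  filter_upwards [ae_unit_mem] with t ht
  exact h _ (hw.mem t ht) _

omit [FiniteDimensional ℝ F] in
theorem IsCompleteDomain.energy_nonneg {U : Set F} {G : F → F →L[ℝ] F}
    (hD : IsCompleteDomain U G) {x y : F} {w : ℝ → F} (h : IsEnergyPath U x y w) :
    0 ≤ domainEnergy G x w := by
  obtain ⟨c, hc, hle⟩ := hD.le_energy
  exact (mul_nonneg hc.le (integral_nonneg fun _ => sq_nonneg _)).trans (hle x y w h)

/-- The direct method: if there are energy paths from `x` to `y`, one of them has least energy. -/
theorem IsCompleteDomain.exists_minimizer {U : Set F} {G : F → F →L[ℝ] F}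
    (hD : IsCompleteDomain U G) {x y : F} (hne : ∃ w, IsEnergyPath U x y w) :
    ∃ w, IsEnergyPath U x y w ∧ ∀ v, IsEnergyPath U x y v →
      domainEnergy G x w ≤ domainEnergy G x v := by
  set S : Set ℝ := domainEnergy G x '' {w | IsEnergyPath U x y w} with hS
  have hSne : S.Nonempty := by
    obtain ⟨w, hw⟩ := hne
    exact ⟨_, w, hw, rfl⟩
  have hSbdd : BddBelow S := ⟨0, by rintro _ ⟨w, hw, rfl⟩; exact hD.energy_nonneg hw⟩
  obtain ⟨e, -, helim, heS⟩ := exists_seq_tendsto_sInf hSne hSbdd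
  choose w hw hwe using heS
  simp only [mem_ofPred_eq] at hw
  obtain ⟨R, hR⟩ := helim.bddAbove_range
  have hER : ∀ k, domainEnergy G x (w k) ≤ R := fun k => by
    rw [hwe]; exact hR (mem_range_self k)
  have hxU : x ∈ U := (hw 0).start_mem
  obtain ⟨Q, hQU, hQ, hQw⟩ := hD.confined x hxU R
  obtain ⟨c, hc, hle⟩ := hD.le_energy
  have hbound : ∀ k, ‖(hw k).memLp.toLp (w k)‖ ≤ √(R / c) := fun k => by
    refine Real.le_sqrt_of_sq_le ?_
    rw [MemLp.norm_toLp_sq_unit, le_div_iff₀' hc]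
    exact (hle x y (w k) (hw k)).trans (hER k)
  have : ProperSpace F := FiniteDimensional.proper_real F
  have : Fact ((2 : ℝ≥0∞) ≠ ⊤) := ⟨by simp⟩
  obtain ⟨g, φ, hφ, hg⟩ := exists_subseq_tendsto_inner hbound
  have hgm : MemLp (g : ℝ → F) 2 unitMeasure := Lp.memLp g
  have hgg : hgm.toLp g = g := Lp.toLp_coeFn g hgm
  have hpt : ∀ t ∈ Icc (0 : ℝ) 1, Filter.Tendsto (fun k => x + primitive (w (φ k)) t) Filter.atTop
      (𝓝 (x + primitive g t)) := fun t ht =>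
    (tendsto_primitive_of_weak (fun k => (hw (φ k)).memLp) hg ht).const_add x
  have hkQ : ∀ k, ∀ t ∈ Icc (0 : ℝ) 1, x + primitive (w (φ k)) t ∈ Q := fun k =>
    hQw y _ (hw (φ k)) (hER _)
  have hgQ : ∀ t ∈ Icc (0 : ℝ) 1, x + primitive g t ∈ Q := fun t ht =>
    hQ.isClosed.mem_of_tendsto (hpt t ht) (.of_forall fun k => hkQ k t ht)
  have hgpath : IsEnergyPath U x y g := by
    refine ⟨hgm, fun t ht => hQU (hgQ t ht), ?_⟩
    refine tendsto_nhds_unique (hpt 1 (by simp)) ?_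
    simp only [(hw (φ _)).endpoint]
    exact tendsto_const_nhds
  refine ⟨g, hgpath, fun v hv => ?_⟩
  refine le_trans ?_ (csInf_le hSbdd ⟨v, hv, rfl⟩)
  have hGc := hD.contDiffOn.continuousOn
  obtain ⟨M, hM⟩ := hQ.exists_bound_of_continuousOn (hGc.mono hQU)
  have hkm : ∀ k, MemLp (fun t => G (x + primitive (w (φ k)) t) (g t)) 2 unitMeasure := fun k =>
    memLp_metric_apply hGc (hw (φ k)).continuousOn (hw (φ k)).mem hgm
  have hgm' : MemLp (fun t => G (x + primitive g t) (g t)) 2 unitMeasure :=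
    memLp_metric_apply hGc hgpath.continuousOn hgpath.mem hgm
  -- The paths converge pointwise inside `Q`, where `G` is continuous and bounded by `M`; with the
  -- velocity frozen at `g`, dominated convergence gives strong `L²` convergence.
  have hstrong : Filter.Tendsto (fun k => (hkm k).toLp _) Filter.atTop (𝓝 (hgm'.toLp _)) := by
    rw [tendsto_iff_norm_sub_tendsto_zero]
    have hsq : Filter.Tendsto (fun k => ‖(hkm k).toLp _ - hgm'.toLp _‖ ^ 2) Filter.atTop
        (𝓝 0) := by
      simp only [← MemLp.toLp_sub, MemLp.norm_toLp_sq_unit]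
      have h0 : (0 : ℝ) = ∫ _ : ℝ, (0 : ℝ) ∂unitMeasure := by simp
      rw [h0]
      refine tendsto_integral_of_dominated_convergence (fun t => (2 * M) ^ 2 * ‖g t‖ ^ 2)
        (fun k => ((hkm k).sub hgm').integrable_sq_unit.1) (hgm.integrable_sq_unit.const_mul _)
        (fun k => ?_) ?_
      · filter_upwards [ae_unit_mem] with t ht
        rw [norm_pow, norm_norm, ← mul_pow]
        gcongr
        have h1 := (G (x + primitive (w (φ k)) t)).le_of_opNorm_le (hM _ (hkQ k t ht)) (g t)
        have h2 := (G (x + primitive g t)).le_of_opNorm_le (hM _ (hgQ t ht)) (g t)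
        exact (norm_sub_le _ _).trans (by linarith)
      · filter_upwards [ae_unit_mem] with t ht
        have h1 : Filter.Tendsto (fun k => G (x + primitive (w (φ k)) t)) Filter.atTop
            (𝓝 (G (x + primitive g t))) :=
          ((hGc.mono hQU) _ (hgQ t ht)).tendsto.comp
            (tendsto_nhdsWithin_iff.2 ⟨hpt t ht, .of_forall fun k => hkQ k t ht⟩)
        have h2 := (tendsto_iff_norm_sub_tendsto_zero.1
          (((ContinuousLinearMap.apply ℝ F (g t)).continuous.tendsto _).comp h1)).pow 2
        simpa using h2
    have := hsq.sqrt
    simpa [Real.sqrt_sq (norm_nonneg _)] using this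
  have hlim1 := tendsto_inner_of_tendsto_of_weak hstrong (fun k => hbound (φ k)) hg
  have hlim2 := hstrong.inner (tendsto_const_nhds (x := g)) (𝕜 := ℝ)
  -- Lower semicontinuity through the tangent inequality `⟪G w, w⟫ ≥ 2⟪w, G g⟫ - ⟪G g, g⟫`, that is,
  -- `⟪G (w - g), w - g⟫ ≥ 0`. The right side is affine in the weakly convergent `w`, so its
  -- integral has the limit `E(g)`.
  have hlim := (hlim1.const_mul 2).sub hlim2
  have hinner : ∀ (f : ℝ → F) (hf : MemLp f 2 unitMeasure),
      inner ℝ (hf.toLp f) g = ∫ t, inner ℝ (f t) (g t) ∂unitMeasure := fun f hf => by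
    have := hf.inner_toLp_unit hgm
    rwa [hgg] at this
  have hval : inner ℝ (hgm'.toLp _) g = domainEnergy G x g := hinner _ hgm'
  rw [real_inner_comm, hval] at hlim
  have hfin : 2 * domainEnergy G x g - domainEnergy G x g = domainEnergy G x g := by ring
  rw [hfin] at hlim
  refine le_of_tendsto_of_tendsto' hlim (helim.comp hφ.tendsto_atTop) fun k => ?_
  rw [MemLp.inner_toLp_unit, hinner, Function.comp_apply, ← hwe, ← integral_const_mul,
    ← integral_sub (((hw (φ k)).memLp.integrable_inner_unit (hkm k)).const_mul 2)
      ((hkm k).integrable_inner_unit hgm)]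
  refine integral_mono_ae ((((hw (φ k)).memLp.integrable_inner_unit (hkm k)).const_mul 2).sub
      ((hkm k).integrable_inner_unit hgm)) (hD.integrable_energy (hw (φ k))) ?_
  filter_upwards [ae_unit_mem] with t ht
  obtain ⟨c', hc', hpos⟩ := hD.coercive
  have hU := (hw (φ k)).mem t ht
  have h1 := (mul_nonneg hc'.le (sq_nonneg _)).trans (hpos _ hU (w (φ k) t - g t))
  simp only [map_sub, inner_sub_left, inner_sub_right] at h1
  have h2 := hD.symm _ hU (w (φ k) t) (g t)
  have h3 := real_inner_comm (G (x + primitive (w (φ k)) t) (g t)) (w (φ k) t)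
  linarith

end

/-! ### Integration by parts and the du Bois-Reymond lemma -/

noncomputable section

/-- Integration by parts for the primitive of a curve in the dual space. -/
theorem integral_apply_primitive {F : Type*} [NormedAddCommGroup F] [NormedSpace ℝ F]
    [CompleteSpace F] {L : ℝ → F →L[ℝ] ℝ} {ζ : ℝ → F} (hL : Integrable L unitMeasure)
    (hζ : Integrable ζ unitMeasure) (h1 : primitive ζ 1 = 0) :
    ∫ t, L t (primitive ζ t) ∂unitMeasure = - ∫ s, primitive L s (ζ s) ∂unitMeasure := by
  have h0m : (0 : ℝ) ∈ Icc (0 : ℝ) 1 := by simp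
  have h1m : (1 : ℝ) ∈ Icc (0 : ℝ) 1 := by simp
  -- Fubini on the triangle `s ≤ t`: neither factor need be continuous, so the product rule for
  -- primitives is replaced by an exchange of integrals.
  set f : ℝ → ℝ → ℝ := fun t s => indicator (Iic t) (fun s => L t (ζ s)) s with hf
  have hint : Integrable (Function.uncurry f) (unitMeasure.prod unitMeasure) := by
    have h := (hL.op_fst_snd (op := fun l a => l a) (by fun_prop)
      ⟨1, fun l a => by simpa using l.le_opNorm a⟩ hζ).indicator
      (measurableSet_le (f := fun p : ℝ × ℝ => p.2) (g := fun p => p.1)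
        measurable_snd measurable_fst)
    refine h.congr (.of_forall fun p => ?_)
    simp [f, Function.uncurry, indicator]
  have hleft : ∫ t, L t (primitive ζ t) ∂unitMeasure
      = ∫ t, ∫ s, f t s ∂unitMeasure ∂unitMeasure := by
    refine integral_congr_ae ?_
    filter_upwards [ae_restrict_mem measurableSet_Ioc] with t ht
    have hi := intervalIntegrable_of_unit hζ h0m (Ioc_subset_Icc_self ht)
    simp only [f]
    rw [integral_indicator measurableSet_Iic, Measure.restrict_restrict measurableSet_Iic,
      primitive, intervalIntegral.integral_of_le ht.1.le,
      ← ContinuousLinearMap.integral_comp_comm _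
        ((intervalIntegrable_iff_integrableOn_Ioc_of_le ht.1.le).1 hi)]
    congr 2
    ext s
    simp only [mem_Ioc, mem_inter_iff, mem_Iic]
    constructor
    · exact fun h => ⟨h.2, h.1, h.2.trans ht.2⟩
    · exact fun h => ⟨h.2.1, h.1⟩
  have hright : ∫ s, ∫ t, f t s ∂unitMeasure ∂unitMeasure
      = ∫ s, (primitive L 1 - primitive L s) (ζ s) ∂unitMeasure := by
    refine integral_congr_ae ?_
    filter_upwards [ae_restrict_mem measurableSet_Ioc] with s hs
    have hi := intervalIntegrable_of_unit hL (Ioc_subset_Icc_self hs) h1m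
    rw [primitive_sub_primitive hL (Ioc_subset_Icc_self hs) h1m]
    have e : ∀ t, f t s = indicator (Ici s) (fun t => L t (ζ s)) t := fun t => by
      simp [f, indicator]
    simp only [e]
    rw [integral_indicator measurableSet_Ici, Measure.restrict_restrict measurableSet_Ici,
      intervalIntegral.integral_of_le hs.2,
      ContinuousLinearMap.integral_apply
        ((intervalIntegrable_iff_integrableOn_Ioc_of_le hs.2).1 hi),
      ← integral_Icc_eq_integral_Ioc]
    congr 2
    ext t
    simp only [mem_Ioc, mem_inter_iff, mem_Ici, mem_Icc]
    constructor
    · exact fun h => ⟨h.1, h.2.2⟩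
    · exact fun h => ⟨h.1, hs.1.trans_le h.1, h.2⟩
  have hcont := continuousOn_primitive_unit hL
  -- The boundary term disappears because `ζ` has mean zero.
  have hconst : ∫ s, primitive L 1 (ζ s) ∂unitMeasure = 0 := by
    rw [ContinuousLinearMap.integral_comp_comm _ hζ]
    have : ∫ s, ζ s ∂unitMeasure = primitive ζ 1 := by
      rw [primitive, intervalIntegral.integral_of_le zero_le_one]
    rw [this, h1, map_zero]
  have hi1 : Integrable (fun s => primitive L 1 (ζ s)) unitMeasure :=
    (primitive L 1).integrable_comp hζ
  have hi2 : Integrable (fun s => primitive L s (ζ s)) unitMeasure := by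
    obtain ⟨M, hM⟩ := isCompact_Icc.exists_bound_of_continuousOn hcont
    refine (hζ.norm.const_mul M).mono' ?_ ?_
    · exact (ContinuousLinearMap.id ℝ (F →L[ℝ] ℝ)).aestronglyMeasurable_comp₂
        (aestronglyMeasurable_unit hcont) hζ.1
    · filter_upwards [ae_unit_mem] with t ht
      exact (primitive L t).le_of_opNorm_le (hM t ht) _
  rw [hleft, integral_integral_swap hint, hright]
  simp only [sub_apply]
  rw [integral_sub hi1 hi2, hconst, zero_sub]

variable {F : Type*} [NormedAddCommGroup F] [InnerProductSpace ℝ F]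

theorem integral_unit_eq_primitive_one {F : Type*} [NormedAddCommGroup F] [NormedSpace ℝ F]
    (w : ℝ → F) : ∫ t, w t ∂unitMeasure = primitive w 1 := by
  rw [primitive, intervalIntegral.integral_of_le zero_le_one]

instance isProbabilityMeasure_unitMeasure : IsProbabilityMeasure unitMeasure :=
  ⟨by simp [unitMeasure]⟩

/-- The du Bois-Reymond lemma. -/
theorem ae_eq_const_of_forall_integral_inner_eq_zero [CompleteSpace F] {f : ℝ → F}
    (hf : MemLp f 2 unitMeasure)
    (h : ∀ ζ, MemLp ζ 2 unitMeasure → primitive ζ 1 = 0 →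
      ∫ t, inner ℝ (f t) (ζ t) ∂unitMeasure = 0) :
    ∃ c, ∀ᵐ t ∂unitMeasure, f t = c := by
  -- The constant must be the mean of `f`; then `f - c` is itself an admissible test function, and
  -- testing with it gives `∫ ‖f - c‖² = 0`.
  set c := primitive f 1 with hc
  have hζ : MemLp (fun t => f t - c) 2 unitMeasure := hf.sub (memLp_const c)
  have hmean : ∫ t, (f t - c) ∂unitMeasure = 0 := by
    rw [integral_sub hf.integrable_unit (integrable_const c), integral_unit_eq_primitive_one]
    simp [hc]
  refine ⟨c, ?_⟩
  have h1 := h _ hζ (by rw [← integral_unit_eq_primitive_one, hmean])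
  have h2 : ∫ t, inner ℝ c (f t - c) ∂unitMeasure = 0 := by
    have := (innerSL ℝ c).integral_comp_comm hζ.integrable_unit
    simp only [innerSL_apply_apply] at this
    rw [this, hmean, inner_zero_right]
  have h3 : ∫ t, ‖f t - c‖ ^ 2 ∂unitMeasure = 0 := by
    have : ∀ t, ‖f t - c‖ ^ 2 = inner ℝ (f t) (f t - c) - inner ℝ c (f t - c) := fun t => by
      rw [← inner_sub_left, real_inner_self_eq_norm_sq]
    simp only [this]
    rw [integral_sub (hf.integrable_inner_unit hζ) ((memLp_const c).integrable_inner_unit hζ),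
      h1, h2, sub_zero]
  rw [integral_eq_zero_iff_of_nonneg (fun t => sq_nonneg _) hζ.integrable_sq_unit] at h3
  filter_upwards [h3] with t ht
  simpa [sub_eq_zero] using ht

theorem isUnit_of_coercive [FiniteDimensional ℝ F] {A : F →L[ℝ] F} {c : ℝ} (hc : 0 < c)
    (h : ∀ x, c * ‖x‖ ^ 2 ≤ inner ℝ (A x) x) : IsUnit A := by
  have : CompleteSpace F := FiniteDimensional.complete ℝ F
  rw [ContinuousLinearMap.isUnit_iff_bijective]
  have hinj : Function.Injective (A : F →ₗ[ℝ] F) := by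
    rw [← LinearMap.ker_eq_bot, LinearMap.ker_eq_bot']
    intro x hx
    have hx' : A x = 0 := hx
    have := h x
    rw [hx', inner_zero_left] at this
    have h2 : ‖x‖ ^ 2 ≤ 0 := by
      by_contra hn
      push Not at hn
      nlinarith
    simpa using le_antisymm h2 (sq_nonneg _)
  exact ⟨hinj, LinearMap.injective_iff_surjective.1 hinj⟩

theorem primitive_add_smul {w ζ : ℝ → F} (hw : Integrable w unitMeasure)
    (hζ : Integrable ζ unitMeasure) (ε : ℝ) {t : ℝ} (ht : t ∈ Icc (0 : ℝ) 1) :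
    primitive (fun s => w s + ε • ζ s) t = primitive w t + ε • primitive ζ t := by
  have h0m : (0 : ℝ) ∈ Icc (0 : ℝ) 1 := by simp
  simp only [primitive]
  have h := intervalIntegral.integral_add (intervalIntegrable_of_unit hw h0m ht)
    ((intervalIntegrable_of_unit hζ h0m ht).smul ε)
  simp only [Pi.smul_apply] at h
  rw [h, intervalIntegral.integral_smul]

/-- The linear form `h ↦ ⟪D h w, w⟫`, for `D` the derivative of the metric. -/
def metricForce (D : F →L[ℝ] F →L[ℝ] F) (w : F) : F →L[ℝ] ℝ := (innerSL ℝ w).comp (D.flip w)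

theorem metricForce_apply (D : F →L[ℝ] F →L[ℝ] F) (w h : F) :
    metricForce D w h = inner ℝ (D h w) w := by
  simp [metricForce, real_inner_comm]

theorem norm_metricForce_le (D : F →L[ℝ] F →L[ℝ] F) (w : F) :
    ‖metricForce D w‖ ≤ ‖D‖ * ‖w‖ ^ 2 := by
  refine (ContinuousLinearMap.opNorm_comp_le _ _).trans ?_
  rw [innerSL_apply_norm]
  have := (D.flip).le_opNorm w
  rw [ContinuousLinearMap.opNorm_flip] at this
  calc ‖w‖ * ‖D.flip w‖ ≤ ‖w‖ * (‖D‖ * ‖w‖) := by gcongr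
    _ = _ := by ring

theorem continuous_metricForce :
    Continuous fun p : (F →L[ℝ] F →L[ℝ] F) × F => metricForce p.1 p.2 := by
  have h1 : Continuous fun p : (F →L[ℝ] F →L[ℝ] F) × F => p.1.flip p.2 :=
    (((ContinuousLinearMap.flipₗᵢ ℝ F F F).continuous.comp continuous_fst).clm_apply continuous_snd)
  exact ((innerSL ℝ).continuous.comp continuous_snd).clm_comp h1

end

/-! ### First variation of the energy and regularity of minimizers -/

noncomputable section

variable {F : Type*} [NormedAddCommGroup F] [InnerProductSpace ℝ F] [FiniteDimensional ℝ F]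

theorem aestronglyMeasurable_unit_clm {E V : Type*} [NormedAddCommGroup E] [NormedSpace ℝ E]
    [NormedAddCommGroup V] [NormedSpace ℝ V] {f : ℝ → E →L[ℝ] V}
    (hf : ContinuousOn f (Icc (0 : ℝ) 1)) : AEStronglyMeasurable f unitMeasure :=
  aestronglyMeasurable_unit hf

omit [FiniteDimensional ℝ F] in
theorem continuousOn_fderiv_metric {U : Set F} {G : F → F →L[ℝ] F}
    (hD : IsCompleteDomain U G) : ContinuousOn (fderiv ℝ G) U :=
  hD.contDiffOn.continuousOn_fderiv_of_isOpen hD.isOpen le_rfl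

omit [FiniteDimensional ℝ F] in
-- The force is quadratic in the velocity, so an `L²` velocity yields only integrability. This is
-- enough, because the regularity argument uses just its continuous primitive.
theorem integrable_metricForce {U : Set F} {G : F → F →L[ℝ] F}
    (hD : IsCompleteDomain U G) {x y : F} {w : ℝ → F} (h : IsEnergyPath U x y w) :
    Integrable (fun t => metricForce (fderiv ℝ G (x + primitive w t)) (w t)) unitMeasure := by
  have hc := (continuousOn_fderiv_metric hD).comp h.continuousOn h.mem
  obtain ⟨M, hM⟩ := isCompact_Icc.exists_bound_of_continuousOn
    (E := F →L[ℝ] F →L[ℝ] F) hc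
  refine (h.memLp.integrable_sq_unit.const_mul M).mono' ?_ ?_
  · exact continuous_metricForce.comp_aestronglyMeasurable
      ((aestronglyMeasurable_unit_clm (V := F →L[ℝ] F) hc).prodMk h.memLp.1)
  · filter_upwards [ae_unit_mem] with t ht
    refine (norm_metricForce_le _ _).trans ?_
    gcongr
    exact hM t ht

/-- The first variation of the energy vanishes at a minimizer. -/
theorem IsCompleteDomain.first_variation {U : Set F} {G : F → F →L[ℝ] F}
    (hD : IsCompleteDomain U G) {x y : F} {w : ℝ → F} (hw : IsEnergyPath U x y w)
    (hmin : ∀ v, IsEnergyPath U x y v → domainEnergy G x w ≤ domainEnergy G x v)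
    {ζ : ℝ → F} (hζ : MemLp ζ 2 unitMeasure) (hζ1 : primitive ζ 1 = 0) :
    ∫ t, metricForce (fderiv ℝ G (x + primitive w t)) (w t) (primitive ζ t) ∂unitMeasure +
      ∫ t, inner ℝ ((2 : ℝ) • G (x + primitive w t) (w t)) (ζ t) ∂unitMeasure = 0 := by
  have : ProperSpace F := FiniteDimensional.proper_real F
  have hwi := hw.memLp.integrable_unit
  have hζi := hζ.integrable_unit
  have hγc := hw.continuousOn
  have hηc := continuousOn_primitive_unit hζi
  obtain ⟨B, hB⟩ := isCompact_Icc.exists_bound_of_continuousOn hηc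
  have hB0 : 0 ≤ B := (norm_nonneg _).trans (hB 0 (by simp))
  set K := (fun t => x + primitive w t) '' Icc (0 : ℝ) 1 with hK
  have hKc : IsCompact K := isCompact_Icc.image_of_continuousOn hγc
  have hKU : K ⊆ U := by rintro _ ⟨t, ht, rfl⟩; exact hw.mem t ht
  -- A compact neighbourhood of the trace of the path: it contains all small perturbations and
  -- provides uniform bounds for `G` and its derivative.
  obtain ⟨δ, hδ, hQU⟩ := hKc.exists_cthickening_subset_open hD.isOpen hKU
  set Q := Metric.cthickening δ K with hQ
  have hQc : IsCompact Q := hKc.cthickening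
  obtain ⟨M, hM⟩ := hQc.exists_bound_of_continuousOn (hD.contDiffOn.continuousOn.mono hQU)
  obtain ⟨M', hM'⟩ := hQc.exists_bound_of_continuousOn (E := F →L[ℝ] F →L[ℝ] F)
    ((continuousOn_fderiv_metric hD).mono hQU)
  have hγQ : ∀ t ∈ Icc (0 : ℝ) 1, x + primitive w t ∈ Q := fun t ht =>
    Metric.self_subset_cthickening K ⟨t, ht, rfl⟩
  have hx0 := hγQ 0 (by simp)
  have hM0 : 0 ≤ M := (norm_nonneg _).trans (hM _ hx0)
  have hM'0 : 0 ≤ M' := (norm_nonneg _).trans (hM' _ hx0)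
  -- The `1` keeps `‖ε‖ ≤ 1`, so that perturbed velocities are bounded by `‖w‖ + ‖ζ‖`; the quotient
  -- keeps perturbed paths within `δ`, with `B + 1` in place of `B` in case `B = 0`.
  set r := min 1 (δ / (B + 1)) with hr
  have hr0 : 0 < r := lt_min one_pos (by positivity)
  have hpert : ∀ ε ∈ Metric.ball (0 : ℝ) r, ∀ t ∈ Icc (0 : ℝ) 1,
      x + primitive w t + ε • primitive ζ t ∈ Q := by
    intro ε hε t ht
    rw [mem_ball_zero_iff] at hε
    refine Metric.mem_cthickening_of_dist_le _ _ _ _ (mem_image_of_mem _ ht) ?_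
    rw [dist_eq_norm, add_sub_cancel_left, norm_smul]
    have h1 : ‖ε‖ ≤ δ / (B + 1) := hε.le.trans (min_le_right _ _)
    calc ‖ε‖ * ‖primitive ζ t‖ ≤ δ / (B + 1) * (B + 1) := by
          gcongr
          linarith [hB t ht]
      _ = δ := by field_simp
  have hpath : ∀ ε ∈ Metric.ball (0 : ℝ) r, IsEnergyPath U x y (fun t => w t + ε • ζ t) := by
    intro ε hε
    refine ⟨hw.memLp.add (hζ.const_smul ε), fun t ht => ?_, ?_⟩
    · rw [primitive_add_smul hwi hζi ε ht, ← add_assoc]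
      exact hQU (hpert ε hε t ht)
    · rw [primitive_add_smul hwi hζi ε (by simp), hζ1, smul_zero, add_zero, hw.endpoint]
  set f : ℝ → ℝ → ℝ := fun ε t =>
    inner ℝ (G (x + primitive w t + ε • primitive ζ t) (w t + ε • ζ t)) (w t + ε • ζ t) with hf
  set f' : ℝ → ℝ → ℝ := fun ε t =>
    inner ℝ (G (x + primitive w t + ε • primitive ζ t) (w t + ε • ζ t)) (ζ t) +
    inner ℝ (fderiv ℝ G (x + primitive w t + ε • primitive ζ t) (primitive ζ t) (w t + ε • ζ t) +
      G (x + primitive w t + ε • primitive ζ t) (ζ t)) (w t + ε • ζ t) with hf'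
  have hfE : ∀ ε, domainEnergy G x (fun t => w t + ε • ζ t) = ∫ t, f ε t ∂unitMeasure := by
    intro ε
    refine integral_congr_ae ?_
    filter_upwards [ae_unit_mem] with t ht
    simp only [f]
    rw [primitive_add_smul hwi hζi ε ht, ← add_assoc]
  have hfint : ∀ ε ∈ Metric.ball (0 : ℝ) r, Integrable (f ε) unitMeasure := by
    intro ε hε
    refine (hD.integrable_energy (hpath ε hε)).congr ?_
    filter_upwards [ae_unit_mem] with t ht
    simp only [f]
    rw [primitive_add_smul hwi hζi ε ht, ← add_assoc]
  have hforce := integrable_metricForce hD hw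
  have hGw := memLp_metric_apply hD.contDiffOn.continuousOn hγc hw.mem hw.memLp
  have hi1 : Integrable (fun t => metricForce (fderiv ℝ G (x + primitive w t)) (w t)
      (primitive ζ t)) unitMeasure := by
    refine (hforce.norm.mul_const B).mono' ?_ ?_
    · exact (ContinuousLinearMap.id ℝ (F →L[ℝ] ℝ)).aestronglyMeasurable_comp₂
        hforce.1 (aestronglyMeasurable_unit hηc)
    · filter_upwards [ae_unit_mem] with t ht
      exact (ContinuousLinearMap.le_opNorm _ _).trans (by gcongr; exact hB t ht)
  have hi2 : Integrable (fun t => inner ℝ ((2 : ℝ) • G (x + primitive w t) (w t)) (ζ t))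
      unitMeasure := (hGw.const_smul (2 : ℝ)).integrable_inner_unit hζ
  -- At `ε = 0` the two velocity terms agree by symmetry of `G`, hence the factor `2`.
  have hf'0 : ∀ t ∈ Icc (0 : ℝ) 1, f' 0 t =
      metricForce (fderiv ℝ G (x + primitive w t)) (w t) (primitive ζ t) +
      inner ℝ ((2 : ℝ) • G (x + primitive w t) (w t)) (ζ t) := by
    intro t ht
    simp only [f', zero_smul, add_zero, metricForce_apply, inner_add_left, inner_smul_left]
    have := hD.symm _ (hw.mem t ht) (ζ t) (w t)
    rw [this, real_inner_comm (ζ t)]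
    simp
    ring
  -- In the dominating function, `2 * M` comes from the two terms differentiating the velocity, and
  -- `M' * B` from differentiating the metric in the direction `primitive ζ`.
  have hderiv := hasDerivAt_integral_of_dominated_loc_of_deriv_le (μ := unitMeasure) (F := f)
    (F' := f') (x₀ := (0 : ℝ)) (s := Metric.ball 0 r)
    (bound := fun t => (2 * M + M' * B) * (‖w t‖ + ‖ζ t‖) ^ 2)
    (Metric.ball_mem_nhds _ hr0)
    (Filter.eventually_of_mem (Metric.ball_mem_nhds _ hr0) fun ε hε => (hfint ε hε).1)
    (hfint 0 (Metric.mem_ball_self hr0)) ?_ ?_ ?_ ?_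
  · have hloc : IsLocalMin (fun ε => ∫ t, f ε t ∂unitMeasure) 0 := by
      filter_upwards [Metric.ball_mem_nhds (0 : ℝ) hr0] with ε hε
      rw [← hfE, ← hfE]
      simpa using hmin _ (hpath ε hε)
    have hz := hloc.hasDerivAt_eq_zero hderiv.2
    rw [← integral_add hi1 hi2, ← hz]
    refine integral_congr_ae ?_
    filter_upwards [ae_unit_mem] with t ht
    exact (hf'0 t ht).symm
  · refine (hi1.add hi2).1.congr ?_
    filter_upwards [ae_unit_mem] with t ht
    exact (hf'0 t ht).symm
  · filter_upwards [ae_unit_mem] with t ht ε hε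
    have hq := hpert ε hε t ht
    have hε1 : ‖ε‖ ≤ 1 := ((mem_ball_zero_iff.1 hε).le).trans (min_le_left _ _)
    set p := x + primitive w t + ε • primitive ζ t
    have ha : ‖w t + ε • ζ t‖ ≤ ‖w t‖ + ‖ζ t‖ := by
      refine (norm_add_le _ _).trans ?_
      rw [norm_smul]
      gcongr
      exact mul_le_of_le_one_left (norm_nonneg _) hε1
    have hz : ‖ζ t‖ ≤ ‖w t‖ + ‖ζ t‖ := by linarith [norm_nonneg (w t)]
    set S := ‖w t‖ + ‖ζ t‖
    have hS : 0 ≤ S := by positivity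
    have b1 : ‖G p (w t + ε • ζ t)‖ ≤ M * S :=
      ((G p).le_of_opNorm_le (hM _ hq) _).trans (by gcongr)
    have b2 : ‖G p (ζ t)‖ ≤ M * S := ((G p).le_of_opNorm_le (hM _ hq) _).trans (by gcongr)
    have b3 : ‖fderiv ℝ G p (primitive ζ t) (w t + ε • ζ t)‖ ≤ M' * B * S := by
      refine (ContinuousLinearMap.le_opNorm _ _).trans ?_
      gcongr
      refine ((fderiv ℝ G p).le_of_opNorm_le (hM' _ hq) _).trans ?_
      gcongr
      exact hB t ht
    simp only [f']
    calc _ ≤ ‖G p (w t + ε • ζ t)‖ * ‖ζ t‖ +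
          ‖fderiv ℝ G p (primitive ζ t) (w t + ε • ζ t) + G p (ζ t)‖ * ‖w t + ε • ζ t‖ :=
        (norm_add_le _ _).trans (add_le_add (norm_inner_le_norm _ _) (norm_inner_le_norm _ _))
      _ ≤ (M * S) * S + (M' * B * S + M * S) * S := by
        gcongr
        exact (norm_add_le _ _).trans (add_le_add b3 b2)
      _ = _ := by ring
  · have hn : MemLp (fun t => ‖w t‖ + ‖ζ t‖) 2 unitMeasure := hw.memLp.norm.add hζ.norm
    have := hn.integrable_sq_unit
    simp only [Real.norm_eq_abs, sq_abs] at this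
    exact this.const_mul _
  · filter_upwards [ae_unit_mem] with t ht ε hε
    have hq := hQU (hpert ε hε t ht)
    have hp : HasDerivAt (fun ε : ℝ => x + primitive w t + ε • primitive ζ t)
        (primitive ζ t) ε := by
      simpa using ((hasDerivAt_id ε).smul_const (primitive ζ t)).const_add (x + primitive w t)
    have ha : HasDerivAt (fun ε : ℝ => w t + ε • ζ t) (ζ t) ε := by
      simpa using ((hasDerivAt_id ε).smul_const (ζ t)).const_add (w t)
    have hG : HasFDerivAt G (fderiv ℝ G (x + primitive w t + ε • primitive ζ t))
        (x + primitive w t + ε • primitive ζ t) :=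
      ((hD.contDiffOn.differentiableOn one_ne_zero).differentiableAt
        (hD.isOpen.mem_nhds hq)).hasFDerivAt
    have hGp : HasDerivAt (fun ε : ℝ => G (x + primitive w t + ε • primitive ζ t))
        (fderiv ℝ G (x + primitive w t + ε • primitive ζ t) (primitive ζ t)) ε :=
      hG.comp_hasDerivAt ε hp
    have hGa := hGp.clm_apply ha
    exact hGa.inner ℝ ha

omit [FiniteDimensional ℝ F] in
theorem primitive_congr {v w : ℝ → F} (h : v =ᵐ[unitMeasure] w) {t : ℝ}
    (ht : t ∈ Icc (0 : ℝ) 1) : primitive v t = primitive w t := by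
  refine intervalIntegral.integral_congr_ae ?_
  rw [uIoc_of_le ht.1]
  have := (ae_restrict_iff' measurableSet_Ioc).1 h
  filter_upwards [this] with s hs hst
  exact hs ⟨hst.1, hst.2.trans ht.2⟩

omit [FiniteDimensional ℝ F] in
theorem IsEnergyPath.congr {U : Set F} {x y : F} {v w : ℝ → F} (hw : IsEnergyPath U x y w)
    (h : w =ᵐ[unitMeasure] v) : IsEnergyPath U x y v := by
  refine ⟨hw.memLp.ae_eq h, fun t ht => ?_, ?_⟩
  · rw [← primitive_congr h ht]; exact hw.mem t ht
  · rw [← primitive_congr h (by simp)]; exact hw.endpoint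

omit [FiniteDimensional ℝ F] in
theorem domainEnergy_congr {G : F → F →L[ℝ] F} {x : F} {v w : ℝ → F}
    (h : w =ᵐ[unitMeasure] v) : domainEnergy G x w = domainEnergy G x v := by
  refine integral_congr_ae ?_
  filter_upwards [h, ae_unit_mem] with t ht htm
  rw [primitive_congr h htm, ht]

/-- Minimizers of the energy have continuous derivatives. -/
theorem IsCompleteDomain.exists_continuous_minimizer {U : Set F} {G : F → F →L[ℝ] F}
    (hD : IsCompleteDomain U G) {x y : F} (hne : ∃ w, IsEnergyPath U x y w) :
    ∃ w, IsEnergyPath U x y w ∧ ContinuousOn w (Icc 0 1) ∧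
      ∀ v, IsEnergyPath U x y v → domainEnergy G x w ≤ domainEnergy G x v := by
  obtain ⟨w, hw, hmin⟩ := hD.exists_minimizer hne
  have : CompleteSpace F := FiniteDimensional.complete ℝ F
  set L : ℝ → F →L[ℝ] ℝ := fun t => metricForce (fderiv ℝ G (x + primitive w t)) (w t)
  have hL : Integrable L unitMeasure := integrable_metricForce hD hw
  -- The Riesz representative of the integrated force. Integrating by parts turns the first
  -- variation into orthogonality of `2 G w - b` to all mean-zero `ζ`, so the momentum `2 G w` is
  -- `b` plus a constant.
  set b : ℝ → F := fun t => (InnerProductSpace.toDual ℝ F).symm (primitive L t)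
  have hb : ContinuousOn b (Icc 0 1) :=
    (InnerProductSpace.toDual ℝ F).symm.continuous.comp_continuousOn
      (continuousOn_primitive_unit hL)
  have hbm : MemLp b 2 unitMeasure := by
    obtain ⟨M, hM⟩ := isCompact_Icc.exists_bound_of_continuousOn hb
    exact MemLp.of_bound (aestronglyMeasurable_unit hb) M (ae_unit_mem.mono hM)
  have hGc := hD.contDiffOn.continuousOn
  have hGw : MemLp (fun t => (2 : ℝ) • G (x + primitive w t) (w t)) 2 unitMeasure :=
    (memLp_metric_apply hGc hw.continuousOn hw.mem hw.memLp).const_smul (2 : ℝ)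
  obtain ⟨c, hc⟩ := ae_eq_const_of_forall_integral_inner_eq_zero (hGw.sub hbm)
    fun ζ hζ hζ1 => by
      have h1 := hD.first_variation hw hmin hζ hζ1
      rw [integral_apply_primitive hL hζ.integrable_unit hζ1] at h1
      simp only [Pi.sub_apply, inner_sub_left]
      rw [integral_sub (hGw.integrable_inner_unit hζ) (hbm.integrable_inner_unit hζ)]
      have h2 : ∀ t, inner ℝ (b t) (ζ t) = primitive L t (ζ t) := fun t =>
        InnerProductSpace.toDual_symm_apply
      simp only [h2]
      linarith
  -- The integrated Euler-Lagrange equation solved for the velocity. Everything on the right is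
  -- continuous, so `v` is a continuous representative of `w`.
  set v : ℝ → F := fun t => (2⁻¹ : ℝ) • Ring.inverse (G (x + primitive w t)) (b t + c)
  have hunit : ∀ z ∈ U, IsUnit (G z) := fun z hz => by
    obtain ⟨c', hc', h⟩ := hD.coercive
    exact isUnit_of_coercive hc' (h z hz)
  have hinv : ContinuousOn (fun z => Ring.inverse (G z)) U := fun z hz => by
    obtain ⟨u, hu⟩ := hunit z hz
    have := NormedRing.inverse_continuousAt u
    rw [hu] at this
    exact this.comp_continuousWithinAt (hGc z hz)
  have hv : ContinuousOn v (Icc 0 1) :=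
    ((hinv.comp hw.continuousOn hw.mem).clm_apply (hb.add continuousOn_const)).const_smul _
  have hwv : w =ᵐ[unitMeasure] v := by
    filter_upwards [hc, ae_unit_mem] with t ht htm
    have hbc : b t + c = (2 : ℝ) • G (x + primitive w t) (w t) := by
      rw [← ht]; simp
    simp only [v]
    rw [hbc, map_smul, smul_smul, ← mul_apply_eq_comp,
      Ring.inverse_mul_cancel _ (hunit _ (hw.mem t htm))]
    simp
  refine ⟨v, hw.congr hwv, hv, fun u hu => ?_⟩
  rw [← domainEnergy_congr hwv]
  exact hmin u hu

end

/-! ### The distance of a complete Riemannian domain -/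

noncomputable section

variable {F : Type*} [NormedAddCommGroup F] [InnerProductSpace ℝ F]

theorem MeasureTheory.MemLp.of_continuousOn_unit {F : Type*} [NormedAddCommGroup F] {w : ℝ → F}
    (h : ContinuousOn w (Icc 0 1)) : MemLp w 2 unitMeasure := by
  obtain ⟨M, hM⟩ := isCompact_Icc.exists_bound_of_continuousOn h
  exact MemLp.of_bound (aestronglyMeasurable_unit h) M (ae_unit_mem.mono hM)

theorem domainEnergy_eq_intervalIntegral (G : F → F →L[ℝ] F) (x : F) (w : ℝ → F) :
    domainEnergy G x w = ∫ t in (0 : ℝ)..1, inner ℝ (G (x + primitive w t) (w t)) (w t) := by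
  rw [domainEnergy, intervalIntegral.integral_of_le zero_le_one]

/-- Reversal of energy paths. -/
theorem IsEnergyPath.reverse {U : Set F} {G : F → F →L[ℝ] F} {x y : F} {w : ℝ → F}
    (hw : IsEnergyPath U x y w) (hc : ContinuousOn w (Icc 0 1)) :
    ∃ v, IsEnergyPath U y x v ∧ domainEnergy G y v = domainEnergy G x w := by
  have h1m : (1 : ℝ) ∈ Icc (0 : ℝ) 1 := by simp
  have hmaps : ∀ t ∈ Icc (0 : ℝ) 1, 1 - t ∈ Icc (0 : ℝ) 1 := fun t ht =>
    ⟨by linarith [ht.2], by linarith [ht.1]⟩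
  have hprim : ∀ t ∈ Icc (0 : ℝ) 1,
      y + primitive (fun t => -w (1 - t)) t = x + primitive w (1 - t) := by
    intro t ht
    have h1 : primitive (fun t => -w (1 - t)) t = - ∫ s in (1 - t)..1, w s := by
      simp only [primitive, intervalIntegral.integral_neg]
      rw [intervalIntegral.integral_comp_sub_left (fun s => w s) 1, sub_zero]
    rw [h1, ← primitive_sub_primitive hw.memLp.integrable_unit (hmaps t ht) h1m, ← hw.endpoint]
    abel
  refine ⟨fun t => -w (1 - t), ⟨?_, fun t ht => ?_, ?_⟩, ?_⟩
  · exact MemLp.of_continuousOn_unit (hc.comp (by fun_prop) hmaps).neg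
  · rw [hprim t ht]
    exact hw.mem _ (hmaps t ht)
  · rw [hprim 1 h1m]
    simp [primitive]
  · rw [domainEnergy_eq_intervalIntegral, domainEnergy_eq_intervalIntegral]
    have h2 := intervalIntegral.integral_comp_sub_left (a := 0) (b := 1)
      (fun t => inner ℝ (G (x + primitive w t) (w t)) (w t)) 1
    simp only [sub_self, sub_zero] at h2
    rw [← h2]
    refine intervalIntegral.integral_congr fun t ht => ?_
    rw [uIcc_of_le zero_le_one] at ht
    rw [hprim t ht]
    simp

/-- Concatenation of energy paths at time `s`. -/
theorem IsEnergyPath.concat {U : Set F} {G : F → F →L[ℝ] F} (hD : IsCompleteDomain U G)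
    {x y z : F} {v w : ℝ → F}
    (hv : IsEnergyPath U x y v) (hvc : ContinuousOn v (Icc 0 1))
    (hw : IsEnergyPath U y z w) (hwc : ContinuousOn w (Icc 0 1)) {s : ℝ} (hs0 : 0 < s)
    (hs1 : s < 1) :
    ∃ u, IsEnergyPath U x z u ∧
      domainEnergy G x u = s⁻¹ * domainEnergy G x v + (1 - s)⁻¹ * domainEnergy G y w := by
  have hs1' : 0 < 1 - s := by linarith
  have h0m : (0 : ℝ) ∈ Icc (0 : ℝ) 1 := by simp
  have h1m : (1 : ℝ) ∈ Icc (0 : ℝ) 1 := by simp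
  have hsm : s ∈ Icc (0 : ℝ) 1 := ⟨hs0.le, hs1.le⟩
  set f : ℝ → F := fun t => s⁻¹ • v (t / s) with hf
  set g : ℝ → F := fun t => (1 - s)⁻¹ • w (t / (1 - s) - s / (1 - s)) with hg
  have hmapf : ∀ t ∈ Icc 0 s, t / s ∈ Icc (0 : ℝ) 1 := fun t ht =>
    ⟨div_nonneg ht.1 hs0.le, (div_le_one hs0).2 ht.2⟩
  have hmapg : ∀ t ∈ Icc s 1, t / (1 - s) - s / (1 - s) ∈ Icc (0 : ℝ) 1 := fun t ht => by
    rw [← sub_div]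
    exact ⟨div_nonneg (by linarith [ht.1]) hs1'.le, (div_le_one hs1').2 (by linarith [ht.2])⟩
  have hfc : ContinuousOn f (Icc 0 s) := (hvc.comp (by fun_prop) hmapf).const_smul _
  have hgc : ContinuousOn g (Icc s 1) := (hwc.comp (by fun_prop) hmapg).const_smul _
  -- The velocity may jump at `s`, which the class of energy paths permits and the class of `C^1`
  -- paths would not.
  set u : ℝ → F := (Iic s).piecewise f g with hu
  have huf : ∀ t ∈ Iic s, u t = f t := fun t ht => piecewise_eq_of_mem _ _ _ ht
  have hug : ∀ t, s < t → u t = g t := fun t ht =>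
    piecewise_eq_of_notMem _ _ _ (by simpa using ht)
  have hum : MemLp u 2 unitMeasure := by
    obtain ⟨A, hA⟩ := isCompact_Icc.exists_bound_of_continuousOn hfc
    obtain ⟨B, hB⟩ := isCompact_Icc.exists_bound_of_continuousOn hgc
    refine MemLp.of_bound (C := max A B) ?_ ?_
    · refine AEStronglyMeasurable.piecewise measurableSet_Iic ?_ ?_
      · rw [Measure.restrict_restrict measurableSet_Iic]
        refine (hfc.mono ?_).aestronglyMeasurable (measurableSet_Iic.inter measurableSet_Ioc)
        exact fun t ht => ⟨ht.2.1.le, ht.1⟩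
      · rw [Measure.restrict_restrict measurableSet_Iic.compl]
        refine (hgc.mono ?_).aestronglyMeasurable (measurableSet_Iic.compl.inter measurableSet_Ioc)
        exact fun t ht => ⟨(lt_of_not_ge (notMem_of_mem_compl ht.1)).le, ht.2.2⟩
    · filter_upwards [ae_unit_mem] with t ht
      rcases le_or_gt t s with h | h
      · rw [huf t h]; exact (hA t ⟨ht.1, h⟩).trans (le_max_left _ _)
      · rw [hug t h]; exact (hB t ⟨h.le, ht.2⟩).trans (le_max_right _ _)
  have hui := hum.integrable_unit
  have hp1 : ∀ t ∈ Icc 0 s, x + primitive u t = x + primitive v (t / s) := by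
    intro t ht
    congr 1
    have e1 : primitive u t = ∫ r in (0 : ℝ)..t, f r := by
      refine intervalIntegral.integral_congr fun r hr => huf r ?_
      rw [uIcc_of_le ht.1] at hr
      exact hr.2.trans ht.2
    rw [e1]
    simp only [f, intervalIntegral.integral_smul]
    rw [intervalIntegral.inv_smul_integral_comp_div, zero_div, primitive]
  have hp2 : ∀ t ∈ Icc s 1, x + primitive u t =
      y + primitive w (t / (1 - s) - s / (1 - s)) := by
    intro t ht
    have htm : t ∈ Icc (0 : ℝ) 1 := ⟨hs0.le.trans ht.1, ht.2⟩
    have e1 : primitive u t - primitive u s = ∫ r in s..t, g r := by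
      rw [primitive_sub_primitive hui hsm htm]
      refine intervalIntegral.integral_congr_ae (.of_forall fun r hr => hug r ?_)
      rw [uIoc_of_le ht.1] at hr
      exact hr.1
    have e2 : ∫ r in s..t, g r = primitive w (t / (1 - s) - s / (1 - s)) := by
      simp only [g, intervalIntegral.integral_smul]
      rw [intervalIntegral.inv_smul_integral_comp_div_sub, sub_self, primitive]
    have e3 := hp1 s ⟨hs0.le, le_rfl⟩
    rw [div_self hs0.ne', hv.endpoint] at e3
    rw [← e2, ← e1, ← e3]
    abel
  have hpath : IsEnergyPath U x z u := by
    refine ⟨hum, fun t ht => ?_, ?_⟩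
    · rcases le_or_gt t s with h | h
      · rw [hp1 t ⟨ht.1, h⟩]; exact hv.mem _ (hmapf t ⟨ht.1, h⟩)
      · rw [hp2 t ⟨h.le, ht.2⟩]; exact hw.mem _ (hmapg t ⟨h.le, ht.2⟩)
    · rw [hp2 1 ⟨hs1.le, le_rfl⟩, ← sub_div, div_self hs1'.ne', hw.endpoint]
  refine ⟨u, hpath, ?_⟩
  have hint := hD.integrable_energy hpath
  rw [domainEnergy_eq_intervalIntegral, ← intervalIntegral.integral_add_adjacent_intervals
    (intervalIntegrable_of_unit hint h0m hsm) (intervalIntegrable_of_unit hint hsm h1m)]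
  congr 1
  · have h := intervalIntegral.inv_smul_integral_comp_div (a := 0) (b := s)
      (fun t => inner ℝ (G (x + primitive v t) (v t)) (v t)) s
    rw [zero_div, div_self hs0.ne'] at h
    rw [domainEnergy_eq_intervalIntegral, ← h, smul_eq_mul,
      ← intervalIntegral.integral_const_mul, ← intervalIntegral.integral_const_mul]
    refine intervalIntegral.integral_congr fun t ht => ?_
    rw [uIcc_of_le hs0.le] at ht
    rw [hp1 t ht, huf t ht.2]
    simp only [f, map_smul, inner_smul_left, inner_smul_right]
    simp
  · have h := intervalIntegral.inv_smul_integral_comp_div_sub (a := s) (b := 1)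
      (fun t => inner ℝ (G (y + primitive w t) (w t)) (w t)) (1 - s) (s / (1 - s))
    rw [sub_self, ← sub_div, div_self hs1'.ne'] at h
    rw [domainEnergy_eq_intervalIntegral, ← h, smul_eq_mul,
      ← intervalIntegral.integral_const_mul, ← intervalIntegral.integral_const_mul]
    refine intervalIntegral.integral_congr_ae (.of_forall fun t ht => ?_)
    rw [uIoc_of_le hs1.le] at ht
    rw [hp2 t ⟨ht.1.le, ht.2⟩, hug t ht.1]
    simp only [g, map_smul, inner_smul_left, inner_smul_right]
    simp

/-- The geodesic distance of a Riemannian domain, computed with energy paths. -/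
def domainDist (U : Set F) (G : F → F →L[ℝ] F) (x y : F) : ℝ≥0∞ :=
  ⨅ (w : ℝ → F) (_ : IsEnergyPath U x y w), ENNReal.ofReal √(domainEnergy G x w)

theorem domainDist_le {U : Set F} (G : F → F →L[ℝ] F) {x y : F} {w : ℝ → F}
    (hw : IsEnergyPath U x y w) : domainDist U G x y ≤ ENNReal.ofReal √(domainEnergy G x w) :=
  iInf₂_le w hw

theorem domainDist_ne_top_iff {U : Set F} {G : F → F →L[ℝ] F} {x y : F} :
    domainDist U G x y ≠ ⊤ ↔ ∃ w, IsEnergyPath U x y w := by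
  constructor
  · intro h
    by_contra hn
    push Not at hn
    exact h (by simp [domainDist, hn])
  · rintro ⟨w, hw⟩
    exact ne_top_of_le_ne_top ENNReal.ofReal_ne_top (domainDist_le G hw)

theorem domainDist_self {U : Set F} (G : F → F →L[ℝ] F) {x : F} (hx : x ∈ U) :
    domainDist U G x x = 0 := by
  have h : IsEnergyPath U x x (0 : ℝ → F) := ⟨MemLp.zero, by simp [primitive, hx],
    by simp [primitive]⟩
  have := domainDist_le G h
  simpa [domainEnergy] using this

variable [FiniteDimensional ℝ F]

theorem IsCompleteDomain.exists_domainDist_eq {U : Set F} {G : F → F →L[ℝ] F}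
    (hD : IsCompleteDomain U G) {x y : F} (h : domainDist U G x y ≠ ⊤) :
    ∃ w, IsEnergyPath U x y w ∧ ContinuousOn w (Icc 0 1) ∧
      domainDist U G x y = ENNReal.ofReal √(domainEnergy G x w) := by
  obtain ⟨w, hw, hc, hmin⟩ := hD.exists_continuous_minimizer (domainDist_ne_top_iff.1 h)
  refine ⟨w, hw, hc, le_antisymm (domainDist_le G hw) (le_iInf₂ fun v hv => ?_)⟩
  exact ENNReal.ofReal_le_ofReal (Real.sqrt_le_sqrt (hmin v hv))

/-- A finite distance is attained by a path with continuous velocity, which can be reversed at equal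
energy. -/
theorem IsCompleteDomain.domainDist_comm_le {U : Set F} {G : F → F →L[ℝ] F}
    (hD : IsCompleteDomain U G) (x y : F) : domainDist U G y x ≤ domainDist U G x y := by
  by_cases h : domainDist U G x y = ⊤
  · rw [h]; exact le_top
  · obtain ⟨w, hw, hc, heq⟩ := hD.exists_domainDist_eq h
    obtain ⟨v, hv, hvw⟩ := hw.reverse (G := G) hc
    rw [heq, ← hvw]
    exact domainDist_le G hv

theorem IsCompleteDomain.domainDist_comm {U : Set F} {G : F → F →L[ℝ] F}
    (hD : IsCompleteDomain U G) (x y : F) : domainDist U G x y = domainDist U G y x :=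
  le_antisymm (hD.domainDist_comm_le y x) (hD.domainDist_comm_le x y)

omit [FiniteDimensional ℝ F] in
-- Coercivity and Cauchy-Schwarz. This separates points and makes Cauchy sequences for the distance
-- Cauchy in the Euclidean norm.
theorem IsCompleteDomain.exists_mul_norm_sub_le {U : Set F} {G : F → F →L[ℝ] F}
    (hD : IsCompleteDomain U G) :
    ∃ c > 0, ∀ x y, ENNReal.ofReal (c * ‖y - x‖) ≤ domainDist U G x y := by
  obtain ⟨c, hc, hle⟩ := hD.le_energy
  refine ⟨√c, Real.sqrt_pos.2 hc, fun x y => le_iInf₂ fun w hw => ?_⟩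
  refine ENNReal.ofReal_le_ofReal (Real.le_sqrt_of_sq_le ?_)
  rw [mul_pow, Real.sq_sqrt hc.le]
  refine le_trans ?_ (hle x y w hw)
  gcongr
  have h := norm_integral_sq_le (w := w) (k := fun t => ‖w t‖) hw.memLp.norm
    (a := 0) (b := 1) (by simp) (by simp) zero_le_one (.of_forall fun _ => le_rfl)
  rw [sub_zero, one_mul] at h
  rwa [← hw.endpoint, add_sub_cancel_left]

omit [FiniteDimensional ℝ F] in
theorem IsCompleteDomain.eq_of_domainDist_eq_zero {U : Set F} {G : F → F →L[ℝ] F}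
    (hD : IsCompleteDomain U G) {x y : F} (h : domainDist U G x y = 0) : x = y := by
  obtain ⟨c, hc, hle⟩ := hD.exists_mul_norm_sub_le
  have := hle x y
  rw [h, nonpos_iff_eq_zero, ENNReal.ofReal_eq_zero] at this
  have h0 : ‖y - x‖ ≤ 0 := by
    by_contra hn
    push Not at hn
    nlinarith
  exact (sub_eq_zero.1 (norm_le_zero_iff.1 h0)).symm

/-- Joining minimizers of energies `a²` and `b²` at time `s` costs `a²/s + b²/(1-s)`, which equals
`(a+b)²` for `s = a/(a+b)`. Vanishing distances are treated first because `s` must lie strictly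
between `0` and `1`. -/
theorem IsCompleteDomain.domainDist_triangle {U : Set F} {G : F → F →L[ℝ] F}
    (hD : IsCompleteDomain U G) (x y z : F) :
    domainDist U G x z ≤ domainDist U G x y + domainDist U G y z := by
  by_cases h1 : domainDist U G x y = ⊤
  · simp [h1]
  by_cases h2 : domainDist U G y z = ⊤
  · simp [h2]
  by_cases h3 : domainDist U G x y = 0
  · rw [hD.eq_of_domainDist_eq_zero h3]
    exact le_add_self
  by_cases h4 : domainDist U G y z = 0
  · rw [hD.eq_of_domainDist_eq_zero h4]
    exact le_self_add
  obtain ⟨v, hv, hvc, hveq⟩ := hD.exists_domainDist_eq h1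
  obtain ⟨w, hw, hwc, hweq⟩ := hD.exists_domainDist_eq h2
  rw [hveq, hweq, ← ENNReal.ofReal_add (Real.sqrt_nonneg _) (Real.sqrt_nonneg _)]
  rw [hveq, ENNReal.ofReal_eq_zero, not_le] at h3
  rw [hweq, ENNReal.ofReal_eq_zero, not_le] at h4
  have hE1 := Real.sq_sqrt (hD.energy_nonneg hv)
  have hE2 := Real.sq_sqrt (hD.energy_nonneg hw)
  set a := √(domainEnergy G x v)
  set b := √(domainEnergy G y w)
  have hab : 0 < a + b := by positivity
  obtain ⟨u, hu, huE⟩ := hv.concat hD hvc hw hwc (s := a / (a + b)) (by positivity)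
    ((div_lt_one hab).2 (by linarith))
  refine (domainDist_le G hu).trans (ENNReal.ofReal_le_ofReal ?_)
  rw [huE, ← hE1, ← hE2]
  refine Real.sqrt_le_iff.2 ⟨hab.le, le_of_eq ?_⟩
  have : 1 - a / (a + b) = b / (a + b) := by field_simp; ring
  rw [this]
  field_simp

/-- Near a point of the domain, the distance is dominated by the norm. -/
theorem IsCompleteDomain.exists_domainDist_le {U : Set F} {G : F → F →L[ℝ] F}
    (hD : IsCompleteDomain U G) {x : F} (hx : x ∈ U) :
    ∃ r > 0, ∃ M : ℝ, Metric.ball x r ⊆ U ∧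
      ∀ y ∈ Metric.ball x r, domainDist U G x y ≤ ENNReal.ofReal (M * ‖y - x‖) := by
  have hGx := (hD.contDiffOn.continuousOn.continuousAt (hD.isOpen.mem_nhds hx)).norm
  obtain ⟨r, hr, hball⟩ := Metric.mem_nhds_iff.1 (Filter.inter_mem (hD.isOpen.mem_nhds hx)
    (hGx.eventually (eventually_le_nhds (lt_add_one ‖G x‖))))
  set M := ‖G x‖ + 1
  have hM : 0 ≤ M := by positivity
  refine ⟨r, hr, √M, fun y hy => (hball hy).1, fun y hy => ?_⟩
  have hprim : ∀ t, primitive (fun _ => y - x) t = t • (y - x) := fun t => by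
    simp [primitive, smul_sub]
  have hmem : ∀ t ∈ Icc (0 : ℝ) 1, x + primitive (fun _ => y - x) t ∈ Metric.ball x r := by
    intro t ht
    rw [hprim]
    exact (convex_ball x r).add_smul_sub_mem (Metric.mem_ball_self hr) hy ht
  have hpath : IsEnergyPath U x y (fun _ => y - x) :=
    ⟨memLp_const _, fun t ht => (hball (hmem t ht)).1, by rw [hprim]; simp⟩
  refine (domainDist_le G hpath).trans (ENNReal.ofReal_le_ofReal ?_)
  refine Real.sqrt_le_iff.2 ⟨by positivity, ?_⟩
  rw [mul_pow, Real.sq_sqrt hM]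
  calc domainEnergy G x (fun _ => y - x) ≤ ∫ _, M * ‖y - x‖ ^ 2 ∂unitMeasure := by
        refine integral_mono_ae (hD.integrable_energy hpath) (integrable_const _) ?_
        filter_upwards [ae_unit_mem] with t ht
        refine (real_inner_le_norm _ _).trans ?_
        have := (G (x + primitive (fun _ => y - x) t)).le_of_opNorm_le (hball (hmem t ht)).2
          (y - x)
        calc _ ≤ M * ‖y - x‖ * ‖y - x‖ := by gcongr
          _ = _ := by ring
    _ = _ := by simp

/-- A continuous path may have infinite energy. But nearby points are at finite distance, so the
times reached at finite distance from `x` form a clopen set containing `0`, hence all of the unit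
interval. -/
theorem IsCompleteDomain.domainDist_ne_top_iff_joinedIn {U : Set F} {G : F → F →L[ℝ] F}
    (hD : IsCompleteDomain U G) {x y : F} :
    domainDist U G x y ≠ ⊤ ↔ JoinedIn U x y := by
  constructor
  · intro h
    obtain ⟨w, hw⟩ := domainDist_ne_top_iff.1 h
    refine JoinedIn.ofLine (f := fun t => x + primitive w t) hw.continuousOn (by simp [primitive])
      hw.endpoint ?_
    rintro _ ⟨t, ht, rfl⟩
    exact hw.mem t ht
  · rintro ⟨γ, hγ⟩
    have hnear : ∀ t : unitInterval, ∀ᶠ s in 𝓝 t, domainDist U G (γ t) (γ s) ≠ ⊤ := by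
      intro t
      obtain ⟨r, hr, M, -, hle⟩ := hD.exists_domainDist_le (hγ t)
      filter_upwards [γ.continuous.continuousAt (Metric.ball_mem_nhds (γ t) hr)] with s hs
      exact ne_top_of_le_ne_top ENNReal.ofReal_ne_top (hle _ hs)
    set S : Set unitInterval := {t | domainDist U G x (γ t) ≠ ⊤}
    have hS : IsClopen S := by
      refine ⟨?_, ?_⟩
      · rw [← isOpen_compl_iff, isOpen_iff_mem_nhds]
        intro t ht
        filter_upwards [hnear t] with s hs hsS
        refine ht (ne_top_of_le_ne_top ?_ (hD.domainDist_triangle x (γ s) (γ t)))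
        rw [hD.domainDist_comm (γ s)]
        exact ENNReal.add_ne_top.2 ⟨hsS, hs⟩
      · rw [isOpen_iff_mem_nhds]
        intro t ht
        filter_upwards [hnear t] with s hs
        exact ne_top_of_le_ne_top (ENNReal.add_ne_top.2 ⟨ht, hs⟩)
          (hD.domainDist_triangle x (γ t) (γ s))
    have h0 : (0 : unitInterval) ∈ S := by
      have hx : x ∈ U := by simpa using hγ 0
      simp [S, domainDist_self G hx]
    have := hS.eq_univ ⟨0, h0⟩
    have h1 : (1 : unitInterval) ∈ S := by rw [this]; trivial
    simpa [S] using h1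

theorem IsCompleteDomain.isCompleteEMetric {U : Set F} {G : F → F →L[ℝ] F}
    (hD : IsCompleteDomain U G) {X : Type*} {e : X → F} (hinj : Function.Injective e)
    (hrange : range e = U) :
    IsCompleteEMetric (fun p q : X => domainDist U G (e p) (e q)) := by
  have heU : ∀ p, e p ∈ U := fun p => hrange ▸ mem_range_self p
  let inst : EMetricSpace X :=
    { edist := fun p q => domainDist U G (e p) (e q)
      edist_self := fun p => domainDist_self G (heU p)
      edist_comm := fun p q => hD.domainDist_comm _ _
      edist_triangle := fun p q r => hD.domainDist_triangle _ _ _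
      eq_of_edist_eq_zero := fun h => hinj (hD.eq_of_domainDist_eq_zero h) }
  have hed : ∀ p q : X, edist p q = domainDist U G (e p) (e q) := fun _ _ => rfl
  refine ⟨inst, hed, EMetric.complete_of_cauchySeq_tendsto fun u hu => ?_⟩
  obtain ⟨c, hc, hcle⟩ := hD.exists_mul_norm_sub_le
  have hle : ∀ p q, edist (e p) (e q) ≤ ENNReal.ofReal c⁻¹ * edist p q := by
    intro p q
    rw [edist_comm, edist_dist, dist_eq_norm, hed]
    calc ENNReal.ofReal ‖e q - e p‖ = ENNReal.ofReal (c⁻¹ * (c * ‖e q - e p‖)) := by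
          congr 1; field_simp
      _ = ENNReal.ofReal c⁻¹ * ENNReal.ofReal (c * ‖e q - e p‖) :=
          ENNReal.ofReal_mul (by positivity)
      _ ≤ _ := by gcongr; exact hcle _ _
  have hlip : LipschitzWith (Real.toNNReal c⁻¹) e := hle
  have hcs : CauchySeq (fun k => e (u k)) := hlip.uniformContinuous.comp_cauchySeq hu
  have : CompleteSpace F := FiniteDimensional.complete ℝ F
  obtain ⟨z, hz⟩ := cauchySeq_tendsto_of_complete hcs
  -- The tail lies within distance `1` of `u N`, thus is reached by paths of energy at most `1`.
  -- Confinement puts it in a compact `Q ⊆ U`, so the Euclidean limit cannot leave `U`.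
  obtain ⟨N, hN⟩ := EMetric.cauchySeq_iff.1 hu 1 one_pos
  obtain ⟨Q, hQU, hQ, hconf⟩ := hD.confined (e (u N)) (heU _) 1
  have hmem : ∀ k ≥ N, e (u k) ∈ Q := by
    intro k hk
    have h1 := hN N le_rfl k hk
    rw [hed] at h1
    obtain ⟨w, hw, -, heq⟩ := hD.exists_domainDist_eq (h1.trans ENNReal.one_lt_top).ne
    rw [heq, ENNReal.ofReal_lt_one, Real.sqrt_lt' one_pos, one_pow] at h1
    have := hconf _ w hw h1.le 1 (by simp)
    rwa [hw.endpoint] at this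
  have hzQ : z ∈ Q := hQ.isClosed.mem_of_tendsto hz (Filter.eventually_atTop.2 ⟨N, hmem⟩)
  obtain ⟨a, rfl⟩ : z ∈ range e := hrange ▸ hQU hzQ
  refine ⟨a, ?_⟩
  obtain ⟨r, hr, M, -, hM⟩ := hD.exists_domainDist_le (heU a)
  rw [tendsto_iff_edist_tendsto_0]
  have hlim : Filter.Tendsto (fun k => ENNReal.ofReal (M * ‖e (u k) - e a‖)) Filter.atTop (𝓝 0) := by
    have h := ENNReal.tendsto_ofReal ((tendsto_iff_norm_sub_tendsto_zero.1 hz).const_mul M)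
    simpa using h
  refine tendsto_of_tendsto_of_tendsto_of_le_of_le' tendsto_const_nhds hlim
    (.of_forall fun _ => zero_le) ?_
  filter_upwards [hz (Metric.ball_mem_nhds _ hr)] with k hk
  rw [hed, hD.domainDist_comm]
  exact hM _ hk

omit [FiniteDimensional ℝ F] in
theorem IsCompleteEMetric.isCompleteMetric {X : Type*} {δ : X → X → ℝ≥0∞}
    (h : IsCompleteEMetric δ) (hfin : ∀ x y, δ x y ≠ ⊤) : IsCompleteMetric δ := by
  obtain ⟨inst, hδ, hc⟩ := h
  exact ⟨EMetricSpace.toMetricSpace fun x y => hδ x y ▸ hfin x y, hδ, hc⟩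

end

noncomputable section

/-! ### Configurations as vectors of a Euclidean space -/

/-- Configurations of `n` points as vectors in `ℝ^{nd}`. -/
def flatten (n d : ℕ) : (Fin n → Eucl d) ≃L[ℝ] EuclideanSpace ℝ (Fin n × Fin d) :=
  LinearEquiv.toContinuousLinearEquiv
    { toFun := fun q => WithLp.toLp 2 fun a => q a.1 a.2
      invFun := fun z i => WithLp.toLp 2 fun j => z (i, j)
      map_add' := fun _ _ => rfl
      map_smul' := fun _ _ => rfl
      left_inv := fun _ => rfl
      right_inv := fun _ => rfl }

@[simp]
theorem flatten_apply {n d : ℕ} (q : Fin n → Eucl d) (a : Fin n × Fin d) :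
    flatten n d q a = q a.1 a.2 := rfl

theorem inner_flatten {n d : ℕ} (q : Fin n → Eucl d) (r : Fin n → Eucl d) :
    inner ℝ (flatten n d q) (flatten n d r) = ∑ i, inner ℝ (q i) (r i) := by
  simp only [PiLp.inner_apply, flatten_apply]
  rw [Fintype.sum_prod_type]

theorem norm_flatten_sq {n d : ℕ} (q : Fin n → Eucl d) :
    ‖flatten n d q‖ ^ 2 = ∑ i, ‖q i‖ ^ 2 := by
  rw [← real_inner_self_eq_norm_sq, inner_flatten]
  simp

theorem norm_le_norm_flatten {n d : ℕ} (q : Fin n → Eucl d) (i : Fin n) :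
    ‖q i‖ ≤ ‖flatten n d q‖ := by
  refine le_of_sq_le_sq ?_ (norm_nonneg _)
  rw [norm_flatten_sq]
  exact Finset.single_le_sum (f := fun i => ‖q i‖ ^ 2) (fun _ _ => sq_nonneg _) (Finset.mem_univ i)

theorem isOpen_landmarkSet (n d : ℕ) : IsOpen (landmarkSet n d) := by
  have : landmarkSet n d = ⋂ (i : Fin n) (j : Fin n) (_ : i ≠ j), {q | q i ≠ q j} := by
    ext q
    simp only [landmarkSet, mem_iInter, Function.Injective, mem_ofPred_eq]
    exact ⟨fun h i j hij he => hij (h he), fun h i j he => by_contra fun hij => h i j hij he⟩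
  rw [this]
  refine isOpen_iInter_of_finite fun i => isOpen_iInter_of_finite fun j =>
    isOpen_iInter_of_finite fun _ => ?_
  exact isOpen_ne_fun (continuous_apply i) (continuous_apply j)

/-- Landmark space as a subset of `ℝ^{nd}`. -/
def flatLandmarks (n d : ℕ) : Set (EuclideanSpace ℝ (Fin n × Fin d)) :=
  (flatten n d).symm ⁻¹' landmarkSet n d

theorem isOpen_flatLandmarks (n d : ℕ) : IsOpen (flatLandmarks n d) :=
  (isOpen_landmarkSet n d).preimage (flatten n d).symm.continuous

theorem flatten_mem_flatLandmarks {n d : ℕ} {q : Fin n → Eucl d} :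
    flatten n d q ∈ flatLandmarks n d ↔ q ∈ landmarkSet n d := by
  simp [flatLandmarks]

/-! ### Regularity of point evaluations -/

section Evaluation

variable {d : ℕ} {H : Type*} [NormedAddCommGroup H] [InnerProductSpace ℝ H]
  [RKHS ℝ H (Eucl d) (Eucl d)]

theorem IsAdmissible.norm_iteratedFDeriv_le (hH : IsAdmissible d 2 H) :
    ∃ C : ℝ≥0, ∀ j ≤ 2, ∀ (u : H) (x : Eucl d),
      ‖iteratedFDeriv ℝ j (u : Eucl d → Eucl d) x‖ ≤ C * ‖u‖ := by
  obtain ⟨C, hC⟩ := hH.embeds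
  refine ⟨C, fun j hj u x => ?_⟩
  have h1 : ‖iteratedFDeriv ℝ j (u : Eucl d → Eucl d) x‖ₑ ≤ C * ‖u‖ₑ := by
    refine le_trans ?_ (hC u)
    refine (le_iSup (fun x => ‖iteratedFDeriv ℝ j (u : Eucl d → Eucl d) x‖ₑ) x).trans ?_
    exact Finset.single_le_sum (f := fun j => ⨆ x, ‖iteratedFDeriv ℝ j (u : Eucl d → Eucl d) x‖ₑ)
      (fun _ _ => zero_le) (Finset.mem_range.2 (Nat.lt_succ_of_le hj))
  rw [enorm_eq_nnnorm, enorm_eq_nnnorm, ← ENNReal.coe_mul, ENNReal.coe_le_coe] at h1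
  exact_mod_cast h1

/-- The estimates on vector fields in `H` that follow from the embedding into `C^2_b`. -/
theorem IsAdmissible.exists_bounds (hH : IsAdmissible d 2 H) :
    ∃ C : ℝ≥0, (∀ (u : H) (x : Eucl d), ‖u x‖ ≤ C * ‖u‖) ∧
      (∀ (u : H) (x : Eucl d), ‖fderiv ℝ (u : Eucl d → Eucl d) x‖ ≤ C * ‖u‖) ∧
      (∀ (u : H) (x y : Eucl d), ‖u x - u y‖ ≤ C * ‖u‖ * ‖x - y‖) ∧
      ∀ (u : H) (x y : Eucl d), ‖fderiv ℝ (u : Eucl d → Eucl d) x -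
        fderiv ℝ (u : Eucl d → Eucl d) y‖ ≤ C * ‖u‖ * ‖x - y‖ := by
  obtain ⟨C, hC⟩ := hH.norm_iteratedFDeriv_le
  have h1 : ∀ (u : H) (x : Eucl d), ‖fderiv ℝ (u : Eucl d → Eucl d) x‖ ≤ C * ‖u‖ := fun u x => by
    rw [← norm_iteratedFDeriv_one]
    exact hC 1 (by norm_num) u x
  refine ⟨C, fun u x => ?_, h1, fun u x y => ?_, fun u x y => ?_⟩
  · simpa using hC 0 (by norm_num) u x
  · exact convex_univ.norm_image_sub_le_of_norm_fderiv_le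
      (fun z _ => ((hH.contDiff u).differentiable two_ne_zero).differentiableAt) (fun z _ => h1 u z)
      (mem_univ y) (mem_univ x)
  · have hd : ContDiff ℝ 1 (fderiv ℝ (u : Eucl d → Eucl d)) :=
      (hH.contDiff u).fderiv_right (by norm_num)
    refine convex_univ.norm_image_sub_le_of_norm_fderiv_le
      (fun z _ => (hd.differentiable one_ne_zero).differentiableAt) (fun z _ => ?_)
      (mem_univ y) (mem_univ x)
    rw [← norm_iteratedFDeriv_one, norm_iteratedFDeriv_fderiv]
    exact hC 2 le_rfl u z

/-- Evaluation of vector fields at a point. -/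
def evalAt (H : Type*) [NormedAddCommGroup H] [InnerProductSpace ℝ H]
    [RKHS ℝ H (Eucl d) (Eucl d)] (x : Eucl d) : H →L[ℝ] Eucl d :=
  (ContinuousLinearMap.proj x).comp (RKHS.coeCLM ℝ : H →L[ℝ] (Eucl d → Eucl d))

@[simp]
theorem evalAt_apply (x : Eucl d) (u : H) : evalAt H x u = u x := rfl

/-- The derivative of point evaluation with respect to the point. -/
theorem IsAdmissible.exists_evalAt_deriv (hH : IsAdmissible d 2 H) :
    ∃ D : Eucl d → Eucl d →L[ℝ] H →L[ℝ] Eucl d, ∀ x h u,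
      D x h u = fderiv ℝ (u : Eucl d → Eucl d) x h := by
  obtain ⟨C, -, h1, -, -⟩ := hH.exists_bounds
  have hdiff : ∀ (u : H) x, DifferentiableAt ℝ (u : Eucl d → Eucl d) x := fun u x =>
    ((hH.contDiff u).differentiable two_ne_zero).differentiableAt
  refine ⟨fun x => LinearMap.mkContinuous₂
    (LinearMap.mk₂ ℝ (fun h (u : H) => fderiv ℝ (u : Eucl d → Eucl d) x h) ?_ ?_ ?_ ?_) C ?_,
    fun x h u => rfl⟩
  · intro a b u
    simp
  · intro c a u
    simp
  · intro a u v
    rw [RKHS.coe_add, fderiv_add (hdiff u x) (hdiff v x)]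
    rfl
  · intro c a u
    rw [RKHS.coe_smul, fderiv_const_smul (hdiff u x)]
    rfl
  · intro a u
    refine (ContinuousLinearMap.le_opNorm _ _).trans ?_
    calc _ ≤ C * ‖u‖ * ‖a‖ := by gcongr; exact h1 u x
      _ = _ := by ring

/-- Point evaluation depends continuously differentiably on the point. -/
theorem IsAdmissible.contDiff_evalAt (hH : IsAdmissible d 2 H) :
    ContDiff ℝ 1 (evalAt H : Eucl d → H →L[ℝ] Eucl d) := by
  obtain ⟨C, -, h1, -, h3⟩ := hH.exists_bounds
  obtain ⟨D, hD⟩ := hH.exists_evalAt_deriv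
  have hdiff : ∀ (u : H) x, DifferentiableAt ℝ (u : Eucl d → Eucl d) x := fun u x =>
    ((hH.contDiff u).differentiable two_ne_zero).differentiableAt
  -- The first-order Taylor remainder of `u` is at most `C ‖u‖ ‖y - x‖²`, uniformly over `u`, by the
  -- bound on second derivatives; hence differentiability in operator norm.
  have hder : ∀ x, HasFDerivAt (evalAt H) (D x) x := by
    intro x
    rw [hasFDerivAt_iff_isLittleO]
    refine Asymptotics.IsBigO.trans_isLittleO (g := fun y => ‖y - x‖ ^ 2)
      (Asymptotics.IsBigO.of_bound C (.of_forall fun y => ?_))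
      (Asymptotics.isLittleO_pow_sub_sub x one_lt_two)
    rw [norm_pow, norm_norm]
    refine ContinuousLinearMap.opNorm_le_bound _ (by positivity) fun u => ?_
    have h := (convex_closedBall x ‖y - x‖).norm_image_sub_le_of_norm_fderiv_le'
      (f := (u : Eucl d → Eucl d)) (φ := fderiv ℝ (u : Eucl d → Eucl d) x)
      (C := C * ‖u‖ * ‖y - x‖) (x := x) (y := y) (fun z _ => hdiff u z)
      (fun z hz => (h3 u z x).trans (by
        gcongr
        rwa [mem_closedBall_iff_norm] at hz))
      (Metric.mem_closedBall_self (norm_nonneg _)) (mem_closedBall_iff_norm.2 le_rfl)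
    simp only [sub_apply, evalAt_apply, hD]
    refine h.trans (le_of_eq (by ring))
  rw [contDiff_one_iff_fderiv]
  refine ⟨fun x => (hder x).differentiableAt, ?_⟩
  have hfd : fderiv ℝ (evalAt H) = D := funext fun x => (hder x).fderiv
  rw [hfd]
  have hlip : LipschitzWith C D := by
    refine LipschitzWith.of_dist_le_mul fun x y => ?_
    rw [dist_eq_norm, dist_eq_norm]
    refine ContinuousLinearMap.opNorm_le_bound₂ _ (by positivity) fun h u => ?_
    have := (fderiv ℝ (u : Eucl d → Eucl d) x -
        fderiv ℝ (u : Eucl d → Eucl d) y).le_of_opNorm_le (h3 u x y) h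
    simp only [sub_apply] at this
    simp only [sub_apply, hD]
    exact this.trans (le_of_eq (by ring))
  exact hlip.continuous

/-- Simultaneous evaluation of vector fields at the points of a configuration. -/
def evalMap (n : ℕ) (H : Type*) [NormedAddCommGroup H] [InnerProductSpace ℝ H]
    [RKHS ℝ H (Eucl d) (Eucl d)] (z : EuclideanSpace ℝ (Fin n × Fin d)) :
    H →L[ℝ] EuclideanSpace ℝ (Fin n × Fin d) :=
  ∑ i, ((flatten n d : (Fin n → Eucl d) →L[ℝ] EuclideanSpace ℝ (Fin n × Fin d)).comp
    (ContinuousLinearMap.single ℝ (fun _ : Fin n => Eucl d) i)).comp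
      (evalAt H ((flatten n d).symm z i))

theorem evalMap_apply {n : ℕ} (z : EuclideanSpace ℝ (Fin n × Fin d)) (u : H) :
    evalMap n H z u = flatten n d fun i => u ((flatten n d).symm z i) := by
  have h : (fun i => u ((flatten n d).symm z i)) =
      ∑ i, Pi.single (M := fun _ => Eucl d) i (u ((flatten n d).symm z i)) :=
    (Finset.univ_sum_single _).symm
  rw [h, map_sum]
  simp [evalMap]

theorem evalMap_flatten_apply {n : ℕ} (q : Fin n → Eucl d) (u : H) :
    evalMap n H (flatten n d q) u = flatten n d fun i => u (q i) := by
  rw [evalMap_apply]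
  simp

theorem IsAdmissible.contDiff_evalMap (hH : IsAdmissible d 2 H) (n : ℕ) :
    ContDiff ℝ 1 (evalMap n H : EuclideanSpace ℝ (Fin n × Fin d) → _) := by
  unfold evalMap
  refine ContDiff.sum fun i _ => contDiff_const.clm_comp (hH.contDiff_evalAt.comp ?_)
  exact (ContinuousLinearMap.proj (R := ℝ) (φ := fun _ : Fin n => Eucl d) i).contDiff.comp
    (flatten n d).symm.contDiff

theorem IsAdmissible.exists_norm_evalMap_le (hH : IsAdmissible d 2 H) (n : ℕ) :
    ∃ K > 0, ∀ (z : EuclideanSpace ℝ (Fin n × Fin d)) (u : H), ‖evalMap n H z u‖ ≤ K * ‖u‖ := by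
  obtain ⟨C, h0, -, -, -⟩ := hH.exists_bounds
  -- The `+ 1` only makes the constant positive when `n` or `C` is `0`.
  refine ⟨√(n * C ^ 2 + 1), Real.sqrt_pos.2 (by positivity), fun z u => ?_⟩
  refine le_of_sq_le_sq ?_ (by positivity)
  rw [mul_pow, Real.sq_sqrt (by positivity), evalMap_apply, norm_flatten_sq]
  calc _ ≤ ∑ _ : Fin n, (C * ‖u‖) ^ 2 := by
        gcongr with i
        exact h0 u _
    _ = n * C ^ 2 * ‖u‖ ^ 2 := by simp; ring
    _ ≤ _ := by gcongr; linarith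

end Evaluation

end

noncomputable section

/-! ### Bump fields -/

/-- Each pairwise distance attains a positive minimum on the compact set, and there are finitely
many pairs. -/
theorem exists_separation {n d : ℕ} {K : Set (Fin n → Eucl d)} (hK : IsCompact K)
    (hKU : K ⊆ landmarkSet n d) :
    ∃ ρ > 0, ∀ q ∈ K, ∀ i j, i ≠ j → ρ ≤ ‖q i - q j‖ := by
  have hpair : ∀ p : Fin n × Fin n, ∃ r > 0, ∀ q ∈ K, p.1 ≠ p.2 → r ≤ ‖q p.1 - q p.2‖ := by
    intro p
    by_cases hp : p.1 = p.2
    · exact ⟨1, one_pos, fun q _ h => absurd hp h⟩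
    rcases K.eq_empty_or_nonempty with rfl | hne
    · exact ⟨1, one_pos, fun q hq => absurd hq (notMem_empty q)⟩
    have hc : Continuous fun q : Fin n → Eucl d => ‖q p.1 - q p.2‖ := by fun_prop
    obtain ⟨q₀, hq₀, hmin⟩ := hK.exists_isMinOn hne hc.continuousOn
    refine ⟨‖q₀ p.1 - q₀ p.2‖, norm_pos_iff.2 (sub_ne_zero.2 fun h => hp (hKU hq₀ h)),
      fun q hq _ => hmin hq⟩
  choose r hr hle using hpair
  have hev : ∀ᶠ ρ in 𝓝[>] (0 : ℝ), ∀ p, ρ ≤ r p :=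
    Filter.eventually_all.2 fun p => nhdsWithin_le_nhds (eventually_le_nhds (hr p))
  obtain ⟨ρ, hρ, hρ0⟩ := (hev.and self_mem_nhdsWithin).exists
  exact ⟨ρ, hρ0, fun q hq i j hij => (hρ (i, j)).trans (hle (i, j) q hq hij)⟩

section Bump

variable {d : ℕ} {H : Type*} [NormedAddCommGroup H] [InnerProductSpace ℝ H]
  [RKHS ℝ H (Eucl d) (Eucl d)]

theorem ckNorm_bump_le {f : Eucl d → ℝ} (hf : ContDiff ℝ ∞ f) (hfc : HasCompactSupport f) (m : ℕ) :
    ∃ B : ℝ≥0, ∀ c h : Eucl d, ckNorm m (fun x => f (x - c) • h) ≤ B * ‖h‖ₑ := by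
  have hbd : ∀ j : ℕ, ∃ b : ℝ≥0, ∀ x, ‖iteratedFDeriv ℝ j f x‖ ≤ b := by
    intro j
    obtain ⟨b, hb⟩ := (hfc.iteratedFDeriv (𝕜 := ℝ) j).exists_bound_of_continuous
      (hf.continuous_iteratedFDeriv (by exact_mod_cast le_top))
    exact ⟨b.toNNReal, fun x => (hb x).trans (Real.le_coe_toNNReal b)⟩
  choose b hb using hbd
  refine ⟨∑ j ∈ Finset.range (m + 1), b j, fun c h => ?_⟩
  rw [ckNorm, ENNReal.ofNNReal_finsetSum, Finset.sum_mul]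
  refine Finset.sum_le_sum fun j _ => iSup_le fun x => ?_
  have h1 : ‖iteratedFDeriv ℝ j (fun x => f (x - c) • h) x‖ ≤ b j * ‖h‖ := by
    have h2 := (ContinuousLinearMap.toSpanSingleton ℝ h).norm_iteratedFDeriv_comp_left
      (f := fun x => f (x - c)) (x := x) (n := j)
      ((hf.comp (contDiff_id.sub contDiff_const)).of_le (by exact_mod_cast le_top)).contDiffAt
      le_rfl
    rw [iteratedFDeriv_comp_sub, ContinuousLinearMap.norm_toSpanSingleton] at h2
    calc _ ≤ ‖h‖ * ‖iteratedFDeriv ℝ j f (x - c)‖ := h2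
      _ ≤ ‖h‖ * b j := by gcongr; exact hb j _
      _ = _ := mul_comm _ _
  rw [enorm_eq_nnnorm, enorm_eq_nnnorm, ← ENNReal.coe_mul, ENNReal.coe_le_coe]
  exact_mod_cast h1

/-- Translates of a bump function times constant vectors are vector fields in `H`, with norms
dominated by the norm of the vector. -/
theorem IsAdmissible.exists_bump {k : ℕ} (hH : IsAdmissible d k H) {ρ : ℝ} (hρ : 0 < ρ) (R : ℝ) :
    ∃ f : Eucl d → ℝ, ContDiff ℝ ∞ f ∧ f 0 = 1 ∧ (∀ x, ρ ≤ ‖x‖ → f x = 0) ∧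
      ∃ B : ℝ≥0, ∀ c ∈ Metric.closedBall (0 : Eucl d) R, ∀ h : Eucl d,
        ∃ u : H, (∀ x, u x = f (x - c) • h) ∧ ‖u‖ ≤ B * ‖h‖ := by
  set φ : ContDiffBump (0 : Eucl d) := ⟨ρ / 2, ρ, by positivity, by linarith⟩
  have hφ : ContDiff ℝ ∞ φ := φ.contDiff
  have hzero : ∀ x, ρ ≤ ‖x‖ → φ x = 0 := fun x hx =>
    φ.zero_of_le_dist (by rw [dist_zero_right]; exact hx)
  refine ⟨φ, hφ, φ.one_of_mem_closedBall (Metric.mem_closedBall_self φ.rIn_pos.le), hzero, ?_⟩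
  -- One compact set contains the supports of all translates with centre in the `R`-ball, so a
  -- single pair `m`, `C` serves every centre.
  set S : Set (Eucl d) := Metric.closedBall 0 (R + ρ)
  have hS : IsCompact S := isCompact_closedBall _ _
  obtain ⟨m, C, hC⟩ := hH.bounded S hS
  obtain ⟨B, hB⟩ := ckNorm_bump_le hφ φ.hasCompactSupport m
  refine ⟨C * B, fun c hc h => ?_⟩
  have hsm : ContDiff ℝ ∞ fun x => φ (x - c) • h :=
    (hφ.comp (contDiff_id.sub contDiff_const)).smul contDiff_const
  have hts : tsupport (fun x => φ (x - c) • h) ⊆ S := by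
    refine closure_minimal (fun x hx => ?_) Metric.isClosed_closedBall
    have h1 : φ (x - c) ≠ 0 := fun h0 => hx (by simp [h0])
    have h2 : ‖x - c‖ < ρ := not_le.1 fun hle => h1 (hzero _ hle)
    rw [mem_closedBall_zero_iff] at hc ⊢
    calc ‖x‖ = ‖c + (x - c)‖ := by simp
      _ ≤ _ := (norm_add_le _ _).trans (by linarith)
  obtain ⟨u, hu⟩ := hH.contains _ ⟨hsm, HasCompactSupport.of_support_subset_isCompact hS
    (subset_closure.trans hts)⟩
  refine ⟨u, fun x => by rw [hu], ?_⟩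
  have h1 := hC u (hu ▸ hsm) (hu ▸ hts)
  rw [hu] at h1
  have h2 := h1.trans (mul_le_mul_right (hB c h) (C : ℝ≥0∞))
  rw [enorm_eq_nnnorm, enorm_eq_nnnorm, ← mul_assoc, ← ENNReal.coe_mul, ← ENNReal.coe_mul,
    ENNReal.coe_le_coe] at h2
  exact_mod_cast h2

end Bump

/-! ### The landmark metric in operator form and the horizontal lift -/

section Metric

variable {d : ℕ} {H : Type*} [NormedAddCommGroup H] [InnerProductSpace ℝ H]
  [RKHS ℝ H (Eucl d) (Eucl d)]

/-- Bumps of radius at most the mutual distance of the points do not see each other, so values can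
be prescribed one landmark at a time. -/
theorem IsAdmissible.surjective_evalMap {n k : ℕ} (hH : IsAdmissible d k H)
    {z : EuclideanSpace ℝ (Fin n × Fin d)} (hz : z ∈ flatLandmarks n d) :
    Function.Surjective (evalMap n H z) := by
  intro y
  set q := (flatten n d).symm z with hq
  set h := (flatten n d).symm y with hh
  obtain ⟨ρ, hρ, hsep⟩ := exists_separation (isCompact_singleton (x := q))
    (singleton_subset_iff.2 hz)
  obtain ⟨f, -, hf0, hfz, B, hB⟩ := hH.exists_bump hρ ‖q‖
  choose u hu _ using fun i => hB (q i) (mem_closedBall_zero_iff.2 (norm_le_pi_norm q i)) (h i)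
  refine ⟨∑ i, u i, ?_⟩
  rw [evalMap_apply, ← (flatten n d).apply_symm_apply y]
  congr 1
  funext j
  have hs : (∑ i, u i) (q j) = ∑ i, u i (q j) := map_sum (evalAt H (q j)) u Finset.univ
  rw [← hq, ← hh, hs, Finset.sum_eq_single j]
  · simp [hu, hf0]
  · intro i _ hij
    rw [hu, hfz _ (hsep q rfl j i hij.symm), zero_smul]
  · simp

variable [CompleteSpace H]

/-- The cometric `K(q^i, q^j)` as an operator. -/
def cometricMap (n : ℕ) (H : Type*) [NormedAddCommGroup H] [InnerProductSpace ℝ H]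
    [RKHS ℝ H (Eucl d) (Eucl d)] [CompleteSpace H] (z : EuclideanSpace ℝ (Fin n × Fin d)) :
    EuclideanSpace ℝ (Fin n × Fin d) →L[ℝ] EuclideanSpace ℝ (Fin n × Fin d) :=
  (evalMap n H z).comp (evalMap n H z).adjoint

/-- The landmark metric as an operator. -/
def metricMap (n : ℕ) (H : Type*) [NormedAddCommGroup H] [InnerProductSpace ℝ H]
    [RKHS ℝ H (Eucl d) (Eucl d)] [CompleteSpace H] (z : EuclideanSpace ℝ (Fin n × Fin d)) :
    EuclideanSpace ℝ (Fin n × Fin d) →L[ℝ] EuclideanSpace ℝ (Fin n × Fin d) :=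
  Ring.inverse (cometricMap n H z)

theorem inner_cometricMap {n : ℕ} (z a b : EuclideanSpace ℝ (Fin n × Fin d)) :
    inner ℝ (cometricMap n H z a) b =
      inner ℝ ((evalMap n H z).adjoint a) ((evalMap n H z).adjoint b) := by
  rw [cometricMap, ContinuousLinearMap.comp_apply, ContinuousLinearMap.adjoint_inner_right]

/-- If `ev ev* a = 0` then `ev* a = 0`; writing `a = ev u` gives `‖a‖² = ⟪ev* a, u⟫ = 0`.
Injectivity suffices in finite dimension. -/
theorem IsAdmissible.isUnit_cometricMap {n k : ℕ} (hH : IsAdmissible d k H)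
    {z : EuclideanSpace ℝ (Fin n × Fin d)} (hz : z ∈ flatLandmarks n d) :
    IsUnit (cometricMap n H z) := by
  rw [ContinuousLinearMap.isUnit_iff_bijective]
  have hinj : Function.Injective (cometricMap n H z :
      EuclideanSpace ℝ (Fin n × Fin d) →ₗ[ℝ] EuclideanSpace ℝ (Fin n × Fin d)) := by
    rw [← LinearMap.ker_eq_bot, LinearMap.ker_eq_bot']
    intro a ha
    have ha' : cometricMap n H z a = 0 := ha
    have h1 := inner_cometricMap (H := H) z a a
    rw [ha', inner_zero_left, eq_comm, inner_self_eq_zero] at h1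
    obtain ⟨u, hu⟩ := hH.surjective_evalMap hz a
    have h2 := ContinuousLinearMap.adjoint_inner_left (evalMap n H z) u a
    rw [h1, hu, inner_zero_left, eq_comm, inner_self_eq_zero] at h2
    exact h2
  exact ⟨hinj, LinearMap.injective_iff_surjective.1 hinj⟩

theorem IsAdmissible.cometricMap_metricMap {n k : ℕ} (hH : IsAdmissible d k H)
    {z : EuclideanSpace ℝ (Fin n × Fin d)} (hz : z ∈ flatLandmarks n d)
    (h : EuclideanSpace ℝ (Fin n × Fin d)) : cometricMap n H z (metricMap n H z h) = h := by
  have := Ring.mul_inverse_cancel _ (hH.isUnit_cometricMap (n := n) hz)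
  exact DFunLike.congr_fun this h

/-- The horizontal lift: the vector field of least norm in `H` with prescribed values. -/
def horizontalLift (n : ℕ) (H : Type*) [NormedAddCommGroup H] [InnerProductSpace ℝ H]
    [RKHS ℝ H (Eucl d) (Eucl d)] [CompleteSpace H] (z h : EuclideanSpace ℝ (Fin n × Fin d)) : H :=
  (evalMap n H z).adjoint (metricMap n H z h)

theorem IsAdmissible.evalMap_horizontalLift {n k : ℕ} (hH : IsAdmissible d k H)
    {z : EuclideanSpace ℝ (Fin n × Fin d)} (hz : z ∈ flatLandmarks n d)
    (h : EuclideanSpace ℝ (Fin n × Fin d)) : evalMap n H z (horizontalLift n H z h) = h :=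
  hH.cometricMap_metricMap hz h

theorem IsAdmissible.norm_horizontalLift_sq {n k : ℕ} (hH : IsAdmissible d k H)
    {z : EuclideanSpace ℝ (Fin n × Fin d)} (hz : z ∈ flatLandmarks n d)
    (h : EuclideanSpace ℝ (Fin n × Fin d)) :
    ‖horizontalLift n H z h‖ ^ 2 = inner ℝ (metricMap n H z h) h := by
  rw [← real_inner_self_eq_norm_sq, horizontalLift, ← inner_cometricMap,
    hH.cometricMap_metricMap hz, real_inner_comm]

/-- Minimality of the horizontal lift `l`: it satisfies `⟪l, u⟫ = ‖l‖²` for every `u` with the same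
values, so Cauchy-Schwarz gives `‖l‖ ≤ ‖u‖`. -/
theorem IsAdmissible.inner_metricMap_le {n k : ℕ} (hH : IsAdmissible d k H)
    {z : EuclideanSpace ℝ (Fin n × Fin d)} (hz : z ∈ flatLandmarks n d) (u : H) :
    inner ℝ (metricMap n H z (evalMap n H z u)) (evalMap n H z u) ≤ ‖u‖ ^ 2 := by
  have h1 := hH.norm_horizontalLift_sq hz (evalMap n H z u)
  have h2 : inner ℝ (horizontalLift n H z (evalMap n H z u)) u =
      inner ℝ (metricMap n H z (evalMap n H z u)) (evalMap n H z u) :=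
    ContinuousLinearMap.adjoint_inner_left _ _ _
  rw [← h1] at h2 ⊢
  have h3 := real_inner_le_norm (horizontalLift n H z (evalMap n H z u)) u
  rw [h2] at h3
  set a := ‖horizontalLift n H z (evalMap n H z u)‖
  have ha : 0 ≤ a := norm_nonneg _
  have hu : 0 ≤ ‖u‖ := norm_nonneg u
  nlinarith [sq_nonneg (a - ‖u‖)]

theorem IsAdmissible.metricMap_symm {n k : ℕ} (hH : IsAdmissible d k H)
    {z : EuclideanSpace ℝ (Fin n × Fin d)} (hz : z ∈ flatLandmarks n d)
    (a b : EuclideanSpace ℝ (Fin n × Fin d)) :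
    inner ℝ (metricMap n H z a) b = inner ℝ a (metricMap n H z b) := by
  conv_lhs => rw [← hH.cometricMap_metricMap hz b]
  conv_rhs => rw [← hH.cometricMap_metricMap hz a]
  rw [inner_cometricMap, real_inner_comm, inner_cometricMap, real_inner_comm]

theorem IsAdmissible.contDiff_adjoint_evalMap (hH : IsAdmissible d 2 H) (n : ℕ) :
    ContDiff ℝ 1 fun z => (evalMap n H z).adjoint := by
  let A := ContinuousLinearMap.adjoint (𝕜 := ℝ) (E := H) (F := EuclideanSpace ℝ (Fin n × Fin d))
  let L : (H →L[ℝ] EuclideanSpace ℝ (Fin n × Fin d)) →L[ℝ]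
      (EuclideanSpace ℝ (Fin n × Fin d) →L[ℝ] H) :=
    A.toLinearEquiv.toAddEquiv.toAddMonoidHom.toRealLinearMap A.continuous
  exact L.contDiff.comp (hH.contDiff_evalMap n)

theorem IsAdmissible.contDiffOn_metricMap (hH : IsAdmissible d 2 H) (n : ℕ) :
    ContDiffOn ℝ 1 (metricMap n H) (flatLandmarks n d) := by
  have hA : ContDiff ℝ 1 (cometricMap n H) :=
    (hH.contDiff_evalMap n).clm_comp (hH.contDiff_adjoint_evalMap n)
  intro z hz
  obtain ⟨u, hu⟩ := hH.isUnit_cometricMap (n := n) hz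
  have h1 := contDiffAt_ringInverse ℝ (n := 1) u
  rw [hu] at h1
  exact (h1.comp z hA.contDiffAt).contDiffWithinAt

end Metric

end

noncomputable section

/-! ### Landmark space is a complete Riemannian domain -/

/-- Let `M = ‖f s‖` be the maximum on `[a, b]`. Cauchy-Schwarz and the bound `1 / 4` give `‖f b - f
s‖ ≤ M / 2`, hence `M ≤ 2 ‖f b‖`. -/
theorem norm_le_two_mul_norm_of_growth {V : Type*} [NormedAddCommGroup V] [NormedSpace ℝ V]
    {f g : ℝ → V} {k : ℝ → ℝ} (hf : ContinuousOn f (Icc 0 1))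
    (hfg : ∀ a ∈ Icc (0 : ℝ) 1, ∀ b ∈ Icc (0 : ℝ) 1, f b - f a = ∫ t in a..b, g t)
    (hk : MemLp k 2 unitMeasure) (hk0 : ∀ t, 0 ≤ k t)
    (hg : ∀ᵐ t ∂unitMeasure, ‖g t‖ ≤ k t * ‖f t‖) {R : ℝ}
    (hR : ∫ t, k t ^ 2 ∂unitMeasure ≤ R) {a b : ℝ} (ha : a ∈ Icc (0 : ℝ) 1)
    (hb : b ∈ Icc (0 : ℝ) 1) (hab : a ≤ b) (hR' : (b - a) * R ≤ 1 / 4) :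
    ‖f a‖ ≤ 2 * ‖f b‖ := by
  have hsub : Icc a b ⊆ Icc 0 1 := Icc_subset_Icc ha.1 hb.2
  obtain ⟨s, hs, hmax⟩ := isCompact_Icc.exists_isMaxOn (nonempty_Icc.2 hab)
    (hf.mono hsub).norm
  have hmax' : ∀ t ∈ Icc a b, ‖f t‖ ≤ ‖f s‖ := fun t ht => hmax ht
  set M := ‖f s‖
  have hM : 0 ≤ M := norm_nonneg _
  have hR0 : 0 ≤ R := (integral_nonneg fun t => sq_nonneg (k t)).trans hR
  have hle : volume.restrict (Ioc s b) ≤ unitMeasure :=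
    Measure.restrict_mono (Ioc_subset_Ioc (hsub hs).1 hb.2) le_rfl
  have h1 := norm_integral_sq_le (w := g) (k := fun t => k t * M) (hk.mul_const M) (hsub hs) hb hs.2
    (by
      filter_upwards [ae_mono hle hg, ae_restrict_mem measurableSet_Ioc] with t ht htm
      exact ht.trans (by
        gcongr
        · exact hk0 t
        · exact hmax' t ⟨hs.1.trans htm.1.le, htm.2⟩))
  rw [← hfg s (hsub hs) b hb] at h1
  simp only [mul_pow] at h1
  rw [integral_mul_const] at h1
  have h2 : ‖f b - f s‖ ^ 2 ≤ (M / 2) ^ 2 := by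
    calc _ ≤ _ := h1
      _ ≤ (b - a) * (R * M ^ 2) := by
        gcongr
        exact hs.1
      _ = (b - a) * R * M ^ 2 := by ring
      _ ≤ 1 / 4 * M ^ 2 := by gcongr
      _ = _ := by ring
  have h3 : ‖f b - f s‖ ≤ M / 2 := le_of_sq_le_sq h2 (by positivity)
  have h4 : M ≤ ‖f b‖ + ‖f b - f s‖ := by
    have := norm_sub_norm_le (f s) (f b)
    rw [norm_sub_rev] at this
    linarith
  linarith [hmax' a (left_mem_Icc.2 hab)]

/-- A lower bound of Grönwall type for curves whose velocity is dominated by their norm. -/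
theorem norm_le_two_pow_mul_norm_of_growth {V : Type*} [NormedAddCommGroup V] [NormedSpace ℝ V]
    {f g : ℝ → V} {k : ℝ → ℝ} (hf : ContinuousOn f (Icc 0 1))
    (hfg : ∀ a ∈ Icc (0 : ℝ) 1, ∀ b ∈ Icc (0 : ℝ) 1, f b - f a = ∫ t in a..b, g t)
    (hk : MemLp k 2 unitMeasure) (hk0 : ∀ t, 0 ≤ k t)
    (hg : ∀ᵐ t ∂unitMeasure, ‖g t‖ ≤ k t * ‖f t‖) {R : ℝ}
    (hR : ∫ t, k t ^ 2 ∂unitMeasure ≤ R) {N : ℕ} (hN : 4 * R < N) {t : ℝ}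
    (ht : t ∈ Icc (0 : ℝ) 1) : ‖f 0‖ ≤ 2 ^ N * ‖f t‖ := by
  have hR0 : 0 ≤ R := (integral_nonneg fun t => sq_nonneg (k t)).trans hR
  have hN0 : (0 : ℝ) < N := by linarith
  -- Cut `[0, t]` into `N` equal pieces. Since `4 * R < N`, each is short enough for the preceding
  -- lemma and costs a factor `2`.
  have key : ∀ j : ℕ, j ≤ N → ‖f 0‖ ≤ 2 ^ j * ‖f (j / N * t)‖ := by
    intro j
    induction j with
    | zero => simp
    | succ j ih =>
      intro hj
      have hmem : ∀ i : ℕ, i ≤ N → (i / N * t : ℝ) ∈ Icc (0 : ℝ) 1 := fun i hi =>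
        ⟨mul_nonneg (by positivity) ht.1, mul_le_one₀ (div_le_one_of_le₀ (by exact_mod_cast hi)
          hN0.le) ht.1 ht.2⟩
      have hdiff : ((j + 1 : ℕ) / N * t - j / N * t : ℝ) = t / N := by
        push_cast; field_simp; ring
      have h1 := norm_le_two_mul_norm_of_growth hf hfg hk hk0 hg hR (hmem j (by omega))
        (hmem (j + 1) hj) (by
          have : 0 ≤ t / N := div_nonneg ht.1 hN0.le
          linarith) (by
          rw [hdiff, div_mul_eq_mul_div, div_le_iff₀ hN0]
          nlinarith [ht.1, ht.2])
      calc ‖f 0‖ ≤ 2 ^ j * ‖f (j / N * t)‖ := ih (by omega)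
        _ ≤ 2 ^ j * (2 * ‖f ((j + 1 : ℕ) / N * t)‖) := by gcongr
        _ = _ := by ring
  have := key N le_rfl
  rwa [div_self hN0.ne', one_mul] at this

section Landmarks

variable {d : ℕ} {H : Type*} [NormedAddCommGroup H] [InnerProductSpace ℝ H]
  [RKHS ℝ H (Eucl d) (Eucl d)] [CompleteSpace H]

/-- Since `h` is the evaluation of its horizontal lift, whose squared norm is `g_H(h, h)`, the bound
`K` on evaluations yields the constant `K⁻²`. -/
theorem IsAdmissible.exists_coercive (hH : IsAdmissible d 2 H) (n : ℕ) :
    ∃ c > 0, ∀ z ∈ flatLandmarks n d, ∀ h, c * ‖h‖ ^ 2 ≤ inner ℝ (metricMap n H z h) h := by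
  obtain ⟨K, hK, hle⟩ := hH.exists_norm_evalMap_le n
  refine ⟨(K ^ 2)⁻¹, by positivity, fun z hz h => ?_⟩
  rw [← hH.norm_horizontalLift_sq hz, inv_mul_le_iff₀ (by positivity), ← mul_pow]
  have := hle z (horizontalLift n H z h)
  rw [hH.evalMap_horizontalLift hz] at this
  gcongr

/-- Landmark space with its metric is a complete Riemannian domain. -/
theorem IsAdmissible.isCompleteDomain (hH : IsAdmissible d 2 H) (n : ℕ) :
    IsCompleteDomain (flatLandmarks n d) (metricMap n H) := by
  refine ⟨isOpen_flatLandmarks n d, fun z hz => hH.metricMap_symm hz, hH.contDiffOn_metricMap n,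
    hH.exists_coercive n, fun x hx R => ?_⟩
  obtain ⟨c, hc, hcoer⟩ := hH.exists_coercive n
  obtain ⟨C, -, -, hlip, -⟩ := hH.exists_bounds
  obtain ⟨N, hN⟩ := exists_nat_gt (4 * (C ^ 2 * R))
  set E := (flatten n d).symm with hE
  -- The ball bounds the displacement; the second condition bounds all pairwise distances below, and
  -- is closed while excluding collisions.
  set Q : Set (EuclideanSpace ℝ (Fin n × Fin d)) := Metric.closedBall x √(R / c) ∩
    {z | ∀ i j, ‖E x i - E x j‖ ≤ 2 ^ N * ‖E z i - E z j‖} with hQ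
  have hEc : ∀ i, Continuous fun z => E z i := fun i => (continuous_apply i).comp E.continuous
  refine ⟨Q, ?_, ?_, ?_⟩
  · rintro z ⟨-, hz⟩ i j hij
    have h0 := hz i j
    have hij' : E z i = E z j := hij
    rw [hij', sub_self, norm_zero, mul_zero] at h0
    exact hx (sub_eq_zero.1 (norm_le_zero_iff.1 h0))
  · refine (isCompact_closedBall _ _).inter_right ?_
    simp only [ofPred_forall]
    refine isClosed_iInter fun i => isClosed_iInter fun j => ?_
    exact isClosed_le continuous_const (continuous_const.mul ((hEc i).sub (hEc j)).norm)
  · intro y w hw hwR t ht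
    have hwi := hw.memLp.integrable_unit
    have hGw := memLp_metric_apply (hH.contDiffOn_metricMap n).continuousOn hw.continuousOn hw.mem
      hw.memLp
    have hint := hGw.integrable_inner_unit hw.memLp
    refine ⟨?_, fun i j => ?_⟩
    · rw [mem_closedBall_iff_norm, add_sub_cancel_left]
      refine Real.le_sqrt_of_sq_le ?_
      have h1 := norm_integral_sq_le (w := w) (k := fun t => ‖w t‖) hw.memLp.norm
        (a := 0) (b := t) (by simp) ht ht.1 (.of_forall fun _ => le_rfl)
      have h2 : c * ∫ t, ‖w t‖ ^ 2 ∂unitMeasure ≤ R := by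
        refine le_trans ?_ hwR
        rw [← integral_const_mul]
        refine integral_mono_ae (hw.memLp.integrable_sq_unit.const_mul c) hint ?_
        filter_upwards [ae_unit_mem] with s hs
        exact hcoer _ (hw.mem s hs) _
      have h3 : 0 ≤ ∫ t, ‖w t‖ ^ 2 ∂unitMeasure := integral_nonneg fun t => sq_nonneg _
      calc ‖primitive w t‖ ^ 2 ≤ (t - 0) * ∫ t, ‖w t‖ ^ 2 ∂unitMeasure := h1
        _ ≤ 1 * ∫ t, ‖w t‖ ^ 2 ∂unitMeasure := by
          gcongr
          linarith [ht.2]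
        _ ≤ R / c := by rw [one_mul, le_div_iff₀' hc]; exact h2
    · set P : EuclideanSpace ℝ (Fin n × Fin d) →L[ℝ] Eucl d :=
        ((ContinuousLinearMap.proj (R := ℝ) (φ := fun _ : Fin n => Eucl d) i) -
          (ContinuousLinearMap.proj (R := ℝ) (φ := fun _ : Fin n => Eucl d) j)).comp
          (E : EuclideanSpace ℝ (Fin n × Fin d) →L[ℝ] (Fin n → Eucl d)) with hP
      have hPz : ∀ z, P z = E z i - E z j := fun z => rfl
      -- This is `C` times the norm of the horizontal lift of the velocity, hence a Lipschitz
      -- constant of that field and a growth rate for the difference of two landmarks.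
      set k : ℝ → ℝ := fun t =>
        C * √(inner ℝ (metricMap n H (x + primitive w t) (w t)) (w t)) with hk
      have hpos : ∀ s ∈ Icc (0 : ℝ) 1,
          0 ≤ inner ℝ (metricMap n H (x + primitive w s) (w s)) (w s) := fun s hs =>
        (mul_nonneg hc.le (sq_nonneg _)).trans (hcoer _ (hw.mem s hs) _)
      have hksq : (fun t => k t ^ 2) =ᵐ[unitMeasure] fun t =>
          (C : ℝ) ^ 2 * inner ℝ (metricMap n H (x + primitive w t) (w t)) (w t) := by
        filter_upwards [ae_unit_mem] with s hs
        simp only [k]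
        rw [mul_pow, Real.sq_sqrt (hpos s hs)]
      have hkm : MemLp k 2 unitMeasure := by
        rw [memLp_two_iff_integrable_sq
          ((Real.continuous_sqrt.comp_aestronglyMeasurable hint.1).const_mul _)]
        exact (hint.const_mul _).congr hksq.symm
      have hgrow := norm_le_two_pow_mul_norm_of_growth (f := fun t => P (x + primitive w t))
        (g := fun t => P (w t)) (k := k) (P.continuous.comp_continuousOn hw.continuousOn) ?_ hkm
        (fun s => by positivity) ?_ (R := C ^ 2 * R) ?_ hN ht
      · simpa [primitive, hPz] using hgrow
      · intro a ha b hb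
        rw [P.intervalIntegral_comp_comm (intervalIntegrable_of_unit hwi ha hb),
          ← primitive_sub_primitive hwi ha hb, ← map_sub, add_sub_add_left_eq_sub]
      · filter_upwards [ae_unit_mem] with s hs
        have hm := hw.mem s hs
        have hval := hH.evalMap_horizontalLift hm (w s)
        rw [evalMap_apply, ← (flatten n d).eq_symm_apply] at hval
        rw [hPz, hPz, ← hE] at *
        rw [← hval]
        simp only [k]
        rw [← hH.norm_horizontalLift_sq hm, Real.sqrt_sq (norm_nonneg _)]
        exact hlip _ _ _
      · rw [integral_congr_ae hksq, integral_const_mul]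
        gcongr
        exact hwR

end Landmarks

end

noncomputable section

/-! ### The geodesic distance in terms of energy paths -/

section Geodesic

variable {n d : ℕ} {H : Type*} [NormedAddCommGroup H] [InnerProductSpace ℝ H]
  [RKHS ℝ H (Eucl d) (Eucl d)] [CompleteSpace H]

theorem adjoint_evalMap_flatten (q : Fin n → Eucl d) (v : EuclideanSpace ℝ (Fin n × Fin d)) :
    (evalMap n H (flatten n d q)).adjoint v =
      ∑ b, v b • RKHS.kerFun H (q b.1) (EuclideanSpace.single b.2 1) := by
  refine ext_inner_right ℝ fun u => ?_
  rw [ContinuousLinearMap.adjoint_inner_left, evalMap_flatten_apply, sum_inner]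
  simp only [inner_smul_left, RKHS.kerFun_inner, PiLp.inner_apply,
    flatten_apply]
  simp [mul_comm]

/-- The reproducing property expresses the adjoint of evaluation through the kernel functions at the
landmarks; evaluating them again produces the blocks. -/
theorem cometricMap_flatten (q : Fin n → Eucl d) :
    cometricMap n H (flatten n d q) = Matrix.toEuclideanCLM (𝕜 := ℝ) (cometric H q) := by
  ext v a
  rw [cometricMap, ContinuousLinearMap.comp_apply, adjoint_evalMap_flatten, evalMap_flatten_apply,
    flatten_apply, Matrix.ofLp_toEuclideanCLM]
  have h : (∑ b, v b • RKHS.kerFun H (q b.1) (EuclideanSpace.single b.2 1)) (q a.1) =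
      ∑ b, v b • RKHS.kernel H (q a.1) (q b.1) (EuclideanSpace.single b.2 1) := by
    rw [← evalAt_apply, map_sum]
    simp only [map_smul, evalAt_apply, RKHS.kerFun_apply]
  rw [h]
  simp [Matrix.mulVec, dotProduct, cometric, mul_comm]

theorem IsAdmissible.landmarkMetric_eq {k : ℕ} (hH : IsAdmissible d k H) {q : Fin n → Eucl d}
    (hq : q ∈ landmarkSet n d) (h : Fin n → Eucl d) :
    landmarkMetric H q h =
      inner ℝ (metricMap n H (flatten n d q) (flatten n d h)) (flatten n d h) := by
  have hu := hH.isUnit_cometricMap (flatten_mem_flatLandmarks.2 hq)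
  have hM : IsUnit (cometric H q) := by
    rw [cometricMap_flatten] at hu
    exact (MulEquiv.isUnit_map (Matrix.toEuclideanCLM (n := Fin n × Fin d) (𝕜 := ℝ))).1 hu
  have hinv : metricMap n H (flatten n d q) = Matrix.toEuclideanCLM (𝕜 := ℝ) (cometric H q)⁻¹ := by
    have h1 : cometricMap n H (flatten n d q) * Matrix.toEuclideanCLM (𝕜 := ℝ) (cometric H q)⁻¹ =
        1 := by
      rw [cometricMap_flatten, ← map_mul, Matrix.mul_nonsing_inv _
        ((Matrix.isUnit_iff_isUnit_det _).1 hM), map_one]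
    calc metricMap n H (flatten n d q) = metricMap n H (flatten n d q) *
          (cometricMap n H (flatten n d q) * Matrix.toEuclideanCLM (𝕜 := ℝ) (cometric H q)⁻¹) := by
          rw [h1, mul_one]
      _ = _ := by rw [← mul_assoc, metricMap, Ring.inverse_mul_cancel _ hu, one_mul]
  rw [real_inner_comm, hinv, Matrix.inner_toEuclideanCLM]
  rfl

theorem primitive_derivWithin {E : Type*} [NormedAddCommGroup E] [NormedSpace ℝ E]
    [CompleteSpace E] {γ : ℝ → E} (hγ : ContDiffOn ℝ 1 γ (Icc 0 1)) {t : ℝ}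
    (ht : t ∈ Icc (0 : ℝ) 1) : primitive (derivWithin γ (Icc 0 1)) t = γ t - γ 0 := by
  have hc := hγ.continuousOn_derivWithin (uniqueDiffOn_Icc zero_lt_one) le_rfl
  have hsub : Icc 0 t ⊆ Icc 0 1 := Icc_subset_Icc_right ht.2
  refine intervalIntegral.integral_eq_sub_of_hasDeriv_right_of_le ht.1
    (hγ.continuousOn.mono hsub) (fun s hs => ?_)
    ((hc.mono hsub).intervalIntegrable_of_Icc ht.1)
  have hs' : s ∈ Ioo (0 : ℝ) 1 := ⟨hs.1, hs.2.trans_le ht.2⟩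
  have h := ((hγ.differentiableOn one_ne_zero) s (Ioo_subset_Icc_self hs')).hasDerivWithinAt
  exact (h.hasDerivAt (Icc_mem_nhds hs'.1 hs'.2)).hasDerivWithinAt

/-- A path of landmarks of class `C^1` gives an energy path. -/
theorem IsAdmissible.isEnergyPath_of_isLandmarkPath (hH : IsAdmissible d 2 H) {q q' : Landmarks n d}
    {γ : ℝ → Fin n → Eucl d} (hγ : IsLandmarkPath q q' γ) :
    IsEnergyPath (flatLandmarks n d) (flatten n d q.pt) (flatten n d q'.pt)
        (fun t => flatten n d (derivWithin γ (Icc 0 1) t)) ∧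
      pathEnergy H γ = ENNReal.ofReal (domainEnergy (metricMap n H) (flatten n d q.pt)
        fun t => flatten n d (derivWithin γ (Icc 0 1) t)) := by
  obtain ⟨hC, hU, h0, h1⟩ := hγ
  have hc := hC.continuousOn_derivWithin (uniqueDiffOn_Icc zero_lt_one) le_rfl
  have hwc : ContinuousOn (fun t => flatten n d (derivWithin γ (Icc 0 1) t)) (Icc 0 1) :=
    (flatten n d).continuous.comp_continuousOn hc
  have hprim : ∀ t ∈ Icc (0 : ℝ) 1, flatten n d q.pt +
      primitive (fun t => flatten n d (derivWithin γ (Icc 0 1) t)) t = flatten n d (γ t) := by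
    intro t ht
    have h2 : primitive (fun t => flatten n d (derivWithin γ (Icc 0 1) t)) t =
        flatten n d (primitive (derivWithin γ (Icc 0 1)) t) :=
      (flatten n d : (Fin n → Eucl d) →L[ℝ]
        EuclideanSpace ℝ (Fin n × Fin d)).intervalIntegral_comp_comm
          (intervalIntegrable_of_unit (MemLp.of_continuousOn_unit hc).integrable_unit (by simp) ht)
    rw [h2, primitive_derivWithin hC ht, h0, map_sub]
    abel
  have hpath : IsEnergyPath (flatLandmarks n d) (flatten n d q.pt) (flatten n d q'.pt)
      (fun t => flatten n d (derivWithin γ (Icc 0 1) t)) := by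
    refine ⟨MemLp.of_continuousOn_unit hwc, fun t ht => ?_, ?_⟩
    · rw [hprim t ht, flatten_mem_flatLandmarks]
      exact hU t ht
    · rw [hprim 1 (by simp), h1]
  refine ⟨hpath, ?_⟩
  have hD := hH.isCompleteDomain n
  have hint := hD.integrable_energy hpath
  obtain ⟨c, hc0, hcoer⟩ := hD.coercive
  rw [pathEnergy, Measure.restrict_congr_set Ioc_ae_eq_Icc.symm, domainEnergy,
    ofReal_integral_eq_lintegral_ofReal hint]
  · refine lintegral_congr_ae ?_
    filter_upwards [ae_unit_mem] with t ht
    rw [hprim t ht, hH.landmarkMetric_eq (hU t ht)]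
  · filter_upwards [ae_unit_mem] with t ht
    exact (mul_nonneg hc0.le (sq_nonneg _)).trans (hcoer _ (hpath.mem t ht) _)

/-- An energy path with continuous derivative gives a path of landmarks of class `C^1`. -/
theorem IsAdmissible.exists_isLandmarkPath (hH : IsAdmissible d 2 H) {q q' : Landmarks n d}
    {w : ℝ → EuclideanSpace ℝ (Fin n × Fin d)}
    (hw : IsEnergyPath (flatLandmarks n d) (flatten n d q.pt) (flatten n d q'.pt) w)
    (hc : ContinuousOn w (Icc 0 1)) :
    ∃ γ, IsLandmarkPath q q' γ ∧ pathEnergy H γ =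
      ENNReal.ofReal (domainEnergy (metricMap n H) (flatten n d q.pt) w) := by
  -- The constant extension beyond `[0, 1]` makes the velocity continuous on all of `ℝ`, so that its
  -- primitive is globally `C^1`.
  set v : ℝ → EuclideanSpace ℝ (Fin n × Fin d) := IccExtend zero_le_one ((Icc 0 1).domRestrict w)
  have hvc : Continuous v := (continuousOn_iff_continuous_domRestrict.1 hc).Icc_extend'
  have hwv : w =ᵐ[unitMeasure] v := by
    filter_upwards [ae_unit_mem] with t ht
    simp only [v, IccExtend_of_mem _ _ ht]
    rfl
  have hv := hw.congr hwv
  set γ : ℝ → Fin n → Eucl d := fun t => (flatten n d).symm (flatten n d q.pt + primitive v t)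
    with hγdef
  have hder : ∀ t, HasDerivAt γ ((flatten n d).symm (v t)) t := fun t =>
    (flatten n d).symm.hasFDerivAt.comp_hasDerivAt t
      ((hvc.integral_hasStrictDerivAt 0 t).hasDerivAt.const_add _)
  have hγC : ContDiff ℝ 1 γ := by
    rw [contDiff_one_iff_deriv]
    refine ⟨fun t => (hder t).differentiableAt, ?_⟩
    have : deriv γ = fun t => (flatten n d).symm (v t) := funext fun t => (hder t).deriv
    rw [this]
    exact (flatten n d).symm.continuous.comp hvc
  have hγ : IsLandmarkPath q q' γ := by
    refine ⟨hγC.contDiffOn, fun t ht => hv.mem t ht, ?_, ?_⟩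
    · simp [γ, primitive]
    · simp only [γ, hv.endpoint]
      simp
  refine ⟨γ, hγ, ?_⟩
  rw [(hH.isEnergyPath_of_isLandmarkPath hγ).2]
  congr 1
  refine domainEnergy_congr ?_
  filter_upwards [hwv, ae_unit_mem] with t h1 ht
  rw [(hder t).hasDerivWithinAt.derivWithin (uniqueDiffOn_Icc zero_lt_one t ht), h1]
  simp

/-- Each `C^1` path is an energy path. In the other direction a finite infimum over energy paths is
attained by a path with continuous velocity, that is, by a `C^1` path. -/
theorem IsAdmissible.geodesicDist_eq (hH : IsAdmissible d 2 H) (q q' : Landmarks n d) :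
    geodesicDist H q q' =
      domainDist (flatLandmarks n d) (metricMap n H) (flatten n d q.pt) (flatten n d q'.pt) := by
  have hD := hH.isCompleteDomain n
  have hpow : ∀ {w}, IsEnergyPath (flatLandmarks n d) (flatten n d q.pt) (flatten n d q'.pt) w →
      ENNReal.ofReal (domainEnergy (metricMap n H) (flatten n d q.pt) w) ^ (1 / 2 : ℝ) =
        ENNReal.ofReal √(domainEnergy (metricMap n H) (flatten n d q.pt) w) := fun hw => by
    rw [ENNReal.ofReal_rpow_of_nonneg (hD.energy_nonneg hw) (by norm_num), Real.sqrt_eq_rpow]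
  refine le_antisymm ?_ ?_
  · by_cases h : domainDist (flatLandmarks n d) (metricMap n H) (flatten n d q.pt)
      (flatten n d q'.pt) = ⊤
    · rw [h]; exact le_top
    obtain ⟨w, hw, hc, heq⟩ := hD.exists_domainDist_eq h
    obtain ⟨γ, hγ, hE⟩ := hH.exists_isLandmarkPath hw hc
    rw [heq, ← hpow hw, ← hE]
    exact iInf₂_le γ hγ
  · refine le_iInf₂ fun γ hγ => ?_
    obtain ⟨hw, hE⟩ := hH.isEnergyPath_of_isLandmarkPath hγ
    rw [hE, hpow hw]
    exact domainDist_le _ hw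

theorem IsAdmissible.exists_minimizing_path (hH : IsAdmissible d 2 H) {q q' : Landmarks n d}
    (h : JoinedIn (landmarkSet n d) q.pt q'.pt) :
    ∃ γ : ℝ → Fin n → Eucl d, IsLandmarkPath q q' γ ∧
      ∀ η : ℝ → Fin n → Eucl d, IsLandmarkPath q q' η → pathEnergy H γ ≤ pathEnergy H η := by
  have hD := hH.isCompleteDomain n
  have hj : JoinedIn (flatLandmarks n d) (flatten n d q.pt) (flatten n d q'.pt) := by
    obtain ⟨p, hp⟩ := h
    exact ⟨p.map (flatten n d).continuous, fun t => flatten_mem_flatLandmarks.2 (hp t)⟩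
  obtain ⟨w, hw, hc, hmin⟩ := hD.exists_continuous_minimizer
    (domainDist_ne_top_iff.1 (hD.domainDist_ne_top_iff_joinedIn.2 hj))
  obtain ⟨γ, hγ, hE⟩ := hH.exists_isLandmarkPath hw hc
  refine ⟨γ, hγ, fun η hη => ?_⟩
  obtain ⟨hv, hE'⟩ := hH.isEnergyPath_of_isLandmarkPath hη
  rw [hE, hE']
  exact ENNReal.ofReal_le_ofReal (hmin _ hv)

theorem IsAdmissible.geodesicDist_ne_top_iff (hH : IsAdmissible d 2 H) (q q' : Landmarks n d) :
    geodesicDist H q q' ≠ ⊤ ↔ JoinedIn (landmarkSet n d) q.pt q'.pt := by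
  rw [hH.geodesicDist_eq, (hH.isCompleteDomain n).domainDist_ne_top_iff_joinedIn]
  constructor
  · rintro ⟨p, hp⟩
    exact ⟨(p.map (flatten n d).symm.continuous).cast (by simp) (by simp), fun t => hp t⟩
  · rintro ⟨p, hp⟩
    exact ⟨p.map (flatten n d).continuous, fun t => flatten_mem_flatLandmarks.2 (hp t)⟩

theorem IsAdmissible.isCompleteEMetric_geodesicDist (hH : IsAdmissible d 2 H) :
    IsCompleteEMetric (geodesicDist H : Landmarks n d → Landmarks n d → ℝ≥0∞) := by
  have h := (hH.isCompleteDomain n).isCompleteEMetric (X := Landmarks n d)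
    (e := fun q => flatten n d q.pt) ?_ ?_
  · have heq : (geodesicDist H : Landmarks n d → Landmarks n d → ℝ≥0∞) = fun q q' =>
        domainDist (flatLandmarks n d) (metricMap n H) (flatten n d q.pt) (flatten n d q'.pt) :=
      funext fun q => funext fun q' => hH.geodesicDist_eq q q'
    rw [heq]
    exact h
  · rintro ⟨p, hp⟩ ⟨p', hp'⟩ h
    obtain rfl : p = p' := (flatten n d).injective h
    rfl
  · ext z
    constructor
    · rintro ⟨q, rfl⟩
      exact flatten_mem_flatLandmarks.2 q.mem
    · intro hz
      exact ⟨⟨(flatten n d).symm z, hz⟩, by simp⟩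

end Geodesic

end

noncomputable section

/-! ### Path components of landmark space -/

/-- A collision of `i` and `j` at a point of the segment other than `q` would make `r i - r j` a
multiple of `q i - q j`. -/
theorem segment_subset_landmarkSet {n d : ℕ} {q r : Fin n → Eucl d} (hq : q ∈ landmarkSet n d)
    (h : ∀ i j, i ≠ j → r i - r j ∉ Submodule.span ℝ {q i - q j}) :
    segment ℝ q r ⊆ landmarkSet n d := by
  rintro _ ⟨a, b, -, -, hab, rfl⟩ i j hij
  by_contra hne
  have h0 : b • (r i - r j) = -a • (q i - q j) := by
    have h1 : a • q i + b • r i = a • q j + b • r j := hij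
    have h2 : b • (r i - r j) + a • (q i - q j) = 0 := by
      rw [smul_sub, smul_sub, ← sub_eq_zero.2 h1]
      abel
    rw [neg_smul]
    exact eq_neg_of_add_eq_zero_left h2
  rcases eq_or_ne b 0 with rfl | hb
  · rw [add_zero] at hab
    rw [hab, zero_smul, neg_smul, one_smul, eq_comm, neg_eq_zero, sub_eq_zero] at h0
    exact hne (hq h0)
  · refine h i j hne (Submodule.mem_span_singleton.2 ⟨b⁻¹ * -a, ?_⟩)
    rw [mul_smul, ← h0, smul_smul, inv_mul_cancel₀ hb, one_smul]

/-- Each excluded condition is a proper subspace, since a line is not all of `ℝ^d` when `d ≥ 2`; a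
real vector space is not a finite union of proper subspaces. The resulting `r` is visible from both
`q` and `q'` along segments. -/
theorem exists_forall_sub_notMem_span {n d : ℕ} (hd : 2 ≤ d) (q q' : Fin n → Eucl d) :
    ∃ r : Fin n → Eucl d, ∀ i j, i ≠ j →
      r i - r j ∉ Submodule.span ℝ {q i - q j} ∧ r i - r j ∉ Submodule.span ℝ {q' i - q' j} := by
  let P : Fin n → Fin n → (Fin n → Eucl d) →ₗ[ℝ] Eucl d := fun i j =>
    LinearMap.proj (R := ℝ) (φ := fun _ : Fin n => Eucl d) i -
      LinearMap.proj (R := ℝ) (φ := fun _ : Fin n => Eucl d) j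
  let ι := {p : Fin n × Fin n // p.1 ≠ p.2} × Bool
  let W : ι → Submodule ℝ (Fin n → Eucl d) := fun p =>
    (Submodule.span ℝ {bif p.2 then q p.1.1.1 - q p.1.1.2 else q' p.1.1.1 - q' p.1.1.2}).comap
      (P p.1.1.1 p.1.1.2)
  have hW : ∀ p, W p ≠ ⊤ := by
    rintro ⟨⟨⟨i, j⟩, hij⟩, b⟩ htop
    have hsurj : Function.Surjective (P i j) := fun y =>
      ⟨Pi.single i y, by simp [P, hij.symm]⟩
    have h1 : ∀ y : Eucl d,
        y ∈ Submodule.span ℝ {bif b then q i - q j else q' i - q' j} := by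
      intro y
      obtain ⟨x, rfl⟩ := hsurj y
      have : x ∈ W ⟨⟨⟨i, j⟩, hij⟩, b⟩ := htop ▸ Submodule.mem_top
      exact this
    have h2 := finrank_span_le_card (R := ℝ)
      ({bif b then q i - q j else q' i - q' j} : Set (Eucl d))
    rw [toFinset_singleton, Finset.card_singleton, (Submodule.eq_top_iff').2 h1, finrank_top, finrank_euclideanSpace, Fintype.card_fin] at h2
    omega
  by_contra hn
  push Not at hn
  have hcover : ⋃ p, (W p : Set (Fin n → Eucl d)) = univ := by
    refine eq_univ_of_forall fun r => mem_iUnion.2 ?_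
    obtain ⟨i, j, hij, h⟩ := hn r
    by_cases h1 : r i - r j ∈ Submodule.span ℝ {q i - q j}
    · exact ⟨⟨⟨⟨i, j⟩, hij⟩, true⟩, h1⟩
    · exact ⟨⟨⟨⟨i, j⟩, hij⟩, false⟩, h h1⟩
  obtain ⟨p, hp⟩ := Subspace.exists_eq_top_of_iUnion_eq_univ hcover
  exact hW p hp

theorem joinedIn_landmarkSet {n d : ℕ} (h : 2 ≤ d ∨ n ≤ 1) {q q' : Fin n → Eucl d}
    (hq : q ∈ landmarkSet n d) (hq' : q' ∈ landmarkSet n d) : JoinedIn (landmarkSet n d) q q' := by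
  rcases h with hd | hn
  · obtain ⟨r, hr⟩ := exists_forall_sub_notMem_span hd q q'
    have h1 : JoinedIn (landmarkSet n d) q r := JoinedIn.of_segment_subset
      (segment_subset_landmarkSet hq fun i j hij => (hr i j hij).1)
    have h2 : JoinedIn (landmarkSet n d) q' r := JoinedIn.of_segment_subset
      (segment_subset_landmarkSet hq' fun i j hij => (hr i j hij).2)
    exact h1.trans h2.symm
  · have : Subsingleton (Fin n) := Fin.subsingleton_iff_le_one.2 hn
    exact JoinedIn.of_segment_subset fun p _ => Function.injective_of_subsingleton p

/-! ### Flow lines are paths of landmarks -/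

/-- Uniqueness of integral curves backwards in time: flow lines that meet have the same starting
point, so landmarks do not collide under a flow. -/
theorem eq_of_flow_eq {d : ℕ} {v : ℝ → Eucl d → Eucl d}
    (hv : ContDiffOn ℝ 1 (fun p : ℝ × Eucl d => v p.1 p.2) (Icc (0 : ℝ) 1 ×ˢ univ))
    {f g : ℝ → Eucl d}
    (hf : ∀ t ∈ Icc (0 : ℝ) 1, HasDerivWithinAt f (v t (f t)) (Icc 0 1) t)
    (hg : ∀ t ∈ Icc (0 : ℝ) 1, HasDerivWithinAt g (v t (g t)) (Icc 0 1) t)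
    {t : ℝ} (ht : t ∈ Icc (0 : ℝ) 1) (hfg : f t = g t) : f 0 = g 0 := by
  have hfc : ContinuousOn f (Icc 0 1) := fun s hs => (hf s hs).continuousWithinAt
  have hgc : ContinuousOn g (Icc 0 1) := fun s hs => (hg s hs).continuousWithinAt
  obtain ⟨A, hA⟩ := isCompact_Icc.exists_bound_of_continuousOn hfc
  obtain ⟨B, hB⟩ := isCompact_Icc.exists_bound_of_continuousOn hgc
  -- A ball containing both curves; a `C^1` field is Lipschitz on its product with the time interval
  -- by compactness.
  set S : Set (Eucl d) := Metric.closedBall 0 (max A B)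
  obtain ⟨K, hK⟩ := (hv.mono (prod_mono_right (subset_univ S))).exists_lipschitzOnWith one_ne_zero
    ((convex_Icc 0 1).prod (convex_closedBall _ _))
    (isCompact_Icc.prod (isCompact_closedBall _ _))
  have hsub : Icc 0 t ⊆ Icc 0 1 := Icc_subset_Icc_right ht.2
  have hder : ∀ {h : ℝ → Eucl d}, (∀ t ∈ Icc (0 : ℝ) 1,
      HasDerivWithinAt h (v t (h t)) (Icc 0 1) t) → ∀ s ∈ Ioc 0 t,
      HasDerivWithinAt h (v s (h s)) (Iic s) s := fun hh s hs => by
    have hs1 : s ∈ Icc (0 : ℝ) 1 := hsub (Ioc_subset_Icc_self hs)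
    exact (hh s hs1).mono_of_mem_nhdsWithin
      (Filter.mem_of_superset (Icc_mem_nhdsLE hs.1) (Icc_subset_Icc_right hs1.2))
  refine ODE_solution_unique_of_mem_Icc_left (v := v) (s := fun _ => S) (K := K) ?_ (hfc.mono hsub)
    (hder hf) (fun s hs => ?_) (hgc.mono hsub) (hder hg) (fun s hs => ?_) hfg
    (left_mem_Icc.2 ht.1)
  · intro s hs
    have hs1 : s ∈ Icc (0 : ℝ) 1 := hsub (Ioc_subset_Icc_self hs)
    intro x hx y hy
    have := hK (mk_mem_prod hs1 hx) (mk_mem_prod hs1 hy)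
    simpa [Prod.edist_eq] using this
  · exact mem_closedBall_zero_iff.2 ((hA s (hsub (Ioc_subset_Icc_self hs))).trans (le_max_left _ _))
  · exact mem_closedBall_zero_iff.2
      ((hB s (hsub (Ioc_subset_Icc_self hs))).trans (le_max_right _ _))

section Flow

variable {n d : ℕ} {H : Type*} [NormedAddCommGroup H] [InnerProductSpace ℝ H]
  [RKHS ℝ H (Eucl d) (Eucl d)] [CompleteSpace H]

/-- The trajectories of the landmarks form a competitor whose velocity is the evaluation of `v`, so
its energy density is at most `‖v‖²` by minimality of the lift. -/
theorem IsAdmissible.geodesicDist_le_flowDist {k : ℕ} (hH : IsAdmissible d k H)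
    (q q' : Landmarks n d) : geodesicDist H q q' ≤ flowDist H q q' := by
  refine le_iInf fun v => le_iInf fun hv => le_iInf fun ⟨φ, ⟨hφ0, hφ⟩, hφ1⟩ => ?_
  set γ : ℝ → Fin n → Eucl d := fun t i => φ t (q.pt i) with hγdef
  have hder : ∀ t ∈ Icc (0 : ℝ) 1,
      HasDerivWithinAt γ (fun i => v t (γ t i)) (Icc 0 1) t := fun t ht =>
    hasDerivWithinAt_pi.2 fun i => hφ (q.pt i) t ht
  have hγc : ContinuousOn γ (Icc 0 1) := fun t ht => (hder t ht).continuousWithinAt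
  have hdw : ∀ t ∈ Icc (0 : ℝ) 1, derivWithin γ (Icc 0 1) t = fun i => v t (γ t i) :=
    fun t ht => (hder t ht).derivWithin (uniqueDiffOn_Icc zero_lt_one t ht)
  have hγ : IsLandmarkPath q q' γ := by
    refine ⟨?_, fun t ht i j hij => ?_, ?_, ?_⟩
    · rw [contDiffOn_one_iff_derivWithin (uniqueDiffOn_Icc zero_lt_one)]
      refine ⟨fun t ht => (hder t ht).differentiableWithinAt, ?_⟩
      refine ContinuousOn.congr (continuousOn_pi.2 fun i => ?_) hdw
      exact hv.2.continuousOn.comp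
        (continuousOn_id.prodMk ((continuous_apply i).comp_continuousOn hγc))
        (fun t ht => ⟨ht, mem_univ _⟩)
    · have h := eq_of_flow_eq (v := fun t x => v t x) (hv.2.of_le (by exact_mod_cast le_top))
        (hφ (q.pt i)) (hφ (q.pt j)) ht hij
      rw [hφ0, hφ0] at h
      exact q.mem h
    · exact funext fun i => hφ0 _
    · exact funext fun i => hφ1 i
  refine (iInf₂_le γ hγ).trans ?_
  refine ENNReal.rpow_le_rpow ?_ (by norm_num)
  refine setLIntegral_mono' measurableSet_Icc fun t ht => ?_
  have hU := hγ.2.1 t ht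
  rw [hdw t ht, hH.landmarkMetric_eq hU, ← evalMap_flatten_apply]
  have h := hH.inner_metricMap_le (flatten_mem_flatLandmarks.2 hU) (v t)
  rw [← ofReal_norm, ← ENNReal.ofReal_pow (norm_nonneg _)]
  exact ENNReal.ofReal_le_ofReal h

end Flow

end

noncomputable section

/-! ### Smooth controls that follow a given path -/

/-- Bernstein approximation of a continuous curve with coefficients in a dense set. -/
theorem exists_smooth_approx {V : Type*} [NormedAddCommGroup V] [NormedSpace ℝ V] {f : ℝ → V}
    (hf : ContinuousOn f (Icc 0 1)) {S : Set V} (hS : Dense S) {δ : ℝ} (hδ : 0 < δ) :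
    ∃ (N : ℕ) (b : Fin (N + 1) → ℝ → ℝ) (c : Fin (N + 1) → V), (∀ k, ContDiff ℝ ∞ (b k)) ∧
      (∀ k, c k ∈ S) ∧ ∀ t ∈ Icc (0 : ℝ) 1, ‖∑ k, b k t • c k - f t‖ ≤ δ := by
  let g : C(unitInterval, V) := ⟨(Icc 0 1).domRestrict f,
    continuousOn_iff_continuous_domRestrict.1 hf⟩
  have h1 := (Metric.tendsto_atTop.1 (bernsteinApproximation_uniform g)) (δ / 2) (by positivity)
  obtain ⟨N, hN⟩ := h1
  have h2 := hN N le_rfl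
  have hS' : ∀ k : Fin (N + 1), ∃ c ∈ S, dist (g (bernstein.z k)) c < δ / 2 := fun k =>
    hS.exists_dist_lt _ (by positivity)
  choose c hcS hc using hS'
  refine ⟨N, fun k t => (bernsteinPolynomial ℝ N k).eval t, c, fun k =>
      Polynomial.contDiff_aeval (bernsteinPolynomial ℝ N k) ∞, hcS, fun t ht => ?_⟩
  set x : unitInterval := ⟨t, ht⟩
  have hb : ∀ k : Fin (N + 1), (bernsteinPolynomial ℝ N k).eval t = bernstein N k x := fun k => rfl
  have h3 : ‖bernsteinApproximation N g x - f t‖ ≤ δ / 2 := by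
    have := (ContinuousMap.dist_apply_le_dist (f := bernsteinApproximation N g) (g := g) x).trans h2.le
    rwa [dist_eq_norm] at this
  have h4 : ‖∑ k : Fin (N + 1), bernstein N k x • c k - bernsteinApproximation N g x‖ ≤ δ / 2 := by
    rw [bernsteinApproximation.apply, ← Finset.sum_sub_distrib]
    calc _ ≤ ∑ k : Fin (N + 1), bernstein N k x * (δ / 2) := by
          refine norm_sum_le_of_le _ fun k _ => ?_
          rw [← smul_sub, norm_smul, Real.norm_of_nonneg bernstein_nonneg, ← dist_eq_norm, dist_comm]
          exact mul_le_mul_of_nonneg_left (hc k).le bernstein_nonneg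
      _ = δ / 2 := by rw [← Finset.sum_mul, bernstein.probability, one_mul]
  simp only [hb]
  calc _ ≤ _ := norm_sub_le_norm_sub_add_norm_sub _ (bernsteinApproximation N g x) _
    _ ≤ δ := by linarith

theorem norm_primitive_le {V : Type*} [NormedAddCommGroup V] [NormedSpace ℝ V] {w : ℝ → V} {δ : ℝ}
    (hw : ∀ t ∈ Icc (0 : ℝ) 1, ‖w t‖ ≤ δ) {t : ℝ} (ht : t ∈ Icc (0 : ℝ) 1) :
    ‖primitive w t‖ ≤ δ := by
  have hδ : 0 ≤ δ := (norm_nonneg _).trans (hw 0 (by simp))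
  have h := intervalIntegral.norm_integral_le_of_norm_le_const (a := 0) (b := t) (C := δ) (f := w)
    (fun s hs => by
      rw [uIoc_of_le ht.1] at hs
      exact hw s ⟨hs.1.le, hs.2.trans ht.2⟩)
  rw [sub_zero, abs_of_nonneg ht.1] at h
  exact h.trans (mul_le_of_le_one_right hδ ht.2)

/-- Smooth approximation of a path with fixed end points. -/
theorem exists_smooth_path {V : Type*} [NormedAddCommGroup V] [NormedSpace ℝ V] [CompleteSpace V]
    {w : ℝ → V} (hw : ContinuousOn w (Icc 0 1)) {δ : ℝ} (hδ : 0 < δ) :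
    ∃ v : ℝ → V, ContDiff ℝ ∞ v ∧ ContDiff ℝ ∞ (primitive v) ∧
      (∀ t, HasDerivAt (primitive v) (v t) t) ∧ primitive v 1 = primitive w 1 ∧
      (∀ t ∈ Icc (0 : ℝ) 1, ‖v t - w t‖ ≤ δ) ∧
      ∀ t ∈ Icc (0 : ℝ) 1, ‖primitive v t - primitive w t‖ ≤ δ := by
  obtain ⟨N, b, c, hb, -, hbc⟩ := exists_smooth_approx hw dense_univ (half_pos hδ)
  set g : ℝ → V := fun t => ∑ k, b k t • c k
  have hg : ContDiff ℝ ∞ g := ContDiff.sum fun k _ => (hb k).smul contDiff_const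
  have hgw : ∀ t ∈ Icc (0 : ℝ) 1, ‖g t - w t‖ ≤ δ / 2 := hbc
  have hint : ∀ {u : ℝ → V}, ContinuousOn u (Icc 0 1) → ∀ t ∈ Icc (0 : ℝ) 1,
      IntervalIntegrable u volume 0 t := fun hu t ht =>
    (hu.mono (Icc_subset_Icc_right ht.2)).intervalIntegrable_of_Icc ht.1
  have hsub : ∀ {u u' : ℝ → V}, ContinuousOn u (Icc 0 1) → ContinuousOn u' (Icc 0 1) →
      ∀ t ∈ Icc (0 : ℝ) 1, primitive u t - primitive u' t = primitive (fun s => u s - u' s) t :=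
    fun hu hu' t ht => (intervalIntegral.integral_sub (hint hu t ht) (hint hu' t ht)).symm
  have h1m : (1 : ℝ) ∈ Icc (0 : ℝ) 1 := by simp
  -- Adding this constant velocity restores the end point exactly; its size is at most the
  -- approximation error, which is why `δ / 2` was used.
  set e := primitive w 1 - primitive g 1
  have he : ‖e‖ ≤ δ / 2 := by
    rw [← norm_neg, neg_sub, hsub hg.continuous.continuousOn hw 1 h1m]
    exact norm_primitive_le hgw h1m
  set v : ℝ → V := fun t => g t + e
  have hv : ContDiff ℝ ∞ v := hg.add contDiff_const
  have hvw : ∀ t ∈ Icc (0 : ℝ) 1, ‖v t - w t‖ ≤ δ := fun t ht => by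
    calc ‖v t - w t‖ = ‖(g t - w t) + e‖ := by congr 1; simp only [v]; abel
      _ ≤ δ := (norm_add_le _ _).trans (by linarith [hgw t ht])
  have hder : ∀ t, HasDerivAt (primitive v) (v t) t := fun t =>
    (hv.continuous.integral_hasStrictDerivAt 0 t).hasDerivAt
  refine ⟨v, hv, ?_, hder, ?_, hvw, fun t ht => ?_⟩
  · rw [contDiff_infty_iff_deriv]
    refine ⟨fun t => (hder t).differentiableAt, ?_⟩
    rwa [funext fun t => (hder t).deriv]
  · have : primitive v 1 = primitive g 1 + e := by
      simp only [primitive, v]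
      rw [intervalIntegral.integral_add (hg.continuous.intervalIntegrable _ _)
        intervalIntegrable_const]
      simp
    rw [this]
    simp [e]
  · rw [hsub hv.continuous.continuousOn hw t ht]
    exact norm_primitive_le hvw ht

/-! ### Flows with prescribed integral curves -/

section Control

variable {n d : ℕ} {H : Type*} [NormedAddCommGroup H] [InnerProductSpace ℝ H]
  [RKHS ℝ H (Eucl d) (Eucl d)]

/-- Existence of flows that contain given integral curves. -/
theorem IsAdmissible.exists_isFlow (hH : IsAdmissible d 2 H) {v : ℝ → H} (hv : IsSmoothControl v)
    {M : ℝ} (hM : ∀ t ∈ Icc (0 : ℝ) 1, ‖v t‖ ≤ M) {γ : Fin n → ℝ → Eucl d}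
    (hγ0 : Function.Injective fun i => γ i 0)
    (hγ : ∀ i, ∀ t ∈ Icc (0 : ℝ) 1, HasDerivWithinAt (γ i) (v t (γ i t)) (Icc 0 1) t) :
    ∃ φ, IsFlow v φ ∧ ∀ i, φ 1 (γ i 0) = γ i 1 := by
  obtain ⟨C, h0, -, hlip, -⟩ := hH.exists_bounds
  have hM0 : 0 ≤ M := (norm_nonneg _).trans (hM 0 (by simp))
  have hcurve : ∀ x : Eucl d, ∃ α : ℝ → Eucl d, α 0 = x ∧
      (∀ t ∈ Icc (0 : ℝ) 1, HasDerivWithinAt α (v t (α t)) (Icc 0 1) t) ∧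
      ∀ i, γ i 0 = x → α 1 = γ i 1 := by
    intro x
    by_cases hx : ∃ i, γ i 0 = x
    · obtain ⟨i, rfl⟩ := hx
      refine ⟨γ i, rfl, hγ i, fun j hj => ?_⟩
      rw [hγ0 hj]
    -- `L` bounds both the speed and the Lipschitz constant of the field. In unit time a curve stays
    -- within radius `L` of its start, so Picard-Lindelöf covers all of `[0, 1]` at once.
    · set L : ℝ≥0 := C * M.toNNReal with hL
      have hLM : (L : ℝ) = C * M := by rw [hL, NNReal.coe_mul, Real.coe_toNNReal _ hM0]
      have hpl : IsPicardLindelof (fun t x => v t x) (⟨0, by simp⟩ : Icc (0 : ℝ) 1) x L 0 L L := by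
        refine ⟨fun t ht => ?_, fun y _ => ?_, fun t ht y _ => ?_, ?_⟩
        · refine LipschitzOnWith.of_dist_le_mul fun y _ z _ => ?_
          rw [dist_eq_norm, dist_eq_norm, hLM]
          exact (hlip (v t) y z).trans (by gcongr; exact hM t ht)
        · exact hv.2.continuousOn.comp (continuousOn_id.prodMk continuousOn_const)
            fun t ht => ⟨ht, mem_univ _⟩
        · rw [hLM]
          exact (h0 (v t) y).trans (by gcongr; exact hM t ht)
        · simp
      obtain ⟨α, hα0, hα⟩ := hpl.exists_eq_forall_mem_Icc_hasDerivWithinAt₀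
      exact ⟨α, hα0, hα, fun i hi => absurd ⟨i, hi⟩ hx⟩
  choose α hα0 hα hα1 using hcurve
  exact ⟨fun t x => α x t, ⟨fun x => hα0 x, fun x => hα x⟩, fun i => hα1 _ i rfl⟩

end Control

end

/-! ### Smooth controls with exact end points, and equality of the two distances -/

noncomputable section

section Control

variable {n d : ℕ} {H : Type*} [NormedAddCommGroup H] [InnerProductSpace ℝ H]
  [RKHS ℝ H (Eucl d) (Eucl d)] [CompleteSpace H]

theorem norm_flatten_symm_le (z : EuclideanSpace ℝ (Fin n × Fin d)) (i : Fin n) :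
    ‖(flatten n d).symm z i‖ ≤ ‖z‖ := by
  simpa using norm_le_norm_flatten ((flatten n d).symm z) i

theorem IsAdmissible.continuousOn_horizontalLift (hH : IsAdmissible d 2 H)
    {z h : ℝ → EuclideanSpace ℝ (Fin n × Fin d)} {s : Set ℝ} (hz : ContinuousOn z s)
    (hzU : ∀ t ∈ s, z t ∈ flatLandmarks n d) (hh : ContinuousOn h s) :
    ContinuousOn (fun t => horizontalLift n H (z t) (h t)) s :=
  ((hH.contDiff_adjoint_evalMap n).continuous.comp_continuousOn hz).clm_apply
    (((hH.contDiffOn_metricMap n).continuousOn.comp hz hzU).clm_apply hh)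

theorem IsAdmissible.horizontalLift_apply {k : ℕ} (hH : IsAdmissible d k H)
    {z : EuclideanSpace ℝ (Fin n × Fin d)} (hz : z ∈ flatLandmarks n d)
    (h : EuclideanSpace ℝ (Fin n × Fin d)) (i : Fin n) :
    horizontalLift n H z h ((flatten n d).symm z i) = (flatten n d).symm h i := by
  have hval := hH.evalMap_horizontalLift hz h
  rw [evalMap_apply, ← (flatten n d).eq_symm_apply] at hval
  exact congrFun hval i

omit [CompleteSpace H] in
theorem sum_smul_apply {ι : Type*} (s : Finset ι) (b : ι → ℝ) (X : ι → H) (p : Eucl d) :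
    (∑ k ∈ s, b k • X k) p = ∑ k ∈ s, b k • X k p := by
  rw [← evalAt_apply, map_sum]
  simp

/-- A path of landmarks is approximated by flow lines of smooth controls, with the same end points
and with norms close to those of the horizontal lift. -/
theorem IsAdmissible.exists_control (hH : IsAdmissible d 2 H) {q q' : Landmarks n d}
    {w : ℝ → EuclideanSpace ℝ (Fin n × Fin d)}
    (hw : IsEnergyPath (flatLandmarks n d) (flatten n d q.pt) (flatten n d q'.pt) w)
    (hc : ContinuousOn w (Icc 0 1)) {ε : ℝ} (hε : 0 < ε) :
    ∃ v : ℝ → H, IsSmoothControl v ∧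
      (∃ φ : ℝ → Eucl d → Eucl d, IsFlow v φ ∧ ∀ i, φ 1 (q.pt i) = q'.pt i) ∧
      ∀ t ∈ Icc (0 : ℝ) 1, ‖v t‖ ≤
        ‖horizontalLift n H (flatten n d q.pt + primitive w t) (w t)‖ + ε := by
  set x := flatten n d q.pt with hx
  set E := (flatten n d).symm with hE
  set u : ℝ → H := fun t => horizontalLift n H (x + primitive w t) (w t) with hudef
  have hu : ContinuousOn u (Icc 0 1) := hH.continuousOn_horizontalLift hw.continuousOn hw.mem hc
  obtain ⟨M, hM⟩ := isCompact_Icc.exists_bound_of_continuousOn hu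
  have hM0 : 0 ≤ M := (norm_nonneg _).trans (hM 0 (by simp))
  obtain ⟨R, hR⟩ := isCompact_Icc.exists_bound_of_continuousOn hw.continuousOn
  obtain ⟨C, h0, -, hlip, -⟩ := hH.exists_bounds
  obtain ⟨ρ, hρ, hsep⟩ := exists_separation (K := (fun t => E (x + primitive w t)) '' Icc (0 : ℝ) 1)
    (isCompact_Icc.image_of_continuousOn (E.continuous.comp_continuousOn hw.continuousOn))
    (by rintro _ ⟨t, ht, rfl⟩; exact hw.mem t ht)
  obtain ⟨f, hf, hf0, hfz, B, hB⟩ := hH.exists_bump (half_pos hρ) (R + 1)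
  -- The total error in `H` is at most `A * δ`: the `1` accounts for approximating the lift, the
  -- rest for `n` bump fields with coefficients of size `(1 + C * M + C) * δ`.
  set A : ℝ := 1 + n * (B * (1 + C * M + C)) with hA
  have hA0 : 0 < A := by positivity
  -- `δ ≤ 1` keeps the new landmarks in the ball where bumps are controlled, and `4 * δ ≤ ρ` keeps
  -- them `ρ / 2` apart, the radius of the bumps.
  obtain ⟨δ, hδ, hδ1, hδρ, hδε⟩ : ∃ δ > 0, δ ≤ 1 ∧ 4 * δ ≤ ρ ∧ A * δ ≤ ε := by
    refine ⟨min 1 (min (ρ / 4) (ε / A)), by positivity, min_le_left _ _, ?_, ?_⟩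
    · have := (min_le_right 1 (min (ρ / 4) (ε / A))).trans (min_le_left _ _)
      linarith
    · rw [← le_div_iff₀' hA0]
      exact (min_le_right _ _).trans (min_le_right _ _)
  obtain ⟨g, hg, hPg, hder, hend, hgw, hPgw⟩ := exists_smooth_path hc hδ
  obtain ⟨N, b, X, hb, hX, hy⟩ := exists_smooth_approx hu hH.dense hδ
  set y : ℝ → H := fun t => ∑ k, b k t • X k with hydef
  have hyp : ∀ t p, y t p = ∑ k, b k t • X k p := fun t p => sum_smul_apply _ _ _ _
  set γ : Fin n → ℝ → Eucl d := fun i t => E (x + primitive g t) i with hγdef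
  have hproj : ∀ i, ContDiff ℝ ∞ fun z => E z i := fun i =>
    (ContinuousLinearMap.proj (R := ℝ) (φ := fun _ : Fin n => Eucl d) i).contDiff.comp E.contDiff
  have hγC : ∀ i, ContDiff ℝ ∞ (γ i) := fun i => (hproj i).comp (contDiff_const.add hPg)
  have hγd : ∀ i t, HasDerivAt (γ i) (E (g t) i) t := fun i t =>
    hasDerivAt_pi.1 (E.hasFDerivAt.comp_hasDerivAt t ((hder t).const_add x)) i
  -- The velocity that the approximating field lacks at landmark `i` of the smoothed path.
  set r : Fin n → ℝ → Eucl d := fun i t => E (g t) i - ∑ k, b k t • X k (γ i t) with hrdef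
  have hrC : ∀ i, ContDiff ℝ ∞ (r i) := fun i => ((hproj i).comp hg).sub
    (ContDiff.sum fun k _ => (hb k).smul ((hX k).1.comp (hγC i)))
  have hclose : ∀ i, ∀ t ∈ Icc (0 : ℝ) 1, ‖E (x + primitive w t) i - γ i t‖ ≤ δ := by
    intro i t ht
    have := norm_flatten_symm_le (primitive w t - primitive g t) i
    rw [norm_sub_rev (primitive w t)] at this
    refine le_trans (le_of_eq ?_) (this.trans (hPgw t ht))
    simp [γ, hE]
  have hrle : ∀ i, ∀ t ∈ Icc (0 : ℝ) 1, ‖r i t‖ ≤ (1 + C * M + C) * δ := by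
    intro i t ht
    -- Three errors: in the velocity of the path, in the position at which the lift is evaluated,
    -- and in the lift itself.
    have e1 : r i t = E (g t - w t) i + (u t (E (x + primitive w t) i) - u t (γ i t)) +
        -((y t - u t) (γ i t)) := by
      simp only [r, u, RKHS.coe_sub, Pi.sub_apply, hyp, map_sub]
      rw [hH.horizontalLift_apply (hw.mem t ht)]
      abel
    have b1 : ‖E (g t - w t) i‖ ≤ δ := (norm_flatten_symm_le _ i).trans (hgw t ht)
    have b2 : ‖u t (E (x + primitive w t) i) - u t (γ i t)‖ ≤ C * M * δ :=
      (hlip _ _ _).trans (by gcongr; exacts [hM t ht, hclose i t ht])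
    have b3 : ‖(y t - u t) (γ i t)‖ ≤ C * δ := (h0 _ _).trans (by gcongr; exact hy t ht)
    rw [e1]
    refine (norm_add₃_le).trans ?_
    rw [norm_neg]
    linarith
  have hγsep : ∀ t ∈ Icc (0 : ℝ) 1, ∀ i j, i ≠ j → ρ / 2 ≤ ‖γ i t - γ j t‖ := by
    intro t ht i j hij
    have h1 := hsep _ ⟨t, ht, rfl⟩ i j hij
    have h2 : ‖E (x + primitive w t) i - E (x + primitive w t) j‖ ≤
        ‖E (x + primitive w t) i - γ i t‖ + ‖γ i t - γ j t‖ +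
          ‖E (x + primitive w t) j - γ j t‖ := by
      rw [norm_sub_rev (E (x + primitive w t) j)]
      refine le_trans (le_of_eq ?_) norm_add₃_le
      congr 1
      abel
    linarith [hclose i t ht, hclose j t ht]
  have hγR : ∀ i, ∀ t ∈ Icc (0 : ℝ) 1, γ i t ∈ Metric.closedBall (0 : Eucl d) (R + 1) := by
    intro i t ht
    rw [mem_closedBall_zero_iff]
    have h1 := norm_sub_norm_le (γ i t) (E (x + primitive w t) i)
    rw [norm_sub_rev] at h1
    linarith [hclose i t ht, (norm_flatten_symm_le (x + primitive w t) i).trans (hR t ht)]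
  -- The approximating field plus moving bumps that carry the residuals. It is smooth jointly in
  -- time and space and has the smoothed landmark curves as integral curves.
  set Φ : ℝ × Eucl d → Eucl d := fun p =>
    ∑ k, b k p.1 • X k p.2 + ∑ i, f (p.2 - γ i p.1) • r i p.1 with hΦ
  have hΦC : ContDiff ℝ ∞ Φ := by
    refine (ContDiff.sum fun k _ => ?_).add (ContDiff.sum fun i _ => ?_)
    · exact ((hb k).comp contDiff_fst).smul ((hX k).1.comp contDiff_snd)
    · exact (hf.comp (contDiff_snd.sub ((hγC i).comp contDiff_fst))).smul
        ((hrC i).comp contDiff_fst)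
  -- Each time slice of `Φ` must be represented by an element of `H`. The choice outside `[0, 1]` is
  -- immaterial, as only the unit interval enters.
  have hex : ∀ t, ∃ V : H, t ∈ Icc (0 : ℝ) 1 → (∀ p, V p = Φ (t, p)) ∧ ‖V‖ ≤ ‖u t‖ + ε := by
    intro t
    by_cases ht : t ∈ Icc (0 : ℝ) 1
    · choose ξ hξ hξn using fun i => hB (γ i t) (hγR i t ht) (r i t)
      refine ⟨y t + ∑ i, ξ i, fun _ => ⟨fun p => ?_, ?_⟩⟩
      · have hs : (∑ i, ξ i) p = ∑ i, ξ i p := map_sum (evalAt H p) ξ Finset.univ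
        simp only [RKHS.coe_add, Pi.add_apply, hs, hξ, hyp, Φ]
      · have h1 : ‖y t‖ ≤ ‖u t‖ + δ := by
          have := norm_sub_norm_le (y t) (u t)
          linarith [hy t ht]
        have h2 : ‖∑ i, ξ i‖ ≤ n * (B * ((1 + C * M + C) * δ)) := by
          refine (norm_sum_le_of_le _ fun i _ => (hξn i).trans
            (mul_le_mul_of_nonneg_left (hrle i t ht) B.2)).trans (le_of_eq ?_)
          simp
        have h3 : A * δ = δ + n * (B * ((1 + C * M + C) * δ)) := by rw [hA]; ring
        exact (norm_add_le _ _).trans (by linarith)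
    · exact ⟨0, fun h => absurd h ht⟩
  choose v hv using hex
  have hvM : ∀ t ∈ Icc (0 : ℝ) 1, ‖v t‖ ≤ M + ε := fun t ht =>
    (hv t ht).2.trans (by linarith [hM t ht])
  have hvc : IsSmoothControl v := by
    refine ⟨⟨(⋃ k, tsupport (X k : Eucl d → Eucl d)) ∪ Metric.closedBall 0 (R + 1 + ρ / 2), ?_, ?_⟩,
      ?_⟩
    · exact (isCompact_iUnion fun k => (hX k).2).union (isCompact_closedBall _ _)
    · intro t ht
      refine closure_minimal (fun p hp => ?_) ((isClosed_iUnion_of_finite fun k =>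
        isClosed_tsupport _).union Metric.isClosed_closedBall)
      by_contra hn
      rw [mem_union, not_or, mem_iUnion, not_exists] at hn
      refine hp ?_
      rw [(hv t ht).1 p]
      simp only [Φ]
      rw [Finset.sum_eq_zero, Finset.sum_eq_zero, add_zero]
      · intro i _
        rw [hfz, zero_smul]
        by_contra hlt
        rw [not_le] at hlt
        refine hn.2 (mem_closedBall_zero_iff.2 ?_)
        have h1 := mem_closedBall_zero_iff.1 (hγR i t ht)
        have h2 := norm_sub_norm_le p (γ i t)
        linarith
      · intro k _
        rw [image_eq_zero_of_notMem_tsupport (hn.1 k), smul_zero]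
    · exact hΦC.contDiffOn.congr fun p hp => (hv p.1 hp.1).1 p.2
  have hvγ : ∀ t ∈ Icc (0 : ℝ) 1, ∀ i, v t (γ i t) = E (g t) i := by
    intro t ht i
    rw [(hv t ht).1]
    simp only [Φ]
    -- At `γ i t` only its own bump acts, the others being centred at distance at least `ρ / 2`.
    rw [Finset.sum_eq_single (a := i) (f := fun j => f (γ i t - γ j t) • r j t), sub_self, hf0,
      one_smul]
    · simp [r]
    · intro j _ hji
      rw [hfz _ (hγsep t ht i j hji.symm), zero_smul]
    · simp
  have hγ0 : ∀ i, γ i 0 = q.pt i := fun i => by simp [γ, primitive, hx, hE]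
  have hγ1 : ∀ i, γ i 1 = q'.pt i := fun i => by
    simp only [γ]
    rw [hend, hw.endpoint]
    simp [hE]
  obtain ⟨φ, hφ, hφ1⟩ := hH.exists_isFlow hvc hvM (γ := γ) (by simp only [hγ0]; exact q.mem)
    (fun i t ht => by rw [hvγ t ht]; exact (hγd i t).hasDerivWithinAt)
  refine ⟨v, hvc, ⟨φ, hφ, fun i => ?_⟩, fun t ht => (hv t ht).2⟩
  rw [← hγ0, hφ1, hγ1]

theorem IsAdmissible.flowDist_le_geodesicDist (hH : IsAdmissible d 2 H) (q q' : Landmarks n d) :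
    flowDist H q q' ≤ geodesicDist H q q' := by
  have hD := hH.isCompleteDomain n
  rw [hH.geodesicDist_eq]
  by_cases h : domainDist (flatLandmarks n d) (metricMap n H) (flatten n d q.pt)
      (flatten n d q'.pt) = ⊤
  · rw [h]; exact le_top
  obtain ⟨w, hw, hc, heq⟩ := hD.exists_domainDist_eq h
  rw [heq]
  set a := domainEnergy (metricMap n H) (flatten n d q.pt) w with ha
  have hu := hH.continuousOn_horizontalLift hw.continuousOn hw.mem hc
  obtain ⟨M, hM⟩ := isCompact_Icc.exists_bound_of_continuousOn hu
  have hint := hD.integrable_energy hw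
  -- If the lift has norm `l ≤ M`, then `(l + ε)² ≤ l² + 2Mε + ε²`, and integrating `l²` gives the
  -- energy `a`. Letting `ε` tend to `0` concludes.
  have hle : ∀ ε > 0, flowDist H q q' ≤
      ENNReal.ofReal √(a + (2 * M * ε + ε ^ 2)) := by
    intro ε hε
    obtain ⟨v, hv, hφ, hvle⟩ := hH.exists_control hw hc hε
    refine (iInf_le_of_le v (iInf₂_le hv hφ)).trans ?_
    have hM0 : 0 ≤ M := (norm_nonneg _).trans (hM 0 (by simp))
    rw [Real.sqrt_eq_rpow, ← ENNReal.ofReal_rpow_of_nonneg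
      (add_nonneg (hD.energy_nonneg hw) (by positivity)) (by norm_num)]
    refine ENNReal.rpow_le_rpow ?_ (by norm_num)
    have hsum : a + (2 * M * ε + ε ^ 2) = ∫ t, (inner ℝ
        (metricMap n H (flatten n d q.pt + primitive w t) (w t)) (w t) +
          (2 * M * ε + ε ^ 2)) ∂unitMeasure := by
      rw [integral_add hint (integrable_const _)]
      simp [ha, domainEnergy]
    have hpt : ∀ t ∈ Icc (0 : ℝ) 1, ‖v t‖ ^ 2 ≤ inner ℝ
        (metricMap n H (flatten n d q.pt + primitive w t) (w t)) (w t) +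
          (2 * M * ε + ε ^ 2) := by
      intro t ht
      rw [← hH.norm_horizontalLift_sq (hw.mem t ht)]
      have h1 := hvle t ht
      have h2 := hM t ht
      set l := ‖horizontalLift n H (flatten n d q.pt + primitive w t) (w t)‖
      calc ‖v t‖ ^ 2 ≤ (l + ε) ^ 2 := by gcongr
        _ ≤ _ := by nlinarith
    have hint' : Integrable (fun t => inner ℝ
        (metricMap n H (flatten n d q.pt + primitive w t) (w t)) (w t) +
          (2 * M * ε + ε ^ 2)) unitMeasure := hint.add (integrable_const _)
    rw [hsum, controlEnergy, Measure.restrict_congr_set Ioc_ae_eq_Icc.symm,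
      ofReal_integral_eq_lintegral_ofReal hint']
    · refine lintegral_mono_ae ?_
      filter_upwards [ae_unit_mem] with t ht
      rw [← ofReal_norm, ← ENNReal.ofReal_pow (norm_nonneg _)]
      exact ENNReal.ofReal_le_ofReal (hpt t ht)
    · filter_upwards [ae_unit_mem] with t ht
      exact (sq_nonneg _).trans (hpt t ht)
  have hlim : Filter.Tendsto (fun ε : ℝ => ENNReal.ofReal √(a + (2 * M * ε + ε ^ 2))) (𝓝[>] 0)
      (𝓝 (ENNReal.ofReal √a)) := by
    have hcont : Continuous fun ε : ℝ => ENNReal.ofReal √(a + (2 * M * ε + ε ^ 2)) :=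
      ENNReal.continuous_ofReal.comp (by fun_prop)
    have := (hcont.tendsto 0).mono_left (nhdsWithin_le_nhds (s := Ioi 0))
    simpa using this
  exact ge_of_tendsto hlim (Filter.eventually_of_mem self_mem_nhdsWithin hle)

theorem IsAdmissible.flowDist_eq_geodesicDist (hH : IsAdmissible d 2 H) :
    (flowDist H : Landmarks n d → Landmarks n d → ℝ≥0∞) = geodesicDist H :=
  funext fun q => funext fun q' =>
    le_antisymm (hH.flowDist_le_geodesicDist q q') (hH.geodesicDist_le_flowDist q q')

end Control

end

theorem mainTheorem5 (n d : ℕ) (H : Type*) [NormedAddCommGroup H] [InnerProductSpace ℝ H]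
    [CompleteSpace H] [RKHS ℝ H (Eucl d) (Eucl d)] (hH : IsAdmissible d 2 H) :
    -- completeness of the distance induced by the diffeomorphism group
    (IsCompleteEMetric (flowDist H : Landmarks n d → Landmarks n d → ℝ≥0∞) ∧
      (∀ q q' : Landmarks n d,
        flowDist H q q' ≠ ⊤ ↔ JoinedIn (landmarkSet n d) q.pt q'.pt) ∧
      (2 ≤ d ∨ n ≤ 1 →
        IsCompleteMetric (flowDist H : Landmarks n d → Landmarks n d → ℝ≥0∞))) ∧
    -- completeness of the geodesic distance of the landmark metric
    (IsCompleteEMetric (geodesicDist H : Landmarks n d → Landmarks n d → ℝ≥0∞) ∧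
      (∀ q q' : Landmarks n d,
        geodesicDist H q q' ≠ ⊤ ↔ JoinedIn (landmarkSet n d) q.pt q'.pt) ∧
      (2 ≤ d ∨ n ≤ 1 →
        IsCompleteMetric (geodesicDist H : Landmarks n d → Landmarks n d → ℝ≥0∞))) ∧
    -- existence of energy minimizers
    (∀ q q' : Landmarks n d, 2 ≤ d ∨ JoinedIn (landmarkSet n d) q.pt q'.pt →
      ∃ γ : ℝ → Fin n → Eucl d, IsLandmarkPath q q' γ ∧
        ∀ η : ℝ → Fin n → Eucl d, IsLandmarkPath q q' η → pathEnergy H γ ≤ pathEnergy H η) := by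
  have hE : IsCompleteEMetric (geodesicDist H : Landmarks n d → Landmarks n d → ℝ≥0∞) :=
    hH.isCompleteEMetric_geodesicDist
  have hM : 2 ≤ d ∨ n ≤ 1 →
      IsCompleteMetric (geodesicDist H : Landmarks n d → Landmarks n d → ℝ≥0∞) := fun h =>
    hE.isCompleteMetric fun q q' =>
      (hH.geodesicDist_ne_top_iff q q').2 (joinedIn_landmarkSet h q.mem q'.mem)
  -- The two distances are the same function, so the results for the geodesic distance serve both
  -- parts.
  rw [hH.flowDist_eq_geodesicDist]
  exact ⟨⟨hE, hH.geodesicDist_ne_top_iff, hM⟩, ⟨hE, hH.geodesicDist_ne_top_iff, hM⟩,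
    fun q q' h => hH.exists_minimizing_path
      (h.elim (fun hd => joinedIn_landmarkSet (.inl hd) q.mem q'.mem) id)⟩
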